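/- A planning instance $(V,I,G,A)$ consists of a finite set $V$ of variables $v$ with finite domains $D(v)$, an initial state $I$ (a total assignment $v\mapsto I(v)\in D(v)$), a goal $G$ (a partial assignment with values in the domains) and a finite set $A$ of actions, each being a pair (precondition, postcondition) of partial assignments. Applying an action to a state that agrees with its precondition overwrites the state with its postcondition; applying it to any other state changes nothing. A solution plan is a sequence of actions whose successive application to $I$ leads to a state that agrees with $G$. An instance of $\mathrm{PlanMod}$ consists of a planning instance $(V,I,G,A)$, a stored case, that is, a planning instance $(V,J,H,A)$ with a solution plan $c$ of it, a subset $A'\subseteq A$ and an integer $M\ge 0$ (integers are written in binary). The question is whether there is a sequence $g=(g_1,\dots,g_m)\in(A')^m$ with $m\le M$ and an interleaving $p$ of the sequences $c$ and $g$ that is a solution plan of $(V,I,G,A)$; no condition is imposed on the states visited. In $\mathrm{PlanMod}^\star$ the question is whether the same holds with some infix $c'$ of $c$ (possibly empty) in place of $c$. For $R\subseteq\{L,V,D,A\}$, the parameter of the problems $R$-$\mathrm{PlanMod}$ and $R$-$\mathrm{PlanMod}^\star$ is the sum of those of the following quantities whose symbol is in $R$: $M$ (for $L$), the number of variables mentioned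 in the actions of $A'$ (for $V$), the number of values mentioned in the actions of $A'$ (for $D$), and $|A'|$ (for $A$). An fpt-reduction between parameterized problems maps instances with parameter $k$ and size $n$ to equivalent instances with parameter at most $g(k)$, in time at most $f(k)\,n^{c}$, for computable $f,g$ and a constant $c$; $\mathrm{FPT}$ is the class of parameterized problems decidable within such a time bound. $\mathrm{W[P]}$ is the class of parameterized problems that are fpt-reducible to weighted circuit satisfiability (given a Boolean circuit and the parameter $k\ge1$, is there a satisfying assignment that sets at most $k$ input nodes to true?). A problem is $\mathrm{W[P]}$-hard if every problem in $\mathrm{W[P]}$ is fpt-reducible to it, and $\mathrm{W[P]}$-complete if it is moreover in $\mathrm{W[P]}$. Theorem. The problem $\{L,V,D,A\}$-$\mathrm{PlanMod}$ is $\mathrm{W[P]}$-complete. Moreover, every variant is fixed-parameter intractable: for every $R\subseteq\{L,V,D,A\}$, both $R$-$\mathrm{PlanMod}$ and $R$-$\mathrm{PlanMod}^\star$ are $\mathrm{W[P]}$-hard, and if one of these problems is in $\mathrm{FPT}$, then $\mathrm{W[P]}\subseteq\mathrm{FPT}$. -/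

import Mathlib

namespace PlanReuse

/-! ## Machine model

WHILE programs over binary trees. Trees are the universal data type: they code numbers, lists and
all finite objects. Every value that an expression produces is charged with its full size (values
are copied, never shared), so running times agree with those of multi-tape Turing machines up to
a polynomial. -/

/-- Binary trees. -/
inductive Data where
  | nil : Data
  | cons : Data → Data → Data
deriving DecidableEq

namespace Data

/-- The number of nodes of a tree; always at least `1`. -/
def size : Data → ℕ
  | nil => 1
  | cons a b => 1 + a.size + b.size

/-- The left subtree. -/
def head : Data → Data
  | nil => nil
  | cons a _ => a

/-- The right subtree. -/
def tail : Data → Data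
  | nil => nil
  | cons _ b => b

end Data

/-- A store assigns a tree to every program variable (numbered by `ℕ`). -/
abbrev Store := ℕ → Data

/-- Expressions; `eq` tests two trees for equality. -/
inductive Expr where
  | var : ℕ → Expr
  | nil : Expr
  | cons : Expr → Expr → Expr
  | head : Expr → Expr
  | tail : Expr → Expr
  | eq : Expr → Expr → Expr

namespace Expr

/-- The value of an expression; `nil` stands for "false", `cons nil nil` for "true". -/
def value (s : Store) : Expr → Data
  | var i => s i
  | nil => Data.nil
  | cons e₁ e₂ => Data.cons (e₁.value s) (e₂.value s)
  | head e => (e.value s).head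
  | tail e => (e.value s).tail
  | eq e₁ e₂ => if e₁.value s = e₂.value s then Data.cons Data.nil Data.nil else Data.nil

/-- The cost of evaluating an expression: the total size of the values of all subexpressions. -/
def cost (s : Store) : Expr → ℕ
  | var i => (s i).size
  | nil => 1
  | cons e₁ e₂ => e₁.cost s + e₂.cost s + ((cons e₁ e₂).value s).size
  | head e => e.cost s + ((head e).value s).size
  | tail e => e.cost s + ((tail e).value s).size
  | eq e₁ e₂ => e₁.cost s + e₂.cost s + ((eq e₁ e₂).value s).size

end Expr

/-- Programs. -/
inductive Prog where
  | skip : Prog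
  | assign : ℕ → Expr → Prog
  | seq : Prog → Prog → Prog
  | ite : Expr → Prog → Prog → Prog
  | while : Expr → Prog → Prog

/-- `Runs p s t s'`: started in the store `s`, the program `p` halts after exactly `t` time units
in the store `s'`. A test succeeds when its value is not `nil`. -/
inductive Runs : Prog → Store → ℕ → Store → Prop where
  | skip (s : Store) : Runs Prog.skip s 1 s
  | assign (i : ℕ) (e : Expr) (s : Store) :
      Runs (Prog.assign i e) s (1 + e.cost s) (Function.update s i (e.value s))
  | seq {p q : Prog} {s s' s'' : Store} {t t' : ℕ} :
      Runs p s t s' → Runs q s' t' s'' → Runs (Prog.seq p q) s (t + t') s''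
  | ite_true {e : Expr} {p q : Prog} {s s' : Store} {t : ℕ} :
      e.value s ≠ Data.nil → Runs p s t s' → Runs (Prog.ite e p q) s (1 + e.cost s + t) s'
  | ite_false {e : Expr} {p q : Prog} {s s' : Store} {t : ℕ} :
      e.value s = Data.nil → Runs q s t s' → Runs (Prog.ite e p q) s (1 + e.cost s + t) s'
  | while_true {e : Expr} {p : Prog} {s s' s'' : Store} {t t' : ℕ} :
      e.value s ≠ Data.nil → Runs p s t s' → Runs (Prog.while e p) s' t' s'' →
        Runs (Prog.while e p) s (1 + e.cost s + t + t') s''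
  | while_false {e : Expr} {p : Prog} {s : Store} :
      e.value s = Data.nil → Runs (Prog.while e p) s (1 + e.cost s) s

/-- The initial store: the input is in variable `0`, all other variables hold `nil`. -/
def inputStore (d : Data) : Store := fun i => if i = 0 then d else Data.nil

/-- On input `d` the program `p` halts within `t` time units and leaves the output `d'` in
variable `0`. -/
def OutputsWithin (p : Prog) (d d' : Data) (t : ℕ) : Prop :=
  ∃ t' ≤ t, ∃ s' : Store, Runs p (inputStore d) t' s' ∧ s' 0 = d'

/-! ## Codings of finite objects by trees -/

/-- An injective coding by trees. -/
class Coding (α : Type) where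
  code : α → Data
  code_injective : Function.Injective code

/-- `false` is coded by `nil` and `true` by `cons nil nil`. -/
instance : Coding Bool where
  code b := if b then Data.cons Data.nil Data.nil else Data.nil
  code_injective := by
    intro a b h
    cases a <;> cases b <;> simp_all

/-- A pair is coded by a node with the two components below it. -/
instance {α β : Type} [Coding α] [Coding β] : Coding (α × β) where
  code x := Data.cons (Coding.code x.1) (Coding.code x.2)
  code_injective := by
    rintro ⟨a, b⟩ ⟨a', b'⟩ h
    simp only [Data.cons.injEq] at h
    rw [Coding.code_injective h.1, Coding.code_injective h.2]

/-- `none` is coded by `nil`, and `some x` by a node over the code of `x`. -/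
instance {α : Type} [Coding α] : Coding (Option α) where
  code
    | none => Data.nil
    | some x => Data.cons (Coding.code x) Data.nil
  code_injective := by
    intro a b h
    cases a <;> cases b <;> simp at h ⊢
    exact Coding.code_injective h

/-- The code of a list: `nil` for the empty list, `cons` of head and tail otherwise. -/
def codeList {α : Type} [Coding α] : List α → Data
  | [] => Data.nil
  | x :: xs => Data.cons (Coding.code x) (codeList xs)

theorem codeList_injective {α : Type} [Coding α] :
    Function.Injective (codeList : List α → Data) := by
  intro l
  induction l with
  | nil => intro l' h; cases l' <;> simp [codeList] at h ⊢
  | cons x xs ih =>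
    intro l' h
    cases l' with
    | nil => simp [codeList] at h
    | cons y ys =>
      simp only [codeList, Data.cons.injEq] at h
      rw [Coding.code_injective h.1, ih h.2]

instance {α : Type} [Coding α] : Coding (List α) where
  code := codeList
  code_injective := codeList_injective

theorem bits_injective : Function.Injective Nat.bits := by
  intro a b h
  apply Nat.digits.injective 2
  rw [Nat.digits_two_eq_bits, Nat.digits_two_eq_bits, h]

/-- Numbers are coded in binary, least significant bit first. -/
instance : Coding ℕ where
  code n := codeList n.bits
  code_injective := codeList_injective.comp bits_injective

/-- A subtype is coded as the ambient type. -/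
instance {α : Type} [Coding α] (P : α → Prop) : Coding {x : α // P x} where
  code x := Coding.code x.1
  code_injective := Coding.code_injective.comp Subtype.val_injective

/-- A tuple is coded as the list of its entries. -/
instance {α : Type} [Coding α] (n : ℕ) : Coding (Fin n → α) where
  code f := codeList (List.ofFn f)
  code_injective := codeList_injective.comp List.ofFn_injective

/-! ## Parameterized problems -/

/-- A parameterized decision problem. Instances carry their parameter: a problem whose instances are
pairs `(I, k)` has the type of these pairs as `Inst` and the second component as `param`. -/
structure ParamProblem where
  Inst : Type
  coding : Coding Inst
  param : Inst → ℕ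
  yes : Inst → Prop

/-- The code of an instance, as it is given to programs. -/
def ParamProblem.code (P : ParamProblem) (x : P.Inst) : Data := P.coding.code x

/-- The size `n` of an instance. -/
def ParamProblem.size (P : ParamProblem) (x : P.Inst) : ℕ := (P.code x).size

/-- `R` is an fpt-reduction from `P` to `Q`. -/
def IsFptReduction (P Q : ParamProblem) (R : P.Inst → Q.Inst) : Prop :=
  (∀ x, P.yes x ↔ Q.yes (R x)) ∧
  (∃ g : ℕ → ℕ, Computable g ∧ ∀ x, Q.param (R x) ≤ g (P.param x)) ∧
  (∃ (p : Prog) (f : ℕ → ℕ) (c : ℕ), Computable f ∧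
    ∀ x, OutputsWithin p (P.code x) (Q.code (R x)) (f (P.param x) * P.size x ^ c))

/-- `P` is fpt-reducible to `Q`. -/
def FptReducible (P Q : ParamProblem) : Prop :=
  ∃ R : P.Inst → Q.Inst, IsFptReduction P Q R

/-- `P` is fixed-parameter tractable: it is decided in time `f(k) * n ^ c`. -/
def InFPT (P : ParamProblem) : Prop :=
  ∃ (p : Prog) (f : ℕ → ℕ) (c : ℕ), Computable f ∧
    ∀ x, ∃ b : Bool, (b = true ↔ P.yes x) ∧
      OutputsWithin p (P.code x) (Coding.code b) (f (P.param x) * P.size x ^ c)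

/-! ## Weighted circuit satisfiability and the class W[P] -/

/-- A node of a Boolean circuit: an input node, or a gate with the numbers of the nodes that feed
it. Conjunctions and disjunctions have unbounded fan-in. -/
inductive Node where
  | input : Node
  | neg : ℕ → Node
  | conj : List ℕ → Node
  | disj : List ℕ → Node

namespace Node

/-- The nodes that feed a node. -/
def preds : Node → List ℕ
  | input => []
  | neg i => [i]
  | conj l => l
  | disj l => l

/-- The value of a node, given the value `b` that it has if it is an input node, and the values `v`
of the nodes that feed it. -/
def eval (b : Bool) (v : ℕ → Bool) : Node → Bool
  | input => b
  | neg i => !(v i)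
  | conj l => l.all v
  | disj l => l.any v

/-- The kind of a node and the nodes that feed it, as a pair. -/
def toPair : Node → ℕ × List ℕ
  | input => (0, [])
  | neg i => (1, [i])
  | conj l => (2, l)
  | disj l => (3, l)

theorem toPair_injective : Function.Injective toPair := by
  intro a b h
  cases a <;> cases b <;> simp_all [toPair]

instance : Coding Node where
  code x := Coding.code x.toPair
  code_injective := Coding.code_injective.comp toPair_injective

end Node

/-- A Boolean circuit: the list of its nodes in a topological order, and its output node. -/
structure Circuit where
  nodes : List Node
  acyclic : ∀ (i : ℕ) (h : i < nodes.length), ∀ j ∈ (nodes[i]).preds, j < i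
  output : ℕ
  output_lt : output < nodes.length

namespace Circuit

/-- The values of the first `n` nodes under the assignment `α` (where `α i` is the value of node
`i` if this is an input node). -/
def values (C : Circuit) (α : ℕ → Bool) : ℕ → ℕ → Bool
  | 0 => fun _ => false
  | n + 1 => Function.update (C.values α n) n
      (((C.nodes[n]?).getD Node.input).eval (α n) (C.values α n))

/-- The assignment `α` to the input nodes satisfies the circuit. -/
def Satisfies (C : Circuit) (α : ℕ → Bool) : Prop :=
  C.values α C.nodes.length C.output = true

/-- The number of input nodes that `α` sets to true. -/
noncomputable def weight (C : Circuit) (α : ℕ → Bool) : ℕ :=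
  {i : ℕ | C.nodes[i]? = some Node.input ∧ α i = true}.ncard

end Circuit

/-- Instances of weighted circuit satisfiability: a circuit and an integer `k ≥ 1`. -/
structure WSatInstance where
  circuit : Circuit
  k : ℕ
  k_pos : 1 ≤ k

instance : Coding WSatInstance where
  code x := Coding.code (x.circuit.nodes, x.circuit.output, x.k)
  code_injective := by
    rintro ⟨⟨a, _, b, _⟩, k, _⟩ ⟨⟨a', _, b', _⟩, k', _⟩ h
    have h' := Coding.code_injective h
    simp only [Prod.mk.injEq] at h'
    obtain ⟨rfl, rfl, rfl⟩ := h'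
    rfl

/-- Weighted circuit satisfiability, with parameter `k`: is there a satisfying assignment that sets
at most `k` input nodes to true? -/
def weightedCircuitSat : ParamProblem where
  Inst := WSatInstance
  coding := inferInstance
  param x := x.k
  yes x := ∃ α : ℕ → Bool, x.circuit.Satisfies α ∧ x.circuit.weight α ≤ x.k

/-- The class W[P]: the problems that are fpt-reducible to weighted circuit satisfiability. -/
def InWP (P : ParamProblem) : Prop := FptReducible P weightedCircuitSat

/-- `Q` is W[P]-hard: every problem in W[P] is fpt-reducible to it. -/
def WPHard (Q : ParamProblem) : Prop := ∀ P : ParamProblem, InWP P → FptReducible P Q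

/-- `Q` is W[P]-complete. -/
def WPComplete (Q : ParamProblem) : Prop := InWP Q ∧ WPHard Q

/-! ## Planning -/

/-- A finite set of variables, numbered from `0`, each with a finite domain of values. Values are
natural numbers, and different variables may share values. -/
structure Frame where
  numVars : ℕ
  dom : Fin numVars → List ℕ

namespace Frame

/-- A state assigns to every variable a value of its domain. -/
abbrev State (F : Frame) : Type := {s : Fin F.numVars → ℕ // ∀ v, s v ∈ F.dom v}

/-- A partial state assigns to some of the variables a value of their domain (and `none` to the
other variables). -/
abbrev PartialState (F : Frame) : Type :=
  {p : Fin F.numVars → Option ℕ // ∀ v, ∀ d, p v = some d → d ∈ F.dom v}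

/-- An action consists of a precondition and a postcondition. -/
abbrev Action (F : Frame) : Type := F.PartialState × F.PartialState

variable {F : Frame}

/-- The precondition of an action. -/
abbrev Action.pre (a : F.Action) : F.PartialState := a.1

/-- The postcondition of an action. -/
abbrev Action.post (a : F.Action) : F.PartialState := a.2

/-- The restriction of the state `s` to the variables of `p` is `p`. -/
def Meets (s : F.State) (p : F.PartialState) : Prop :=
  ∀ v d, p.1 v = some d → s.1 v = d

/-- The state obtained from `s` by overwriting it with the partial state `p`. -/
def overwrite (s : F.State) (p : F.PartialState) : F.State :=
  ⟨fun v => (p.1 v).getD (s.1 v), by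
    intro v
    have hs := s.2 v
    have hp := p.2 v
    dsimp only
    cases h : p.1 v with
    | none => exact hs
    | some d => exact hp d h⟩

open Classical in
/-- Application of an action. An action that is not applicable does not change the state. -/
noncomputable def step (s : F.State) (a : F.Action) : F.State :=
  if Meets s (Action.pre a) then overwrite s (Action.post a) else s

/-- The state `s[p]` that results from applying the plan `p` to the state `s`. -/
noncomputable def run (s : F.State) (p : List F.Action) : F.State := p.foldl step s

end Frame

/-- `Interleaving c g p`: the sequence `p` is divided into the two subsequences `c` and `g`. -/
inductive Interleaving {α : Type} : List α → List α → List α → Prop where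
  | nil : Interleaving [] [] []
  | left {x : α} {c g p : List α} : Interleaving c g p → Interleaving (x :: c) g (x :: p)
  | right {x : α} {c g p : List α} : Interleaving c g p → Interleaving c (x :: g) (x :: p)

/-- An instance of plan reuse: a planning instance `(V, I, G, A)`, a case consisting of a planning
instance `(V, J, H, A)` and a solution plan `c` of it, a subset `A'` of `A`, and an integer `M`.
Finite sets are given by lists. -/
structure PlanModInstance where
  frame : Frame
  init : frame.State
  goal : frame.PartialState
  actions : List frame.Action
  caseInit : frame.State
  caseGoal : frame.PartialState
  casePlan : List frame.Action
  casePlan_subset : ∀ a ∈ casePlan, a ∈ actions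
  casePlan_solves : Frame.Meets (Frame.run caseInit casePlan) caseGoal
  glue : List frame.Action
  glue_subset : ∀ a ∈ glue, a ∈ actions
  maxSteps : ℕ

instance : Coding PlanModInstance where
  code x := Coding.code
    (List.ofFn x.frame.dom, (x.init, x.goal, x.actions),
      (x.caseInit, x.caseGoal, x.casePlan), x.glue, x.maxSteps)
  code_injective := by
    rintro ⟨⟨n, D⟩, I, G, A, J, H, c, _, _, A', _, M⟩
      ⟨⟨n', D'⟩, I', G', A₂, J', H', c', _, _, A₂', _, M'⟩ h
    have h0 : Coding.code (List.ofFn D) = Coding.code (List.ofFn D') := (Data.cons.inj h).1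
    have h1 := List.ofFn_inj'.1 (Coding.code_injective h0)
    obtain ⟨rfl, h2⟩ := Sigma.mk.inj h1
    obtain rfl := eq_of_heq h2
    have h' := Coding.code_injective h
    simp only [Prod.mk.injEq] at h'
    obtain ⟨-, ⟨rfl, rfl, rfl⟩, ⟨rfl, rfl, rfl⟩, rfl, rfl⟩ := h'
    rfl

namespace PlanModInstance

/-- Reuse of the sequence of actions `c`: at most `M` occurrences of actions of `A'` can be
interleaved with `c` so that a solution plan of `(V, I, G, A)` results. -/
def Reusable (x : PlanModInstance) (c : List x.frame.Action) : Prop :=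
  ∃ g p : List x.frame.Action, g.length ≤ x.maxSteps ∧ (∀ a ∈ g, a ∈ x.glue) ∧
    Interleaving c g p ∧ Frame.Meets (Frame.run x.init p) x.goal

/-- The number of variables that are mentioned in the actions of `A'`. -/
noncomputable def numGlueVars (x : PlanModInstance) : ℕ :=
  {v | ∃ a ∈ x.glue, ∃ d, (Frame.Action.pre a).1 v = some d ∨
    (Frame.Action.post a).1 v = some d}.ncard

/-- The number of values that are mentioned in the actions of `A'`. -/
noncomputable def numGlueValues (x : PlanModInstance) : ℕ :=
  {d | ∃ a ∈ x.glue, ∃ v, (Frame.Action.pre a).1 v = some d ∨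
    (Frame.Action.post a).1 v = some d}.ncard

/-- The number of actions in `A'`. -/
noncomputable def numGlueActions (x : PlanModInstance) : ℕ := {a | a ∈ x.glue}.ncard

end PlanModInstance

/-- The four restrictions: number of glue steps, and number of variables, of values and of actions
of `A'`. -/
inductive Restriction where
  | L | V | D | A
deriving DecidableEq

/-- The parameter for the set `R` of restrictions: the sum of the quantities named by `R`. -/
noncomputable def parameter (R : Finset Restriction) (x : PlanModInstance) : ℕ :=
  ∑ r ∈ R, match r with
    | Restriction.L => x.maxSteps
    | Restriction.V => x.numGlueVars
    | Restriction.D => x.numGlueValues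
    | Restriction.A => x.numGlueActions

/-- `R`-PlanMod: the stored plan is reused as a whole. -/
noncomputable def planMod (R : Finset Restriction) : ParamProblem where
  Inst := PlanModInstance
  coding := inferInstance
  param := parameter R
  yes x := x.Reusable x.casePlan

/-- `R`-PlanMod*: some infix of the stored plan is reused (any number of actions may be discarded
from its beginning and from its end). -/
noncomputable def planModStar (R : Finset Restriction) : ParamProblem where
  Inst := PlanModInstance
  coding := inferInstance
  param := parameter R
  yes x := ∃ c : List x.frame.Action, c <:+: x.casePlan ∧ x.Reusable c

end PlanReuse

/-! Hardness. One map reduces weighted circuit satisfiability to all the variants at once. The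
stored plan evaluates the circuit node by node, in topological order, on 0/1 variables that are
initially 0. A gate is evaluated by actions that set its variable to 1 when a guard on earlier nodes
holds; an input node is evaluated by an action that moves a token from one extra variable to the
node. The only glue action puts a token into that extra variable. The variable holds at most one
token and moving consumes it, so the true inputs are paid for by distinct glue steps
(`Guess.run_input`, `Guess.Inv`), and reuse with at most `k` glue steps amounts to a satisfying
assignment of weight at most `k` (`Guess.reusable_iff`). Two flags, set by the first and the last
action, make every proper infix of the plan useless (`Guess.eq_plan_of_run`), so the same instance
works when infixes are allowed. There is one glue action, with one variable and one value, so the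
parameter is at most `k + 3` for every `R` (`Guess.parameter_le`).

Membership when `L` is in `R`. Put into every gap of the stored plan `M` copies of the list of all
glue actions, as optional steps; any sequence of at most `M` glue actions then fits into any gap
(`Unfold.sel_slots_iff`). A circuit simulates the resulting sequence: it has an input node for each
optional step and, at each time, a node for each assignment of a value to a variable
(`Unfold.values_fluent`). The weight of an assignment counts the optional steps taken. The circuit
has size polynomial in the instance size plus `M`, which is an fpt bound because `M` is at most the
parameter.

Intractability follows because fpt-reductions compose and preserve membership in FPT.

The time bounds rest on a small calculus of polynomial-time functions (`Comp`, `TimeBdd`, `PTime`),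
closed under pairing, branching and folds over lists with bounded intermediate results. It is
applied to instances rewritten as plain nested lists with the same codes. -/

namespace PlanReuse

/-! ## Time-bounded runs -/

namespace Data

theorem size_pos (d : Data) : 1 ≤ d.size := by cases d <;> simp [size]; omega

theorem size_head_le (d : Data) : d.head.size ≤ d.size := by
  cases d <;> simp [head, size]; omega

theorem size_tail_le (d : Data) : d.tail.size ≤ d.size := by
  cases d <;> simp [tail, size]

end Data

namespace Expr

/-- All variables of the expression are below `bound`. -/
def bound : Expr → ℕ
  | var i => i + 1
  | nil => 0
  | cons e₁ e₂ => max e₁.bound e₂.bound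
  | head e => e.bound
  | tail e => e.bound
  | eq e₁ e₂ => max e₁.bound e₂.bound

theorem value_cost_congr {s s₂ : Store} (e : Expr) (h : ∀ i < e.bound, s₂ i = s i) :
    e.value s₂ = e.value s ∧ e.cost s₂ = e.cost s := by
  induction e with
  | var i => simp [value, cost, h i (by simp [bound])]
  | nil => simp [value, cost]
  | cons a b iha ihb =>
    obtain ⟨h1, h2⟩ := iha fun i hi => h i (by simp only [bound]; omega)
    obtain ⟨h3, h4⟩ := ihb fun i hi => h i (by simp only [bound]; omega)
    simp [value, cost, h1, h2, h3, h4]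
  | head a ih => obtain ⟨h1, h2⟩ := ih h; simp [value, cost, h1, h2]
  | tail a ih => obtain ⟨h1, h2⟩ := ih h; simp [value, cost, h1, h2]
  | eq a b iha ihb =>
    obtain ⟨h1, h2⟩ := iha fun i hi => h i (by simp only [bound]; omega)
    obtain ⟨h3, h4⟩ := ihb fun i hi => h i (by simp only [bound]; omega)
    simp [value, cost, h1, h2, h3, h4]

theorem size_value_le_cost (s : Store) (e : Expr) : (e.value s).size ≤ e.cost s := by
  cases e <;> simp only [cost, value, Data.size] <;> omega

/-- The constant expression with value `d`. -/
def ofData : Data → Expr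
  | Data.nil => nil
  | Data.cons a b => cons (ofData a) (ofData b)

theorem value_ofData (s : Store) (d : Data) : (ofData d).value s = d := by
  induction d with
  | nil => rfl
  | cons a b iha ihb => simp [ofData, value, iha, ihb]

theorem bound_ofData (d : Data) : (ofData d).bound = 0 := by
  induction d with
  | nil => rfl
  | cons a b iha ihb => simp [ofData, bound, iha, ihb]

end Expr

namespace Prog

/-- All variables of the program are below `bound`. -/
def bound : Prog → ℕ
  | skip => 0
  | assign i e => max (i + 1) e.bound
  | seq p q => max p.bound q.bound
  | ite e p q => max e.bound (max p.bound q.bound)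
  | .while e p => max e.bound p.bound

/-- Set the variables `1, …, n` to `nil`. -/
def clear : ℕ → Prog
  | 0 => skip
  | n + 1 => seq (clear n) (assign (n + 1) Expr.nil)

/-- Run `p` on the content of variable `0`, with scratch variables up to `n`. -/
def call (n : ℕ) (p : Prog) : Prog := seq (clear n) p

end Prog

/-- Values and costs depend only on variables that occur in the program, and only those are written.
This is what allows a program to serve as a subroutine while data is kept in higher variables. -/
theorem Runs.frame {p : Prog} {s s' : Store} {t : ℕ} (h : Runs p s t s') {N : ℕ}
    (hN : p.bound ≤ N) {s₂ : Store} (hs : ∀ i < N, s₂ i = s i) :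
    ∃ s₂', Runs p s₂ t s₂' ∧ (∀ i < N, s₂' i = s' i) ∧ ∀ i, N ≤ i → s₂' i = s₂ i := by
  induction h generalizing s₂ with
  | skip s => exact ⟨s₂, Runs.skip _, hs, fun _ _ => rfl⟩
  | assign i e s =>
    simp only [Prog.bound] at hN
    obtain ⟨h1, h2⟩ := e.value_cost_congr fun i hi => hs i (by omega)
    refine ⟨_, h2 ▸ Runs.assign i e s₂, fun j hj => ?_, fun j hj => ?_⟩
    · by_cases hji : j = i
      · subst hji; simp [h1]
      · simp [hji, hs j hj]
    · exact Function.update_of_ne (by omega) _ _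
  | seq _ _ ih1 ih2 =>
    simp only [Prog.bound] at hN
    obtain ⟨s₃, hr, h1, h2⟩ := ih1 (by omega) hs
    obtain ⟨s₄, hr', h3, h4⟩ := ih2 (by omega) h1
    exact ⟨s₄, hr.seq hr', h3, fun i hi => (h4 i hi).trans (h2 i hi)⟩
  | @ite_true e p q _ _ _ hv _ ih =>
    simp only [Prog.bound] at hN
    obtain ⟨h1, h2⟩ := e.value_cost_congr fun i hi => hs i (by omega)
    obtain ⟨s₃, hr, h⟩ := ih (by omega) hs
    exact ⟨s₃, h2 ▸ Runs.ite_true (h1 ▸ hv) hr, h⟩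
  | @ite_false e p q _ _ _ hv _ ih =>
    simp only [Prog.bound] at hN
    obtain ⟨h1, h2⟩ := e.value_cost_congr fun i hi => hs i (by omega)
    obtain ⟨s₃, hr, h⟩ := ih (by omega) hs
    exact ⟨s₃, h2 ▸ Runs.ite_false (h1 ▸ hv) hr, h⟩
  | @while_true e p _ _ _ _ _ hv _ _ ih1 ih2 =>
    have hN' := hN
    simp only [Prog.bound] at hN'
    obtain ⟨h1, h2⟩ := e.value_cost_congr fun i hi => hs i (by omega)
    obtain ⟨s₃, hr, h3, h4⟩ := ih1 (by omega) hs
    obtain ⟨s₄, hr', h5, h6⟩ := ih2 hN h3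
    exact ⟨s₄, h2 ▸ Runs.while_true (h1 ▸ hv) hr hr', h5, fun i hi => (h6 i hi).trans (h4 i hi)⟩
  | @while_false e p s hv =>
    simp only [Prog.bound] at hN
    obtain ⟨h1, h2⟩ := e.value_cost_congr fun i hi => hs i (by omega)
    exact ⟨s₂, h2 ▸ Runs.while_false (h1 ▸ hv), hs, fun _ _ => rfl⟩

/-- An assignment is charged with the full size of the value it stores. Time bounds therefore
control output sizes, which is needed whenever programs are composed. -/
theorem Runs.size_le {p : Prog} {s s' : Store} {t : ℕ} (h : Runs p s t s') (i : ℕ) :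
    (s' i).size ≤ (s i).size + t := by
  induction h with
  | skip s => omega
  | assign j e s =>
    have := e.size_value_le_cost s
    by_cases hj : i = j
    · subst hj; simp; omega
    · simp [hj]
  | _ => omega

/-- Started in `s`, the program `p` halts within `t` time units in a store that satisfies `Q`. -/
def Halts (p : Prog) (s : Store) (t : ℕ) (Q : Store → Prop) : Prop :=
  ∃ t' ≤ t, ∃ s', Runs p s t' s' ∧ Q s'

namespace Halts

theorem seq {p q : Prog} {s : Store} {t t' : ℕ} {Q Q' : Store → Prop} (h : Halts p s t Q)
    (h' : ∀ s', Q s' → Halts q s' t' Q') : Halts (Prog.seq p q) s (t + t') Q' := by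
  obtain ⟨t₁, ht₁, s₁, h₁, hQ⟩ := h
  obtain ⟨t₂, ht₂, s₂, h₂, hQ'⟩ := h' s₁ hQ
  exact ⟨t₁ + t₂, by omega, s₂, h₁.seq h₂, hQ'⟩

theorem mono {p : Prog} {s : Store} {t t' : ℕ} {Q Q' : Store → Prop} (h : Halts p s t Q)
    (ht : t ≤ t') (hQ : ∀ s', Q s' → Q' s') : Halts p s t' Q' := by
  obtain ⟨t₁, ht₁, s₁, h₁, h⟩ := h
  exact ⟨t₁, by omega, s₁, h₁, hQ _ h⟩

theorem assign {i : ℕ} {e : Expr} {s : Store} {Q : Store → Prop} {t : ℕ}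
    (ht : 1 + e.cost s ≤ t) (h : Q (Function.update s i (e.value s))) :
    Halts (Prog.assign i e) s t Q := ⟨_, ht, _, Runs.assign i e s, h⟩

theorem clear (n : ℕ) (s : Store) :
    Halts (Prog.clear n) s (1 + 2 * n) (fun s' => s' = fun i =>
      if 1 ≤ i ∧ i ≤ n then Data.nil else s i) := by
  induction n with
  | zero =>
    refine ⟨1, by omega, s, Runs.skip s, ?_⟩
    funext i
    exact (if_neg (by omega)).symm
  | succ n ih =>
    refine (ih.seq (t' := 2) ?_).mono (by omega) fun _ h => h
    rintro _ rfl
    refine Halts.assign (by simp [Expr.cost]) ?_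
    funext i
    by_cases hi : i = n + 1
    · subst hi; simp [Expr.value]
    · have : (1 ≤ i ∧ i ≤ n + 1) ↔ (1 ≤ i ∧ i ≤ n) := by omega
      simp [hi, this]

end Halts

theorem OutputsWithin.size_le {p : Prog} {d d' : Data} {t : ℕ} (h : OutputsWithin p d d' t) :
    d'.size ≤ d.size + t := by
  obtain ⟨t', ht', s', hr, rfl⟩ := h
  have := hr.size_le 0
  simp only [inputStore, if_true] at this
  omega

theorem OutputsWithin.mono {p : Prog} {d d' : Data} {t t' : ℕ} (h : OutputsWithin p d d' t)
    (ht : t ≤ t') : OutputsWithin p d d' t' := Halts.mono h ht fun _ h => h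

/-- After clearing, the low variables look like a fresh input store, so `Runs.frame` transfers the
run; everything above `N` survives the call. -/
theorem OutputsWithin.call {p : Prog} {d d' : Data} {t : ℕ} (h : OutputsWithin p d d' t) {N : ℕ}
    (hN : p.bound ≤ N) {s : Store} (hs : s 0 = d) :
    Halts (Prog.call N p) s (t + 2 * N + 1) (fun s' => s' 0 = d' ∧ ∀ i, N < i → s' i = s i) := by
  obtain ⟨t', ht', s', hr, rfl⟩ := h
  refine ((Halts.clear N s).seq (t' := t) ?_).mono (by omega) fun _ h => h
  rintro _ rfl
  have hs₂ : ∀ i < N + 1,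
      (fun i => if 1 ≤ i ∧ i ≤ N then Data.nil else s i) i = inputStore d i := by
    intro i hi
    by_cases h0 : i = 0
    · subst h0; simp [inputStore, hs]
    · have : 1 ≤ i ∧ i ≤ N := by omega
      simp [inputStore, h0, this]
  -- The frame bound is `N + 1` and not `N`, so that the output variable `0` is covered even if `N =
  -- 0`.
  obtain ⟨s₂, hr₂, h1, h2⟩ := hr.frame (by omega) hs₂
  exact ⟨t', ht', s₂, hr₂, h1 0 (by omega), fun i hi =>
    (h2 i (by omega)).trans (if_neg (by omega))⟩

theorem OutputsWithin.comp {p q : Prog} {d d' d'' : Data} {t t' : ℕ}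
    (h : OutputsWithin p d d' t) (h' : OutputsWithin q d' d'' t') :
    OutputsWithin (Prog.seq p (Prog.call q.bound q)) d d'' (t + (t' + 2 * q.bound + 1)) :=
  Halts.seq h fun _ hs' => (h'.call le_rfl hs').mono le_rfl fun _ h => h.1

/-! ## Polynomial bounds -/

/-- `T` is bounded by a polynomial in `μ`. -/
def PolyBdd {ι : Type} (μ T : ι → ℕ) : Prop := ∃ P : Polynomial ℕ, ∀ i, T i ≤ P.eval (μ i)

theorem polynomial_eval_mono (P : Polynomial ℕ) {a b : ℕ} (h : a ≤ b) : P.eval a ≤ P.eval b := by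
  induction P using Polynomial.induction_on' with
  | add p q hp hq => simp only [Polynomial.eval_add]; omega
  | monomial n c => simp only [Polynomial.eval_monomial]; gcongr

theorem polynomial_eval_le (P : Polynomial ℕ) {n : ℕ} (h : 1 ≤ n) :
    P.eval n ≤ P.eval 1 * n ^ P.natDegree := by
  rw [Polynomial.eval_eq_sum_range, Polynomial.eval_eq_sum_range, Finset.sum_mul]
  refine Finset.sum_le_sum fun i hi => ?_
  simp only [one_pow, mul_one]
  exact Nat.mul_le_mul_left _ (Nat.pow_le_pow_right h (by simpa [Nat.lt_succ_iff] using hi))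

namespace PolyBdd

variable {ι : Type} {μ T T' : ι → ℕ}

theorem mono (h : PolyBdd μ T) (h' : ∀ i, T' i ≤ T i) : PolyBdd μ T' := by
  obtain ⟨P, hP⟩ := h
  exact ⟨P, fun i => (h' i).trans (hP i)⟩

theorem refl : PolyBdd μ μ := ⟨Polynomial.X, fun i => by simp⟩

theorem const (c : ℕ) : PolyBdd μ (fun _ => c) := ⟨Polynomial.C c, fun i => by simp⟩

theorem add (h : PolyBdd μ T) (h' : PolyBdd μ T') : PolyBdd μ (fun i => T i + T' i) := by
  obtain ⟨P, hP⟩ := h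
  obtain ⟨Q, hQ⟩ := h'
  exact ⟨P + Q, fun i => by simpa using add_le_add (hP i) (hQ i)⟩

theorem mul (h : PolyBdd μ T) (h' : PolyBdd μ T') : PolyBdd μ (fun i => T i * T' i) := by
  obtain ⟨P, hP⟩ := h
  obtain ⟨Q, hQ⟩ := h'
  exact ⟨P * Q, fun i => by simpa using Nat.mul_le_mul (hP i) (hQ i)⟩

theorem eval (h : PolyBdd μ T) (P : Polynomial ℕ) : PolyBdd μ (fun i => P.eval (T i)) := by
  obtain ⟨Q, hQ⟩ := h
  exact ⟨P.comp Q, fun i => by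
    rw [Polynomial.eval_comp]; exact polynomial_eval_mono P (hQ i)⟩

theorem comp {κ : Type} {ν U : κ → ℕ} (h : PolyBdd ν U) (f : ι → κ)
    (hf : PolyBdd μ (fun i => ν (f i))) : PolyBdd μ (fun i => U (f i)) := by
  obtain ⟨P, hP⟩ := h
  exact (hf.eval P).mono fun i => hP (f i)

end PolyBdd

/-! ## Computations in polynomial time, relative to a measure -/

/-- One program computes `y i` from `x i`, for all `i`, in time polynomial in `μ i`. -/
def Comp {ι : Type} (μ : ι → ℕ) (x y : ι → Data) : Prop :=
  ∃ (p : Prog) (T : ι → ℕ), PolyBdd μ T ∧ ∀ i, OutputsWithin p (x i) (y i) (T i)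

namespace Comp

variable {ι : Type} {μ : ι → ℕ} {x y z : ι → Data}

theorem size (h : Comp μ x y) (hx : PolyBdd μ fun i => (x i).size) :
    PolyBdd μ fun i => (y i).size := by
  obtain ⟨p, T, hT, h⟩ := h
  exact (hx.add hT).mono fun i => (h i).size_le

theorem trans (h : Comp μ x y) (h' : Comp μ y z) : Comp μ x z := by
  obtain ⟨p, T, hT, h⟩ := h
  obtain ⟨q, U, hU, h'⟩ := h'
  exact ⟨_, _, hT.add ((hU.add (.const _)).add (.const 1)), fun i => (h i).comp (h' i)⟩

theorem refl : Comp μ x x :=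
  ⟨Prog.skip, _, .const 1, fun i => ⟨1, le_rfl, _, Runs.skip _, by simp [inputStore]⟩⟩

theorem expr (e : Expr) (hy : ∀ i, e.value (inputStore (x i)) = y i)
    (hc : PolyBdd μ fun i => e.cost (inputStore (x i))) : Comp μ x y :=
  ⟨Prog.assign 0 e, _, (PolyBdd.const 1).add hc, fun i => Halts.assign le_rfl (by simp [hy])⟩

theorem const (d : Data) : Comp μ x (fun _ => d) := by
  refine expr (Expr.ofData d) (fun i => Expr.value_ofData _ d) ?_
  refine (PolyBdd.const ((Expr.ofData d).cost (inputStore d))).mono fun i => ?_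
  refine (Expr.value_cost_congr _ fun j hj => ?_).2.le
  simp [Expr.bound_ofData] at hj

theorem head (hx : PolyBdd μ fun i => (x i).size) : Comp μ x (fun i => (x i).head) :=
  expr (Expr.head (Expr.var 0)) (fun i => by simp [Expr.value, inputStore])
    ((hx.add hx).mono fun i => by
      simpa [Expr.cost, Expr.value, inputStore] using Data.size_head_le _)

theorem tail (hx : PolyBdd μ fun i => (x i).size) : Comp μ x (fun i => (x i).tail) :=
  expr (Expr.tail (Expr.var 0)) (fun i => by simp [Expr.value, inputStore])
    ((hx.add hx).mono fun i => by
      simpa [Expr.cost, Expr.value, inputStore] using Data.size_tail_le _)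

theorem eq (hx : PolyBdd μ fun i => (x i).size) :
    Comp μ x (fun i => if (x i).head = (x i).tail then Data.cons Data.nil Data.nil else Data.nil) :=
  expr (Expr.eq (Expr.head (Expr.var 0)) (Expr.tail (Expr.var 0)))
    (fun i => by simp [Expr.value, inputStore])
    ((((hx.add hx).add (hx.add hx)).add (.const 3)).mono fun i => by
      have := Data.size_tail_le (x i)
      have := Data.size_head_le (x i)
      simp only [Expr.cost, Expr.value, inputStore, if_true]
      split_ifs <;> simp only [Data.size] <;> omega)

/-- Both programs are called in turn on variable `0`; the input waits in variable `N + 1` and the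
first result in variable `N + 2`. -/
theorem pair (hx : PolyBdd μ fun i => (x i).size) (h : Comp μ x y) (h' : Comp μ x z) :
    Comp μ x (fun i => Data.cons (y i) (z i)) := by
  have hy := h.size hx
  have hz := h'.size hx
  obtain ⟨p, T, hT, h⟩ := h
  obtain ⟨q, U, hU, h'⟩ := h'
  let N := max p.bound q.bound
  refine ⟨Prog.seq (Prog.assign (N + 1) (Expr.var 0)) (Prog.seq (Prog.call N p)
    (Prog.seq (Prog.assign (N + 2) (Expr.var 0)) (Prog.seq (Prog.assign 0 (Expr.var (N + 1)))
    (Prog.seq (Prog.call N q) (Prog.assign 0 (Expr.cons (Expr.var (N + 2)) (Expr.var 0))))))),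
    fun i => (1 + (x i).size) + ((T i + 2 * N + 1) + ((1 + (y i).size) + ((1 + (x i).size) +
      ((U i + 2 * N + 1) + (2 + 2 * ((y i).size + (z i).size)))))), ?_, fun i => ?_⟩
  · exact ((PolyBdd.const 1).add hx).add (((hT.add (.const _)).add (.const _)).add
      (((PolyBdd.const 1).add hy).add (((PolyBdd.const 1).add hx).add
      (((hU.add (.const _)).add (.const _)).add ((PolyBdd.const _).add
      ((PolyBdd.const 2).mul (hy.add hz)))))))
  · refine Halts.seq (Halts.assign (Q := fun s => s 0 = x i ∧ s (N + 1) = x i) ?_ ?_) ?_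
    · simp [Expr.cost, inputStore]
    · simp [Expr.value, inputStore]
    rintro s ⟨h0, h1⟩
    refine Halts.seq ((h i).call (le_max_left _ _) h0) ?_
    rintro s' ⟨h0', h1'⟩
    refine Halts.seq (Halts.assign (Q := fun s => s (N + 2) = y i ∧ s (N + 1) = x i) ?_ ?_) ?_
    · simp [Expr.cost, h0']
    · simp [Expr.value, h0', h1' (N + 1) (by omega), h1]
    rintro s ⟨h2, h1⟩
    refine Halts.seq (Halts.assign (Q := fun s => s (N + 2) = y i ∧ s 0 = x i) ?_ ?_) ?_
    · simp [Expr.cost, h1]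
    · simp [Expr.value, h1, h2]
    rintro s ⟨h2, h1⟩
    refine Halts.seq ((h' i).call (le_max_right _ _) h1) ?_
    rintro s' ⟨h0', h1'⟩
    refine Halts.assign ?_ ?_
    · simp only [Expr.cost, Expr.value, h0', h1' (N + 2) (by omega), h2, Data.size]; omega
    · simp [Expr.value, h0', h1' (N + 2) (by omega), h2]

theorem ite {c : ι → Data} (hx : PolyBdd μ fun i => (x i).size) (hc : Comp μ x c)
    (h : Comp μ x y) (h' : Comp μ x z) :
    Comp μ x (fun i => if c i = Data.nil then z i else y i) := by
  have hcs := hc.size hx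
  obtain ⟨r, V, hV, hc⟩ := hc
  obtain ⟨p, T, hT, h⟩ := h
  obtain ⟨q, U, hU, h'⟩ := h'
  let N := max r.bound (max p.bound q.bound)
  refine ⟨Prog.seq (Prog.assign (N + 1) (Expr.var 0)) (Prog.seq (Prog.call N r)
    (Prog.seq (Prog.assign (N + 2) (Expr.var 0)) (Prog.seq (Prog.assign 0 (Expr.var (N + 1)))
    (Prog.ite (Expr.var (N + 2)) (Prog.call N p) (Prog.call N q))))),
    fun i => (1 + (x i).size) + ((V i + 2 * N + 1) + ((1 + (c i).size) + ((1 + (x i).size) +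
      ((T i + U i + 2 * N + 1) + (1 + (c i).size))))), ?_, fun i => ?_⟩
  · exact ((PolyBdd.const 1).add hx).add (((hV.add (.const _)).add (.const _)).add
      (((PolyBdd.const 1).add hcs).add (((PolyBdd.const 1).add hx).add
      ((((hT.add hU).add (.const _)).add (.const _)).add ((PolyBdd.const _).add hcs)))))
  · refine Halts.seq (Halts.assign (Q := fun s => s 0 = x i ∧ s (N + 1) = x i) ?_ ?_) ?_
    · simp [Expr.cost, inputStore]
    · simp [Expr.value, inputStore]
    rintro s ⟨h0, h1⟩
    refine Halts.seq ((hc i).call (le_max_left _ _) h0) ?_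
    rintro s' ⟨h0', h1'⟩
    refine Halts.seq (Halts.assign (Q := fun s => s (N + 2) = c i ∧ s (N + 1) = x i) ?_ ?_) ?_
    · simp [Expr.cost, h0']
    · simp [Expr.value, h0', h1' (N + 1) (by omega), h1]
    rintro s ⟨h2, h1⟩
    refine Halts.seq (Halts.assign (Q := fun s => s (N + 2) = c i ∧ s 0 = x i) ?_ ?_) ?_
    · simp [Expr.cost, h1]
    · simp [Expr.value, h1, h2]
    rintro s ⟨h2, h1⟩
    by_cases hci : c i = Data.nil
    · obtain ⟨t, ht, s', hr, hs', -⟩ := (h' i).call (N := N) (by omega) h1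
      refine ⟨_, ?_, s', Runs.ite_false (by simp [Expr.value, h2, hci]) hr, by simp [hs', hci]⟩
      simp only [Expr.cost, h2]; omega
    · obtain ⟨t, ht, s', hr, hs', -⟩ := (h i).call (N := N) (by omega) h1
      refine ⟨_, ?_, s', Runs.ite_true (by simp [Expr.value, h2, hci]) hr, by simp [hs', hci]⟩
      simp only [Expr.cost, h2]; omega

/-- A while loop with the input in `N + 1`, the remaining list in `N + 2` and the accumulator in `N
+ 3`. Iterating a polynomial-time step may blow up the accumulator, so a polynomial bound `B` is
required on the result for every prefix of the list. -/
theorem fold {β σ : Type} [Coding β] [Coding σ] {l : ι → List β} {s₀ : ι → σ}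
    {g : ι → σ → β → σ} {p : Prog} {P : Polynomial ℕ} {B : ι → ℕ}
    (hx : PolyBdd μ fun i => (x i).size) (hl : Comp μ x fun i => codeList (l i))
    (hs₀ : Comp μ x fun i => Coding.code (s₀ i))
    (hg : ∀ i s b, OutputsWithin p (Data.cons (x i) (Data.cons (Coding.code s) (Coding.code b)))
      (Coding.code (g i s b)) (P.eval (2 + ((x i).size + (Coding.code s).size +
        (Coding.code b).size))))
    (hB : PolyBdd μ B)
    (hgB : ∀ i, ∀ l', l' <+: l i → (Coding.code (l'.foldl (g i) (s₀ i))).size ≤ B i) :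
    Comp μ x fun i => Coding.code ((l i).foldl (g i) (s₀ i)) := by
  have hls := hl.size hx
  obtain ⟨q, U, hU, hq⟩ := (Comp.refl (x := x)).pair hx (hl.pair hx hs₀)
  let N := max p.bound q.bound
  let body : Prog := Prog.seq (Prog.assign 0 (Expr.cons (Expr.var (N + 1))
    (Expr.cons (Expr.var (N + 3)) (Expr.head (Expr.var (N + 2))))))
    (Prog.seq (Prog.call N p) (Prog.seq (Prog.assign (N + 3) (Expr.var 0))
    (Prog.assign (N + 2) (Expr.tail (Expr.var (N + 2))))))
  -- Time of one iteration when the remaining list has code size at most `L`: the test, assembling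
  -- the argument, the call, storing the accumulator, and dropping the head of the list.
  let W : ι → ℕ → ℕ := fun i L => (1 + L) + ((4 + 4 * (x i).size + 4 * B i + 4 * L) +
    ((P.eval (2 + ((x i).size + B i + L)) + 2 * N + 1) + ((1 + B i) + (1 + (L + L)))))
  have loop : ∀ (i : ι) (L : ℕ) (m : List β) (acc : σ) (s : Store), s (N + 1) = x i →
      s (N + 2) = codeList m → s (N + 3) = Coding.code acc → (codeList m).size ≤ L →
      (∀ l', l' <+: m → (Coding.code (l'.foldl (g i) acc)).size ≤ B i) →
      Halts (Prog.while (Expr.var (N + 2)) body) s (m.length * W i L + (1 + L))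
        (fun s' => s' (N + 3) = Coding.code (m.foldl (g i) acc)) := by
    intro i L m
    induction m with
    | nil =>
      intro acc s h1 h2 h3 hL _
      exact ⟨_, by simp only [Expr.cost, h2]; omega, s,
        Runs.while_false (by simp [Expr.value, h2, codeList]), h3⟩
    | cons b m ih =>
      intro acc s h1 h2 h3 hL hB
      have hL' : 1 + (Coding.code b).size + (codeList m).size ≤ L := hL
      have hacc : (Coding.code acc).size ≤ B i := hB [] ⟨_, rfl⟩
      have hbody : Halts body s (W i L - (1 + L)) (fun s' => s' (N + 1) = x i ∧
          s' (N + 2) = codeList m ∧ s' (N + 3) = Coding.code (g i acc b)) := by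
        have : W i L - (1 + L) = (4 + 4 * (x i).size + 4 * B i + 4 * L) +
          ((P.eval (2 + ((x i).size + B i + L)) + 2 * N + 1) + ((1 + B i) + (1 + (L + L)))) := by
          simp only [W]; omega
        rw [this]
        refine Halts.seq (Halts.assign (Q := fun s' => s' 0 = Data.cons (x i)
          (Data.cons (Coding.code acc) (Coding.code b)) ∧ s' (N + 1) = x i ∧
          s' (N + 2) = codeList (b :: m)) ?_ ?_) ?_
        · simp only [Expr.cost, Expr.value, h1, h2, h3, Data.size, codeList, Data.head]; omega
        · simp [Expr.value, h1, h2, h3, codeList, Data.head]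
        rintro s ⟨h0, h1, h2⟩
        refine Halts.seq (((hg i acc b).mono (polynomial_eval_mono P
          (by omega : _ ≤ 2 + ((x i).size + B i + L)))).call (le_max_left _ _) h0) ?_
        rintro s' ⟨h0', h'⟩
        refine Halts.seq (Halts.assign (Q := fun s' => s' (N + 3) = Coding.code (g i acc b) ∧
          s' (N + 1) = x i ∧ s' (N + 2) = codeList (b :: m)) ?_ ?_) ?_
        · have := hB [b] (by simp)
          simp only [Expr.cost, h0', List.foldl_cons, List.foldl_nil] at this ⊢; omega
        · simp [Expr.value, h0', h' (N + 1) (by omega), h' (N + 2) (by omega), h1, h2]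
        rintro s ⟨h3, h1, h2⟩
        refine Halts.assign ?_ ?_
        · simp only [Expr.cost, Expr.value, h2, codeList, Data.size, Data.tail]; omega
        · simp [Expr.value, h1, h2, h3, codeList, Data.tail]
      obtain ⟨t₁, ht₁, s₁, hr₁, h1', h2', h3'⟩ := hbody
      obtain ⟨t₂, ht₂, s₂, hr₂, hs₂⟩ := ih (g i acc b) s₁ h1' h2' h3' (by omega)
        fun l' hl' => hB (b :: l') (by simpa using hl')
      refine ⟨_, ?_, s₂, Runs.while_true (by simp [Expr.value, h2, codeList]) hr₁ hr₂, hs₂⟩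
      have hW : 1 + L ≤ W i L := by simp only [W]; omega
      simp only [Expr.cost, h2, List.length_cons, Nat.succ_mul]
      omega
  refine ⟨Prog.seq q (Prog.seq (Prog.assign (N + 1) (Expr.head (Expr.var 0)))
    (Prog.seq (Prog.assign (N + 2) (Expr.head (Expr.tail (Expr.var 0))))
    (Prog.seq (Prog.assign (N + 3) (Expr.tail (Expr.tail (Expr.var 0))))
    (Prog.seq (Prog.while (Expr.var (N + 2)) body) (Prog.assign 0 (Expr.var (N + 3))))))),
    fun i => U i + ((4 * ((x i).size + (codeList (l i)).size + B i + 2)) +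
      ((4 * ((x i).size + (codeList (l i)).size + B i + 2)) +
      ((4 * ((x i).size + (codeList (l i)).size + B i + 2)) +
      (((codeList (l i)).size * W i (codeList (l i)).size + (1 + (codeList (l i)).size)) +
      (1 + B i))))), ?_, fun i => ?_⟩
  · have h4 := (PolyBdd.const (μ := μ) 4).mul (((hx.add hls).add hB).add (.const 2))
    refine hU.add (h4.add (h4.add (h4.add (PolyBdd.add ((hls.mul ?_).add
      ((PolyBdd.const 1).add hls)) ((PolyBdd.const 1).add hB)))))
    exact ((PolyBdd.const 1).add hls).add ((((((PolyBdd.const 4).add ((PolyBdd.const 4).mul hx)).add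
      ((PolyBdd.const 4).mul hB))).add ((PolyBdd.const 4).mul hls)).add
      ((((((PolyBdd.const 2).add ((hx.add hB).add hls)).eval P).add (.const _)).add (.const _)).add
      (((PolyBdd.const 1).add hB).add ((PolyBdd.const 1).add (hls.add hls)))))
  · have hs := hgB i [] ⟨_, rfl⟩
    have hlen : (l i).length ≤ (codeList (l i)).size := by
      induction l i with
      | nil => simp
      | cons b m ih => simp only [List.length_cons, codeList, Data.size]; omega
    simp only [List.foldl_nil] at hs
    refine Halts.seq (hq i) ?_
    rintro s h0
    refine Halts.seq (Halts.assign (Q := fun s => s 0 = Data.cons (x i)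
      (Data.cons (codeList (l i)) (Coding.code (s₀ i))) ∧ s (N + 1) = x i) ?_ ?_) ?_
    · simp only [Expr.cost, Expr.value, h0, Data.size, Data.head]; omega
    · simp [Expr.value, h0, Data.head]
    rintro s ⟨h0, h1⟩
    refine Halts.seq (Halts.assign (Q := fun s => s 0 = Data.cons (x i)
      (Data.cons (codeList (l i)) (Coding.code (s₀ i))) ∧ s (N + 1) = x i ∧
      s (N + 2) = codeList (l i)) ?_ ?_) ?_
    · simp only [Expr.cost, Expr.value, h0, Data.size, Data.head, Data.tail]; omega
    · simp [Expr.value, h0, h1, Data.head, Data.tail]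
    rintro s ⟨h0, h1, h2⟩
    refine Halts.seq (Halts.assign (Q := fun s => s (N + 1) = x i ∧
      s (N + 2) = codeList (l i) ∧ s (N + 3) = Coding.code (s₀ i)) ?_ ?_) ?_
    · simp only [Expr.cost, Expr.value, h0, Data.size, Data.tail]; omega
    · simp [Expr.value, h0, h1, h2, Data.tail]
    rintro s ⟨h1, h2, h3⟩
    refine Halts.seq ((loop i _ (l i) (s₀ i) s h1 h2 h3 le_rfl (hgB i)).mono
      (Nat.add_le_add_right (Nat.mul_le_mul_right _ hlen) _) fun _ h => h) ?_
    rintro s h3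
    refine Halts.assign ?_ (by simp [Expr.value, h3])
    have := hgB i (l i) (List.prefix_rfl)
    simp only [Expr.cost, h3]; omega

end Comp

/-! ## Polynomial-time functions on coded types -/

/-- The size of the code of an object. -/
def csize {α : Type} [Coding α] (a : α) : ℕ := (Coding.code a).size

theorem csize_nil {α : Type} [Coding α] : csize ([] : List α) = 1 := rfl

theorem csize_pos {α : Type} [Coding α] (a : α) : 1 ≤ csize a := Data.size_pos _

theorem csize_prod {α β : Type} [Coding α] [Coding β] (a : α × β) :
    csize a = 1 + csize a.1 + csize a.2 := rfl

theorem csize_cons {α : Type} [Coding α] (a : α) (l : List α) :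
    csize (a :: l) = 1 + csize a + csize l := rfl

theorem csize_append {α : Type} [Coding α] (l l' : List α) :
    csize (l ++ l') + 1 = csize l + csize l' := by
  induction l with
  | nil => simp [csize_nil]; omega
  | cons a l ih => simp only [List.cons_append, csize_cons]; omega

theorem csize_reverse {α : Type} [Coding α] (l : List α) : csize l.reverse = csize l := by
  induction l with
  | nil => rfl
  | cons a l ih =>
    have := csize_append l.reverse [a]
    simp only [List.reverse_cons, csize_cons, csize_nil] at *
    omega

theorem csize_prefix_le {α : Type} [Coding α] {l l' : List α} (h : l' <+: l) :
    csize l' ≤ csize l := by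
  obtain ⟨m, rfl⟩ := h
  have := csize_append l' m
  have := csize_pos m
  omega

theorem csize_le_of_mem {α : Type} [Coding α] {l : List α} {a : α} (h : a ∈ l) :
    csize a ≤ csize l := by
  induction l with
  | nil => simp at h
  | cons b l ih =>
    rw [csize_cons]
    rcases List.mem_cons.1 h with rfl | h
    · omega
    · have := ih h; omega

theorem length_le_csize {α : Type} [Coding α] (l : List α) : l.length ≤ csize l := by
  induction l with
  | nil => simp
  | cons a l ih => rw [csize_cons, List.length_cons]; omega

theorem csize_list_le {α : Type} [Coding α] {l : List α} {K : ℕ} (h : ∀ a ∈ l, csize a ≤ K) :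
    csize l ≤ 1 + l.length * (1 + K) := by
  induction l with
  | nil => simp [csize_nil]
  | cons a l ih =>
    have := ih fun b hb => h b (List.mem_cons_of_mem _ hb)
    have := h a List.mem_cons_self
    rw [csize_cons, List.length_cons, Nat.succ_mul]
    omega

/-- A crude linear bound, sufficient because it is used only for indices and lengths of lists that
are themselves present. -/
theorem csize_nat_le (n : ℕ) : csize n ≤ 1 + 4 * n := by
  have h : csize n.bits ≤ 1 + n.bits.length * (1 + 3) := csize_list_le fun b _ => by
    cases b <;> simp [csize, Coding.code, Data.size]
  have h' : n.bits.length ≤ n := by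
    rw [Nat.size_eq_bits_len]
    exact Nat.size_le.2 n.lt_two_pow_self
  have : csize n = csize n.bits := rfl
  omega

/-- `f` is computable in time polynomial in `μ`. -/
abbrev TimeBdd {α β : Type} [Coding α] [Coding β] (μ : α → ℕ) (f : α → β) : Prop :=
  Comp μ (fun a => Coding.code a) (fun a => Coding.code (f a))

/-- `f` is computable in time polynomial in the size of its argument. -/
abbrev PTime {α β : Type} [Coding α] [Coding β] (f : α → β) : Prop := TimeBdd csize f

/-- The size of `f a` is polynomial in `μ a`, being bounded by input size plus running time, so a
bound in terms of the size of `f a` turns into one in terms of `μ a`. -/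
theorem TimeBdd.comp {α β γ : Type} [Coding α] [Coding β] [Coding γ] {μ : α → ℕ} {f : α → β}
    {g : β → γ} (hg : PTime g) (hf : TimeBdd μ f) (hμ : PolyBdd μ csize) :
    TimeBdd μ (fun a => g (f a)) := by
  have hs : PolyBdd μ fun a => csize (f a) := hf.size hμ
  refine Comp.trans hf ?_
  obtain ⟨p, T, hT, h⟩ := hg
  exact ⟨p, fun a => T (f a), hT.comp f hs, fun a => h (f a)⟩

/-- The fold of a list, in polynomial time if the intermediate results are bounded. -/
theorem TimeBdd.foldl {α β σ : Type} [Coding α] [Coding β] [Coding σ] {μ : α → ℕ}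
    {l : α → List β} {s₀ : α → σ} {g : α → σ → β → σ} {B : α → ℕ} (hμ : PolyBdd μ csize)
    (hl : TimeBdd μ l) (hs₀ : TimeBdd μ s₀) (hg : PTime fun q : α × σ × β => g q.1 q.2.1 q.2.2)
    (hB : PolyBdd μ B) (hgB : ∀ a, ∀ l', l' <+: l a → csize (l'.foldl (g a) (s₀ a)) ≤ B a) :
    TimeBdd μ (fun a => (l a).foldl (g a) (s₀ a)) := by
  obtain ⟨p, T, ⟨P, hP⟩, h⟩ := hg
  refine Comp.fold (p := p) (P := P) hμ hl hs₀ (fun a s b => ?_) hB hgB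
  refine (h (a, s, b)).mono ((hP _).trans (polynomial_eval_mono P ?_))
  have h1 : csize (a, s, b) = 1 + csize a + (1 + csize s + csize b) := rfl
  simp only [csize] at h1 ⊢
  omega

namespace PTime

variable {α β γ δ σ : Type} [Coding α] [Coding β] [Coding γ] [Coding δ] [Coding σ]

theorem comp {g : β → γ} {f : α → β} (hg : PTime g) (hf : PTime f) : PTime fun a => g (f a) :=
  TimeBdd.comp hg hf .refl

theorem congr {f g : α → β} (h : PTime f) (h' : ∀ a, f a = g a) : PTime g := by
  rwa [← funext h']

theorem csize_le {f : α → β} (hf : PTime f) : PolyBdd csize fun a => csize (f a) :=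
  Comp.size hf .refl

theorem id : PTime fun a : α => a := Comp.refl

theorem const (b : β) : PTime fun _ : α => b := Comp.const _

/-- Functions with the same codes of values. -/
theorem code_congr {f : α → β} {g : α → γ} (hf : PTime f)
    (h : ∀ a, Coding.code (f a) = Coding.code (g a)) : PTime g := by
  simpa only [PTime, TimeBdd, h] using hf

theorem fst {f : α → β × γ} (hf : PTime f) : PTime fun a => (f a).1 :=
  comp (g := Prod.fst) (Comp.head (x := fun b : β × γ => Coding.code b) .refl) hf

theorem snd {f : α → β × γ} (hf : PTime f) : PTime fun a => (f a).2 :=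
  comp (g := Prod.snd) (Comp.tail (x := fun b : β × γ => Coding.code b) .refl) hf

theorem pair {f : α → β} {g : α → γ} (hf : PTime f) (hg : PTime g) : PTime fun a => (f a, g a) :=
  Comp.pair .refl hf hg

theorem cons {f : α → β} {g : α → List β} (hf : PTime f) (hg : PTime g) :
    PTime fun a => f a :: g a := Comp.pair .refl hf hg

theorem some {f : α → β} (hf : PTime f) : PTime fun a => Option.some (f a) :=
  Comp.pair .refl hf (.const _)

theorem ite {c : α → Prop} [DecidablePred c] {f g : α → β} (hc : PTime fun a => decide (c a))
    (hf : PTime f) (hg : PTime g) : PTime fun a => if c a then f a else g a := by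
  have h := Comp.ite .refl hc hf hg
  refine (congrArg (Comp csize _) (funext fun a => ?_)).mp h
  by_cases hca : c a <;> simp [hca, Coding.code]

/-- Codings are injective, so the primitive comparison of trees decides equality of objects. -/
theorem eq [DecidableEq β] {f g : α → β} (hf : PTime f) (hg : PTime g) :
    PTime fun a => decide (f a = g a) := by
  have h := (Comp.pair .refl hf hg).trans (Comp.eq ((pair hf hg).csize_le))
  refine (congrArg (Comp csize _) (funext fun a => ?_)).mp h
  by_cases hfg : f a = g a
  · simp [Data.head, Data.tail, hfg, Coding.code]
  · simp [Data.head, Data.tail, hfg, Coding.code, Coding.code_injective.ne hfg]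

theorem decide_of_bool {f : α → Bool} (hf : PTime f) : PTime fun a => decide (f a = true) :=
  hf.congr fun a => by simp

theorem not {c : α → Prop} [DecidablePred c] (hc : PTime fun a => decide (c a)) :
    PTime fun a => decide (¬ c a) :=
  (ite hc (const false) (const true)).congr fun a => by by_cases h : c a <;> simp [h]

theorem and {c d : α → Prop} [DecidablePred c] [DecidablePred d] (hc : PTime fun a => decide (c a))
    (hd : PTime fun a => decide (d a)) : PTime fun a => decide (c a ∧ d a) :=
  (ite hc hd (const false)).congr fun a => by by_cases h : c a <;> simp [h]

theorem foldl {l : α → List β} {s₀ : α → σ} {g : α → σ → β → σ} {B : α → ℕ}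
    (hl : PTime l) (hs₀ : PTime s₀) (hg : PTime fun q : α × σ × β => g q.1 q.2.1 q.2.2)
    (hB : PolyBdd csize B)
    (hgB : ∀ a, ∀ l', l' <+: l a → csize (l'.foldl (g a) (s₀ a)) ≤ B a) :
    PTime fun a => (l a).foldl (g a) (s₀ a) := TimeBdd.foldl .refl hl hs₀ hg hB hgB

theorem reverseAux {f g : α → List β} (hf : PTime f) (hg : PTime g) :
    PTime fun a => (f a).reverse ++ g a := by
  refine (foldl (g := fun _ acc b => b :: acc) hf hg (cons id.snd.snd id.snd.fst)
    (hf.csize_le.add hg.csize_le) fun a l' hl' => ?_).congr fun a => ?_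
  · have h1 := csize_append l'.reverse (g a)
    have h2 := csize_prefix_le hl'
    rw [csize_reverse] at h1
    rw [List.foldl_flip_cons_eq_append']
    omega
  · rw [List.foldl_flip_cons_eq_append']

theorem reverse {f : α → List β} (hf : PTime f) : PTime fun a => (f a).reverse :=
  (reverseAux hf (const [])).congr fun a => by simp

theorem append {f g : α → List β} (hf : PTime f) (hg : PTime g) : PTime fun a => f a ++ g a :=
  (reverseAux hf.reverse hg).congr fun a => by simp

/-- A fold that appends. Each piece has size at most a polynomial in the sizes of the argument and
the list, and there are at most as many pieces as list entries, which bounds all intermediate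
results. -/
theorem flatMap {f : α → List β} {g : α → β → List γ} (hf : PTime f)
    (hg : PTime fun q : α × β => g q.1 q.2) : PTime fun a => (f a).flatMap (g a) := by
  obtain ⟨P, hP⟩ := hg.csize_le
  have key : ∀ (a : α) (l : List β) (acc : List γ),
      l.foldl (fun acc b => acc ++ g a b) acc = acc ++ l.flatMap (g a) := by
    intro a l
    induction l with
    | nil => simp
    | cons b l ih => intro acc; rw [List.foldl_cons, ih]; simp
  refine (foldl (g := fun a acc b => acc ++ g a b) hf (const [])
    (append id.snd.fst (comp hg (pair id.fst id.snd.snd)))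
    (B := fun a => 1 + csize (f a) * P.eval (1 + csize a + csize (f a)))
    ((PolyBdd.const 1).add (hf.csize_le.mul ((((PolyBdd.const 1).add .refl).add
      hf.csize_le).eval P))) fun a l' hl' => ?_).congr fun a => by simp [key]
  rw [key, List.nil_append]
  have h : ∀ l : List β, (∀ b ∈ l, b ∈ f a) →
      csize (l.flatMap (g a)) ≤ 1 + l.length * P.eval (1 + csize a + csize (f a)) := by
    intro l
    induction l with
    | nil => intro _; simp [csize_nil]
    | cons b l ih =>
      intro hb
      have h1 := ih fun b hb' => hb b (List.mem_cons_of_mem _ hb')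
      have h2 := (hP (a, b)).trans (polynomial_eval_mono P
        (show csize (a, b) ≤ 1 + csize a + csize (f a) by
          have := csize_le_of_mem (hb b List.mem_cons_self)
          rw [csize_prod]; simp only; omega))
      have h3 := csize_append (g a b) (l.flatMap (g a))
      simp only [List.flatMap_cons, List.length_cons, Nat.succ_mul] at *
      omega
  refine (h l' fun b hb => hl'.subset hb).trans ?_
  have := hl'.length_le.trans (length_le_csize (f a))
  gcongr

theorem map {f : α → List β} {g : α → β → γ} (hf : PTime f)
    (hg : PTime fun q : α × β => g q.1 q.2) : PTime fun a => (f a).map (g a) :=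
  (flatMap (g := fun a b => [g a b]) hf (cons hg (const []))).congr fun a => by
    rw [List.map_eq_flatMap]

theorem filter {f : α → List β} {p : α → β → Bool} (hf : PTime f)
    (hp : PTime fun q : α × β => p q.1 q.2) : PTime fun a => (f a).filter (p a) :=
  (flatMap (g := fun a b => if p a b = true then [b] else []) hf
    (ite (decide_of_bool hp) (cons id.snd (const [])) (const []))).congr fun a => by
      induction f a with
      | nil => rfl
      | cons b l ih => by_cases h : p a b <;> simp [h, ih]

/-- The code of the empty list is `nil`, which is exactly what a test treats as false; hence the
swapped branches. -/
theorem isNil {f : α → List β} (hf : PTime f) : PTime fun a => decide (f a = []) := by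
  have h := Comp.ite .refl hf (const (α := α) false) (const (α := α) true)
  refine (congrArg (Comp csize _) (funext fun a => ?_)).mp h
  cases h : f a <;> simp [Coding.code, codeList, h]

theorem headD {f : α → List β} (hf : PTime f) (b : β) : PTime fun a => (f a).headD b := by
  have h := Comp.ite .refl hf (Comp.trans hf (Comp.head hf.csize_le)) (const (α := α) b)
  refine (congrArg (Comp csize _) (funext fun a => ?_)).mp h
  cases h : f a <;> simp [Coding.code, codeList, Data.head, h]

theorem any {f : α → List β} {p : α → β → Bool} (hf : PTime f)
    (hp : PTime fun q : α × β => p q.1 q.2) : PTime fun a => (f a).any (p a) :=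
  (not (isNil (filter hf hp))).congr fun a => by
    rw [Bool.eq_iff_iff]; simp

theorem mem [DecidableEq β] {f : α → β} {g : α → List β} {dec : ∀ a, Decidable (f a ∈ g a)}
    (hf : PTime f)
    (hg : PTime g) : PTime fun a => decide (f a ∈ g a) :=
  (any (p := fun a b => decide (f a = b)) hg (eq (comp hf id.fst) id.snd)).congr fun a => by
    rw [Bool.eq_iff_iff]; simp

/-! ### Arithmetic of binary numbers in polynomial time. -/

/-- Binary increment. -/
def incBits : List Bool → List Bool
  | [] => [true]
  | false :: l => true :: l
  | true :: l => false :: incBits l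

theorem bits_add_one (n : ℕ) : (n + 1).bits = incBits n.bits := by
  induction n using Nat.strong_induction_on with
  | _ n ih =>
    rcases Nat.even_or_odd' n with ⟨m, rfl | rfl⟩
    · rcases Nat.eq_zero_or_pos m with rfl | hm
      · simp [incBits]
      · rw [Nat.bit1_bits, Nat.bit0_bits _ (by omega), incBits]
    · rw [Nat.bit1_bits, incBits, ← ih m (by omega), ← Nat.bit0_bits _ (by omega)]
      ring_nf

/-- One step of the binary increment: the state consists of the carry and the reversed output. -/
def incStep (s : Bool × List Bool) (b : Bool) : Bool × List Bool :=
  if s.1 = true ∧ b = true then (true, false :: s.2)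
  else if s.1 = true then (false, true :: s.2) else (false, b :: s.2)

/-- The fold starts with carry true. Once the carry is absorbed the remaining bits are copied; a
carry that survives to the end contributes a new leading bit. The output accumulates in reverse. -/
theorem incBits_eq_foldl (l : List Bool) : incBits l =
    (if (l.foldl incStep (true, [])).1 = true then true :: (l.foldl incStep (true, [])).2
      else (l.foldl incStep (true, [])).2).reverse := by
  have h0 : ∀ (l acc : List Bool), l.foldl incStep (false, acc) = (false, l.reverse ++ acc) := by
    intro l
    induction l with
    | nil => simp
    | cons b l ih => intro acc; simp [incStep, ih]
  have h1 : ∀ (l acc : List Bool), (if (l.foldl incStep (true, acc)).1 = true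
      then true :: (l.foldl incStep (true, acc)).2
      else (l.foldl incStep (true, acc)).2).reverse = acc.reverse ++ incBits l := by
    intro l
    induction l with
    | nil => simp [incBits]
    | cons b l ih =>
      intro acc
      cases b
      · simp [incStep, h0, incBits]
      · simpa [incStep, incBits] using ih (false :: acc)
  simpa using (h1 l []).symm

theorem length_incStep (l : List Bool) (s : Bool × List Bool) :
    (l.foldl incStep s).2.length = l.length + s.2.length := by
  induction l generalizing s with
  | nil => simp
  | cons b l ih =>
    rw [List.foldl_cons, ih, List.length_cons, incStep]
    split_ifs <;> simp only [List.length_cons] <;> omega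

/-- The only arithmetic operation that is programmed on bits; indices, lengths and node numbers are
obtained from it by counting along lists. -/
theorem succ {f : α → ℕ} (hf : PTime f) : PTime fun a => f a + 1 := by
  have hb : PTime fun a => (f a).bits := code_congr hf fun _ => rfl
  refine code_congr (f := fun a => incBits (f a).bits) ?_ fun a => ?_
  · simp only [incBits_eq_foldl]
    have h : PTime fun a => (f a).bits.foldl incStep (true, []) := by
      refine foldl (g := fun _ s b => incStep s b) hb (const _)
        (ite (and (decide_of_bool id.snd.fst.fst) (decide_of_bool id.snd.snd))
          (pair (const true) (cons (const false) id.snd.fst.snd))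
          (ite (decide_of_bool id.snd.fst.fst)
            (pair (const false) (cons (const true) id.snd.fst.snd))
            (pair (const false) (cons id.snd.snd id.snd.fst.snd))))
        (B := fun a => 1 + 3 + (1 + csize (f a) * (1 + 3)))
        (((PolyBdd.const _).add (.const _)).add ((PolyBdd.const _).add
          (hf.csize_le.mul (.const _)))) fun a l' hl' => ?_
      have hbool : ∀ b : Bool, csize b ≤ 3 := by
        intro b; cases b <;> simp [csize, Coding.code, Data.size]
      rw [csize_prod]
      refine add_le_add (add_le_add le_rfl (hbool _)) ((csize_list_le fun b _ => hbool b).trans ?_)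
      rw [length_incStep]
      have : l'.length ≤ csize (f a) :=
        hl'.length_le.trans (length_le_csize (α := Bool) (f a).bits)
      simp only [List.length_nil, add_zero]
      gcongr
    exact reverse (ite (decide_of_bool h.fst) (cons (const true) h.snd) h.snd)
  · show codeList _ = codeList _
    rw [bits_add_one]

/-- A fold that carries a counter; the counter stays below the length of the list, so its code is
small. -/
theorem zipIdx {f : α → List β} (hf : PTime f) : PTime fun a => (f a).zipIdx := by
  have key : ∀ (l : List β) (n : ℕ) (acc : List (β × ℕ)),
      l.foldl (fun (s : ℕ × List (β × ℕ)) b => (s.1 + 1, s.2 ++ [(b, s.1)])) (n, acc) =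
        (n + l.length, acc ++ l.zipIdx n) := by
    intro l
    induction l with
    | nil => simp
    | cons b l ih => intro n acc; rw [List.foldl_cons, ih]; simp [Nat.add_right_comm, Nat.add_assoc]
  refine (snd (foldl (g := fun _ (s : ℕ × List (β × ℕ)) b => (s.1 + 1, s.2 ++ [(b, s.1)])) hf
    (const (0, [])) (pair (succ id.snd.fst.fst) (append id.snd.fst.snd
      (cons (pair id.snd.snd id.snd.fst.fst) (const []))))
    (B := fun a => 1 + (1 + 4 * csize (f a)) + (1 + csize (f a) * (1 + (1 + csize (f a) +
      (1 + 4 * csize (f a))))))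
    (((PolyBdd.const _).add ((PolyBdd.const _).add ((PolyBdd.const _).mul hf.csize_le))).add
      ((PolyBdd.const _).add (hf.csize_le.mul ((PolyBdd.const _).add (((PolyBdd.const _).add
        hf.csize_le).add ((PolyBdd.const _).add ((PolyBdd.const _).mul hf.csize_le)))))))
    fun a l' hl' => ?_)).congr fun a => by simp [key]
  have hlen : l'.length ≤ csize (f a) := hl'.length_le.trans (length_le_csize _)
  rw [key, csize_prod]
  simp only [Nat.zero_add, List.nil_append]
  have h1 : csize l'.length ≤ 1 + 4 * csize (f a) := (csize_nat_le _).trans (by omega)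
  refine add_le_add (add_le_add le_rfl h1) ((csize_list_le (K := 1 + csize (f a) +
    (1 + 4 * csize (f a))) fun p hp => ?_).trans ?_)
  · rw [csize_prod]
    have h2 := csize_le_of_mem (hl'.subset (List.fst_mem_of_mem_zipIdx hp))
    have h3 := List.snd_lt_of_mem_zipIdx hp
    have h4 := csize_nat_le p.2
    omega
  · rw [List.length_zipIdx]
    gcongr

theorem range_length {f : α → List β} (hf : PTime f) : PTime fun a => List.range (f a).length :=
  (map (g := fun _ (p : β × ℕ) => p.2) hf.zipIdx id.snd.snd).congr fun a => by
    rw [List.range_eq_range']; exact List.zipIdx_map_snd 0 (f a)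

theorem length {f : α → List β} (hf : PTime f) : PTime fun a => (f a).length := by
  refine (headD (f := fun a => ((List.range (f a).length).map (· + 1)).reverse)
    (reverse (map (g := fun _ n => n + 1) hf.range_length (succ id.snd))) 0).congr fun a => ?_
  cases (f a).length with
  | zero => simp
  | succ n => simp [List.range_succ]

end PTime

/-- The list of all pairs of numbers below `T` and `B`, in lexicographic order, is enumerated by
`t * B + r`. -/
theorem flatMap_range_pair (T B : ℕ) :
    (List.range T).flatMap (fun t => (List.range B).map fun r => (t, r)) =
      (List.range (T * B)).map fun i => (i / B, i % B) := by
  induction T with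
  | zero => simp
  | succ T ih =>
    rw [List.range_succ, List.flatMap_append, ih, Nat.succ_mul, List.range_add, List.map_append]
    simp only [List.flatMap_cons, List.flatMap_nil, List.append_nil, List.map_map]
    refine congrArg _ (List.map_congr_left fun r hr => ?_)
    rw [List.mem_range] at hr
    have hB : 0 < B := by omega
    simp [Nat.mul_comm T B, Nat.mul_add_div hB, Nat.div_eq_of_lt hr,
      Nat.mod_eq_of_lt hr]

/-- The position of `(t, r)` in the lexicographic list of all pairs of numbers below `T` and `B`. -/
def pairIndex (T B t r : ℕ) : ℕ :=
  ((((List.range T).flatMap fun t => (List.range B).map fun r => (t, r)).zipIdx.filter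
    fun p => decide (p.1 = (t, r))).map Prod.snd).headD 0

/-- By `flatMap_range_pair` the pair at position `j` is the quotient and remainder of `j` by `B`, so
only one position matches. This computes a product by searching a list, so no multiplication needs
to be programmed. -/
theorem pairIndex_eq {T B t r : ℕ} (ht : t < T) (hr : r < B) : pairIndex T B t r = t * B + r := by
  unfold pairIndex
  have h : ∀ i ∈ (((List.range T).flatMap fun t => (List.range B).map fun r => (t, r)).zipIdx.filter
      fun p => decide (p.1 = (t, r))), i.2 = t * B + r := by
    rintro ⟨⟨t', r'⟩, i⟩ hi
    rw [flatMap_range_pair, List.mem_filter, List.mem_zipIdx_iff_getElem?] at hi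
    obtain ⟨h1, h2⟩ := hi
    simp only [List.getElem?_map, Option.map_eq_some_iff, decide_eq_true_eq] at h1 h2
    obtain ⟨j, hj, h1⟩ := h1
    obtain ⟨hji, rfl⟩ := List.getElem?_eq_some_iff.1 hj
    simp only [List.getElem_range, Prod.mk.injEq] at h1 h2 ⊢
    rw [← h2.1, ← h2.2, ← h1.1, ← h1.2]
    exact (Nat.div_add_mod' _ _).symm
  have hne : (((List.range T).flatMap fun t => (List.range B).map fun r => (t, r)).zipIdx.filter
      fun p => decide (p.1 = (t, r))) ≠ [] := by
    have h1 : (t, r) ∈ (List.range T).flatMap fun t => (List.range B).map fun r => (t, r) := by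
      simp [ht, hr]
    obtain ⟨i, hi, h1⟩ := List.getElem_of_mem h1
    refine List.ne_nil_of_mem (a := ((t, r), i)) ?_
    rw [List.mem_filter, List.mem_zipIdx_iff_getElem?]
    exact ⟨by simp only; rw [List.getElem?_eq_getElem hi, h1], by simp⟩
  obtain ⟨x, l, hl⟩ := List.exists_cons_of_ne_nil hne
  rw [hl] at h ⊢
  simp [h x (by simp)]

theorem PTime.pairIndex {α : Type} [Coding α] {T B t r : α → ℕ}
    (hT : PTime fun a => List.range (T a)) (hB : PTime fun a => List.range (B a))
    (ht : PTime t) (hr : PTime r) :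
    PTime fun a => PlanReuse.pairIndex (T a) (B a) (t a) (r a) := by
  have hp : PTime fun a => ((List.range (T a)).flatMap
      (fun t => (List.range (B a)).map fun r => (t, r))).zipIdx :=
    (PTime.flatMap (g := fun a t => (List.range (B a)).map fun r => (t, r)) hT
      (PTime.map (g := fun (p : α × ℕ) r => (p.2, r)) (hB.comp (.fst .id))
        (.pair (.snd (.fst .id)) (.snd .id)))).zipIdx
  exact PTime.headD (PTime.map (g := fun _ (p : (ℕ × ℕ) × ℕ) => p.2)
    (PTime.filter (p := fun a (p : (ℕ × ℕ) × ℕ) => decide (p.1 = (t a, r a))) hp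
      (.eq (.fst (.snd .id)) (.pair (ht.comp (.fst .id)) (hr.comp (.fst .id)))))
    (.snd (.snd .id))) 0

/-! ## Closure properties of fpt-reductions -/

/-- The sum of the values of `f` up to `m`: a monotone function that bounds `f`. -/
def runningSum (f : ℕ → ℕ) (m : ℕ) : ℕ := ∑ j ∈ Finset.range (m + 1), f j

theorem le_runningSum (f : ℕ → ℕ) {a b : ℕ} (h : a ≤ b) : f a ≤ runningSum f b :=
  Finset.single_le_sum (f := f) (fun _ _ => Nat.zero_le _) (Finset.mem_range.2 (by omega))

theorem computable_add {f g : ℕ → ℕ} (hf : Computable f) (hg : Computable g) :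
    Computable fun k => f k + g k := Primrec.nat_add.to_comp.comp hf hg

theorem computable_mul {f g : ℕ → ℕ} (hf : Computable f) (hg : Computable g) :
    Computable fun k => f k * g k := Primrec.nat_mul.to_comp.comp hf hg

theorem computable_pow {f : ℕ → ℕ} (hf : Computable f) (c : ℕ) : Computable fun k => f k ^ c := by
  induction c with
  | zero => simpa using Computable.const 1
  | succ c ih => simpa only [pow_succ] using computable_mul ih hf

theorem computable_runningSum {f : ℕ → ℕ} (hf : Computable f) : Computable (runningSum f) := by
  have h : Computable fun m : ℕ => Nat.rec (motive := fun _ => ℕ) 0 (fun y s => s + f y) (m + 1) :=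
    Computable.nat_rec (h := fun _ p => p.2 + f p.1) Computable.succ (Computable.const 0)
      (Primrec.nat_add.to_comp.comp (Computable.snd.comp Computable.snd)
        (hf.comp (Computable.fst.comp Computable.snd)))
  refine (congrArg Computable (funext fun m => ?_)).mp h
  unfold runningSum
  induction m + 1 with
  | zero => rfl
  | succ m ih => rw [Finset.sum_range_succ, ← ih]

theorem ParamProblem.size_pos (P : ParamProblem) (x : P.Inst) : 1 ≤ P.size x := Data.size_pos _

/-- Composing a program that runs in time `f(k) * n ^ c` with another such program. -/
theorem exists_comp_fptTime (p q : Prog) {f f' g : ℕ → ℕ} (c c' : ℕ) (hf : Computable f)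
    (hf' : Computable f') (hg : Computable g) : ∃ F : ℕ → ℕ, ∃ C : ℕ, Computable F ∧
      ∀ (d d' d'' : Data) (k k' : ℕ), k' ≤ g k → OutputsWithin p d d' (f k * d.size ^ c) →
        OutputsWithin q d' d'' (f' k' * d'.size ^ c') →
        OutputsWithin (Prog.seq p (Prog.call q.bound q)) d d'' (F k * d.size ^ C) := by
  refine ⟨fun k => (f k + (2 * q.bound + 1)) + runningSum f' (g k) * (1 + f k) ^ c',
    c + (c + 1) * c', computable_add (computable_add hf (Computable.const _))
      (computable_mul ((computable_runningSum hf').comp hg)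
        (computable_pow (computable_add (Computable.const 1) hf) c')), ?_⟩
  intro d d' d'' k k' hk h h'
  refine (h.comp h').mono ?_
  have hn := d.size_pos
  have hsize := h.size_le
  set n := d.size
  -- The intermediate output is no larger than the input plus the time of `p`. The exponent `c + 1`
  -- absorbs the summand `n` even when `c = 0`.
  have h1 : d'.size ≤ (1 + f k) * n ^ (c + 1) := by
    have h2 : n ≤ n ^ (c + 1) := Nat.le_self_pow (by omega) n
    have h3 : f k * n ^ c ≤ f k * n ^ (c + 1) :=
      Nat.mul_le_mul_left _ (Nat.pow_le_pow_right hn (by omega))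
    rw [Nat.add_mul]
    omega
  have h2 : f' k' * d'.size ^ c' ≤
      (runningSum f' (g k) * (1 + f k) ^ c') * n ^ (c + (c + 1) * c') := by
    calc f' k' * d'.size ^ c' ≤ runningSum f' (g k) * ((1 + f k) * n ^ (c + 1)) ^ c' :=
          Nat.mul_le_mul (le_runningSum f' hk) (Nat.pow_le_pow_left h1 _)
      _ = (runningSum f' (g k) * (1 + f k) ^ c') * n ^ ((c + 1) * c') := by
          rw [mul_pow, ← pow_mul, mul_assoc]
      _ ≤ _ := Nat.mul_le_mul_left _ (Nat.pow_le_pow_right hn (by omega))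
  have h3 : f k * n ^ c ≤ f k * n ^ (c + (c + 1) * c') :=
    Nat.mul_le_mul_left _ (Nat.pow_le_pow_right hn (by omega))
  have h4 : 2 * q.bound + 1 ≤ (2 * q.bound + 1) * n ^ (c + (c + 1) * c') :=
    Nat.le_mul_of_pos_right _ (Nat.pow_pos hn)
  rw [Nat.add_mul, Nat.add_mul]
  omega

/-- The parameter of the intermediate instance is only bounded by `g k`, and `g'` and `f'` need not
be monotone; they are replaced by their running sums, which are monotone and still computable. -/
theorem FptReducible.trans {P Q S : ParamProblem} (h : FptReducible P Q) (h' : FptReducible Q S) :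
    FptReducible P S := by
  obtain ⟨R, hR, ⟨g, hg, hgR⟩, p, f, c, hf, hp⟩ := h
  obtain ⟨R', hR', ⟨g', hg', hgR'⟩, p', f', c', hf', hp'⟩ := h'
  obtain ⟨F, C, hF, h⟩ := exists_comp_fptTime p p' c c' hf hf' hg
  exact ⟨fun x => R' (R x), fun x => (hR x).trans (hR' _),
    ⟨fun k => runningSum g' (g k), (computable_runningSum hg').comp hg, fun x =>
      (hgR' _).trans (le_runningSum g' (hgR x))⟩,
    _, F, C, hF, fun x => h _ _ _ _ _ (hgR x) (hp x) (hp' (R x))⟩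

theorem InFPT.of_fptReducible {P Q : ParamProblem} (h : FptReducible P Q) (h' : InFPT Q) :
    InFPT P := by
  obtain ⟨R, hR, ⟨g, hg, hgR⟩, p, f, c, hf, hp⟩ := h
  obtain ⟨p', f', c', hf', hp'⟩ := h'
  obtain ⟨F, C, hF, h⟩ := exists_comp_fptTime p p' c c' hf hf' hg
  refine ⟨Prog.seq p (Prog.call p'.bound p'), F, C, hF, fun x => ?_⟩
  obtain ⟨b, hb, hout⟩ := hp' (R x)
  exact ⟨b, hb.trans (hR x).symm, h _ _ _ _ _ (hgR x) (hp x) hout⟩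

/-- A reduction that is computed in time polynomial in the size and the parameter. -/
theorem FptReducible.of_comp {P Q : ParamProblem} (R : P.Inst → Q.Inst)
    (hR : ∀ x, P.yes x ↔ Q.yes (R x)) {g : ℕ → ℕ} (hg : Computable g)
    (hgR : ∀ x, Q.param (R x) ≤ g (P.param x))
    (h : Comp (fun x => P.size x + P.param x) (fun x => P.code x) (fun x => Q.code (R x))) :
    FptReducible P Q := by
  obtain ⟨p, T, ⟨A, hA⟩, h⟩ := h
  refine ⟨R, hR, ⟨g, hg, hgR⟩, p, fun k => A.eval 1 * (1 + k) ^ A.natDegree, A.natDegree,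
    computable_mul (Computable.const _) (computable_pow
      (computable_add (Computable.const 1) Computable.id) _), fun x => (h x).mono ?_⟩
  have hn := P.size_pos x
  -- Sizes are at least `1`, so the sum is at most a product, and a polynomial in the product splits
  -- into a factor in the parameter and a power of the size.
  have h1 : P.size x + P.param x ≤ (1 + P.param x) * P.size x := by
    rw [Nat.add_mul, one_mul]
    exact Nat.add_le_add_left (Nat.le_mul_of_pos_right _ hn) _
  refine (hA x).trans ((polynomial_eval_mono A h1).trans ((polynomial_eval_le A ?_).trans ?_))
  · exact Nat.mul_pos (by omega) hn
  · rw [mul_pow, mul_assoc]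

/-! ## Circuits, interleavings and plans -/

theorem Node.eval_congr (nd : Node) (b : Bool) {v v' : ℕ → Bool}
    (h : ∀ j ∈ nd.preds, v j = v' j) : nd.eval b v = nd.eval b v' := by
  cases nd with
  | input => rfl
  | neg i => simp [eval, h i (by simp [preds])]
  | conj l =>
    rw [Bool.eq_iff_iff]
    simp only [eval, List.all_eq_true]
    exact forall₂_congr fun j hj => by rw [h j hj]
  | disj l =>
    rw [Bool.eq_iff_iff]
    simp only [eval, List.any_eq_true]
    exact exists_congr fun j => and_congr_right fun hj => by rw [h j hj]

instance : DecidableEq Node := fun _ _ => decidable_of_iff _ Node.toPair_injective.eq_iff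

namespace Circuit

variable (C : Circuit) (α : ℕ → Bool)

theorem lt_of_mem_preds {i j : ℕ} {nd : Node} (h : C.nodes[i]? = some nd) (hj : j ∈ nd.preds) :
    j < i := by
  obtain ⟨hi, rfl⟩ := List.getElem?_eq_some_iff.1 h
  exact C.acyclic i hi j hj

/-- Stage `m + 1` of the evaluation changes only the value of node `m`. -/
theorem values_stable {i m : ℕ} (h : i < m) : C.values α m i = C.values α (i + 1) i := by
  induction m with
  | zero => omega
  | succ m ih =>
    rcases Nat.lt_succ_iff_lt_or_eq.1 h with h' | rfl
    · rw [← ih h']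
      exact Function.update_of_ne (by omega) _ _
    · rfl

/-- The values of the nodes satisfy the equations of the circuit. -/
theorem values_eq {i : ℕ} {nd : Node} (h : C.nodes[i]? = some nd) :
    C.values α C.nodes.length i = nd.eval (α i) (C.values α C.nodes.length) := by
  have hi := (List.getElem?_eq_some_iff.1 h).1
  rw [values_stable C α hi]
  have : C.values α (i + 1) i = nd.eval (α i) (C.values α i) := by
    simp [values, h]
  rw [this]
  refine nd.eval_congr _ fun j hj => ?_
  have hj' := C.lt_of_mem_preds h hj
  rw [values_stable C α hj', values_stable C α (hj'.trans hi)]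

/-- The equations of the circuit determine the values of the nodes. -/
theorem values_unique {v : ℕ → Bool}
    (h : ∀ i nd, C.nodes[i]? = some nd → v i = nd.eval (α i) v) {i : ℕ}
    (hi : i < C.nodes.length) : C.values α C.nodes.length i = v i := by
  induction i using Nat.strong_induction_on with
  | _ i ih =>
    have hn := List.getElem?_eq_getElem hi
    rw [C.values_eq α hn, h i _ hn]
    refine Node.eval_congr _ _ fun j hj => ?_
    have hj' := C.lt_of_mem_preds hn hj
    exact ih j hj' (hj'.trans hi)

theorem weight_eq_card :
    C.weight α = ((Finset.range C.nodes.length).filter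
      fun i => C.nodes[i]? = some Node.input ∧ α i = true).card := by
  rw [weight, ← Set.ncard_coe_finset]
  congr 1
  ext i
  simp only [Set.mem_ofPred_eq, Finset.coe_filter, Finset.mem_range]
  exact ⟨fun h => ⟨(List.getElem?_eq_some_iff.1 h.1).1, h⟩, fun h => h.2⟩

end Circuit

namespace Interleaving

variable {α : Type} {c c₁ c₂ g p : List α} {x : α}

theorem right_nil (c : List α) : Interleaving c [] c := by
  induction c with
  | nil => exact .nil
  | cons x c ih => exact .left ih

theorem eq_of_nil (h : Interleaving [] g p) : p = g := by
  generalize hc : ([] : List α) = c at h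
  induction h with
  | nil => rfl
  | left _ _ => simp at hc
  | right _ ih => rw [ih hc]

theorem append {g₁ p₁ g₂ p₂ : List α} (h : Interleaving c₁ g₁ p₁) (h' : Interleaving c₂ g₂ p₂) :
    Interleaving (c₁ ++ c₂) (g₁ ++ g₂) (p₁ ++ p₂) := by
  induction h with
  | nil => exact h'
  | left _ ih => exact .left ih
  | right _ ih => exact .right ih

theorem exists_of_append (h : Interleaving (c₁ ++ c₂) g p) : ∃ g₁ g₂ p₁ p₂, g = g₁ ++ g₂ ∧
    p = p₁ ++ p₂ ∧ Interleaving c₁ g₁ p₁ ∧ Interleaving c₂ g₂ p₂ := by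
  generalize hc : c₁ ++ c₂ = c at h
  induction h generalizing c₁ with
  | nil =>
    obtain ⟨rfl, rfl⟩ := List.append_eq_nil_iff.1 hc
    exact ⟨[], [], [], [], rfl, rfl, .nil, .nil⟩
  | @left x c g p h ih =>
    cases c₁ with
    | nil =>
      rw [List.nil_append] at hc
      exact ⟨[], g, [], x :: p, rfl, rfl, .nil, hc ▸ .left h⟩
    | cons y c₁ =>
      obtain ⟨rfl, hc'⟩ := List.cons.inj hc
      obtain ⟨g₁, g₂, p₁, p₂, rfl, rfl, h₁, h₂⟩ := ih hc'
      exact ⟨g₁, g₂, y :: p₁, p₂, rfl, rfl, .left h₁, h₂⟩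
  | @right x c g p h ih =>
    obtain ⟨g₁, g₂, p₁, p₂, rfl, rfl, h₁, h₂⟩ := ih hc
    exact ⟨x :: g₁, g₂, x :: p₁, p₂, rfl, rfl, .right h₁, h₂⟩

theorem exists_of_cons (h : Interleaving (x :: c) g p) : ∃ g₁ g₂ p₂, g = g₁ ++ g₂ ∧
    p = g₁ ++ x :: p₂ ∧ Interleaving c g₂ p₂ := by
  generalize hc : x :: c = c' at h
  induction h with
  | nil => simp at hc
  | @left y c' g p h ih =>
    obtain ⟨rfl, rfl⟩ := List.cons.inj hc
    exact ⟨[], g, p, rfl, rfl, h⟩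
  | @right y c' g p h ih =>
    obtain ⟨g₁, g₂, p₂, rfl, rfl, h₂⟩ := ih hc
    exact ⟨y :: g₁, g₂, p₂, rfl, rfl, h₂⟩

theorem mem_or_mem (h : Interleaving c g p) (hx : x ∈ p) : x ∈ c ∨ x ∈ g := by
  induction h with
  | nil => simp at hx
  | left _ ih =>
    rcases List.mem_cons.1 hx with rfl | hx
    · simp
    · rcases ih hx with h | h <;> simp [h]
  | right _ ih =>
    rcases List.mem_cons.1 hx with rfl | hx
    · simp
    · rcases ih hx with h | h <;> simp [h]

end Interleaving

namespace Frame

variable {F : Frame}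

theorem run_append (s : F.State) (p q : List F.Action) : run s (p ++ q) = run (run s p) q :=
  List.foldl_append

theorem run_cons (s : F.State) (a : F.Action) (p : List F.Action) :
    run s (a :: p) = run (step s a) p := rfl

/-- An invariant of all actions of a plan is an invariant of the plan. -/
theorem run_invariant {P : F.State → Prop} {p : List F.Action}
    (h : ∀ a ∈ p, ∀ s, P s → P (step s a)) {s : F.State} (hs : P s) : P (run s p) := by
  induction p generalizing s with
  | nil => exact hs
  | cons a p ih =>
    exact ih (fun b hb => h b (List.mem_cons_of_mem _ hb)) (h a List.mem_cons_self s hs)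

theorem step_apply_of_none {s : F.State} {a : F.Action} {v : Fin F.numVars}
    (h : (Action.post a).1 v = none) : (step s a).1 v = s.1 v := by
  unfold step
  split_ifs
  · simp [overwrite, h]
  · rfl

end Frame

/-! ## Weighted circuit satisfiability reduces to plan reuse -/

namespace Guess

/-- One variable for every node, the variable `n` in which a guess is stored, and two flags `n + 1`,
`n + 2` for the start and the end of the stored plan. -/
def frame (n : ℕ) : Frame := ⟨n + 3, fun _ => [0, 1]⟩

/-- The state of a Boolean assignment. -/
def state (n : ℕ) (b : ℕ → Bool) : (frame n).State :=
  ⟨fun v => (b v.1).toNat, fun v => by cases b v.1 <;> simp [frame]⟩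

/-- The partial state of a partial Boolean assignment. -/
def part (n : ℕ) (φ : ℕ → Option Bool) : (frame n).PartialState :=
  ⟨fun v => (φ v.1).map Bool.toNat, fun v d h => by
    obtain ⟨b, -, rfl⟩ := Option.map_eq_some_iff.1 h
    cases b <;> simp [frame]⟩

/-- The action with the given precondition and postcondition. -/
def act (n : ℕ) (φ ψ : ℕ → Option Bool) : (frame n).Action := (part n φ, part n ψ)

/-- `b` agrees with `φ` on the variables of the frame. -/
def Holds (n : ℕ) (φ : ℕ → Option Bool) (b : ℕ → Bool) : Prop :=
  ∀ v < n + 3, ∀ d, φ v = some d → b v = d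

/-- The result of overwriting `b` with `ψ`. -/
def upd (ψ : ℕ → Option Bool) (b : ℕ → Bool) : ℕ → Bool := fun v => (ψ v).getD (b v)

/-- The partial assignment that is defined for `v` only. -/
def single (v : ℕ) (d : Bool) : ℕ → Option Bool := fun u => if u = v then some d else none

theorem meets_iff {n : ℕ} {φ : ℕ → Option Bool} {b : ℕ → Bool} :
    Frame.Meets (state n b) (part n φ) ↔ Holds n φ b := by
  constructor
  · intro h v hv d hd
    have := h ⟨v, hv⟩ d.toNat (by simp [part, hd])
    have h' : (b v).toNat = d.toNat := this
    revert h'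
    cases b v <;> cases d <;> simp
  · rintro h ⟨v, hv⟩ d hd
    obtain ⟨b', hb', rfl⟩ := Option.map_eq_some_iff.1 hd
    exact congrArg Bool.toNat (h v hv b' hb')

theorem step_of_holds {n : ℕ} {φ ψ : ℕ → Option Bool} {b : ℕ → Bool} (h : Holds n φ b) :
    Frame.step (state n b) (act n φ ψ) = state n (upd ψ b) := by
  unfold Frame.step
  rw [if_pos (show Frame.Meets (state n b) (Frame.Action.pre (act n φ ψ)) from meets_iff.2 h)]
  apply Subtype.ext
  funext v
  simp only [Frame.overwrite, Frame.Action.post, act, part, state, upd]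
  cases ψ v.1 <;> rfl

theorem step_of_not_holds {n : ℕ} {φ ψ : ℕ → Option Bool} {b : ℕ → Bool} (h : ¬ Holds n φ b) :
    Frame.step (state n b) (act n φ ψ) = state n b := by
  unfold Frame.step
  rw [if_neg (show ¬ Frame.Meets (state n b) (Frame.Action.pre (act n φ ψ)) from
    fun h' => h (meets_iff.1 h'))]

theorem holds_none (n : ℕ) (b : ℕ → Bool) : Holds n (fun _ => none) b := by
  intro v _ d h; simp at h

theorem holds_single {n v : ℕ} {d : Bool} {b : ℕ → Bool} (hv : v < n + 3) :
    Holds n (single v d) b ↔ b v = d := by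
  constructor
  · intro h; exact h v hv d (by simp [single])
  · intro h u _ d' hd'
    simp only [single, Option.ite_none_right_eq_some, Option.some.injEq] at hd'
    obtain ⟨rfl, rfl⟩ := hd'
    exact h

theorem upd_single (v : ℕ) (d : Bool) (b : ℕ → Bool) :
    upd (single v d) b = Function.update b v d := by
  funext u
  by_cases h : u = v
  · subst h; simp [upd, single]
  · simp [upd, single, h]

/-- The glue action sets the guess. -/
def glue (n : ℕ) : (frame n).Action := act n (fun _ => none) (single n true)

/-- The first action of the stored plan. -/
def start (n : ℕ) : (frame n).Action := act n (fun _ => none) (single (n + 1) true)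

/-- The last action of the stored plan. -/
def finish (n out : ℕ) : (frame n).Action :=
  act n (fun u => if u = out ∨ u = n + 1 then some true else none) (single (n + 2) true)

/-- The postcondition of the action for an input node: it moves the guess to the node. -/
def move (n i : ℕ) : ℕ → Option Bool :=
  fun u => if u = n then some false else if u = i then some true else none

/-- A gate is true if and only if one of its guards holds. -/
def guards : Node → List (ℕ → Option Bool)
  | .input => []
  | .neg j => [single j false]
  | .conj l => [fun u => if u ∈ l then some true else none]
  | .disj l => l.map fun j => single j true

/-- The actions that evaluate the node `i`. -/
def nodeActs (n : ℕ) : Node → ℕ → List (frame n).Action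
  | .input, i => [act n (single n true) (move n i)]
  | nd, i => (guards nd).map fun φ => act n φ (single i true)

theorem nodeActs_of_ne {n : ℕ} {nd : Node} (h : nd ≠ .input) (i : ℕ) :
    nodeActs n nd i = (guards nd).map fun φ => act n φ (single i true) := by
  cases nd with
  | input => exact absurd rfl h
  | _ => rfl

/-- A disjunction has one guard per predecessor, the other gates a single guard. The value `x` is a
placeholder: only an input node would read it. -/
theorem exists_guard_iff {n i : ℕ} {nd : Node} (h : ∀ j ∈ nd.preds, j < i) (hi : i < n)
    (hnd : nd ≠ .input) (b : ℕ → Bool) (x : Bool) :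
    (∃ φ ∈ guards nd, Holds n φ b) ↔ nd.eval x b = true := by
  cases nd with
  | input => exact absurd rfl hnd
  | neg j =>
    have := h j (by simp [Node.preds])
    simp [guards, Node.eval, holds_single (show j < n + 3 by omega)]
  | conj l =>
    simp only [guards, List.mem_singleton, exists_eq_left, Node.eval, List.all_eq_true]
    constructor
    · intro h' j hj
      exact h' j (by have := h j hj; omega) true (by simp [hj])
    · intro h' v _ d hd
      simp only [Option.ite_none_right_eq_some, Option.some.injEq] at hd
      rw [h' v hd.1, hd.2]
  | disj l =>
    simp only [guards, List.mem_map, exists_exists_and_eq_and, Node.eval, List.any_eq_true]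
    refine exists_congr fun j => and_congr_right fun hj => ?_
    have := h j hj
    exact holds_single (by omega)

theorem guard_support {nd : Node} {φ : ℕ → Option Bool} (hφ : φ ∈ guards nd) {u : ℕ}
    (hu : φ u ≠ none) : u ∈ nd.preds := by
  cases nd with
  | input => simp [guards] at hφ
  | neg j =>
    simp only [guards, List.mem_singleton] at hφ
    subst hφ
    simpa [single, Node.preds] using hu
  | conj l =>
    simp only [guards, List.mem_singleton] at hφ
    subst hφ
    simpa [Node.preds] using hu
  | disj l =>
    simp only [guards, List.mem_map] at hφ
    obtain ⟨j, hj, rfl⟩ := hφ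
    have : u = j := by simpa [single] using hu
    exact this ▸ hj

theorem holds_congr {n : ℕ} {φ : ℕ → Option Bool} {b b' : ℕ → Bool}
    (h : ∀ u, φ u ≠ none → b u = b' u) : Holds n φ b ↔ Holds n φ b' :=
  forall₂_congr fun v _ => forall_congr' fun d => imp_congr_right fun hd => by
    rw [h v (by simp [hd])]

/-- The guards read variables below `i`, while the block writes only variable `i` and the glue steps
only variable `n`. Each guard thus keeps its truth value throughout, wherever glue steps are
inserted. -/
theorem run_gate {n i : ℕ} (hi : i < n) {c g p : List (frame n).Action}
    (h : Interleaving c g p) (hg : ∀ a ∈ g, a = glue n) (φs : List (ℕ → Option Bool))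
    (hc : c = φs.map fun φ => act n φ (single i true))
    (hφ : ∀ φ ∈ φs, ∀ u, φ u ≠ none → u < i) (b : ℕ → Bool) :
    ∃ b', Frame.run (state n b) p = state n b' ∧ (∀ j, j ≠ i → j ≠ n → b' j = b j) ∧
      (b' i = true ↔ b i = true ∨ ∃ φ ∈ φs, Holds n φ b) ∧
      (b' n = true ↔ b n = true ∨ g ≠ []) := by
  induction h generalizing φs b with
  | nil =>
    have : φs = [] := by simpa using hc.symm
    subst this
    exact ⟨b, rfl, fun _ _ _ => rfl, by simp, by simp⟩
  | @left a c g p _ ih =>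
    cases φs with
    | nil => simp at hc
    | cons φ φs =>
      obtain ⟨rfl, hc'⟩ := List.cons.inj hc
      have hφ' : ∀ φ ∈ φs, ∀ u, φ u ≠ none → u < i := fun φ h => hφ φ (by simp [h])
      by_cases hH : Holds n φ b
      · obtain ⟨b', h1, h2, h3, h4⟩ := ih hg φs hc' hφ' (Function.update b i true)
        refine ⟨b', ?_, fun j hj hj' => ?_, ?_, ?_⟩
        · rw [Frame.run_cons, step_of_holds hH, upd_single, h1]
        · rw [h2 j hj hj', Function.update_of_ne hj]
        · simp [h3, hH]
        · rw [h4, Function.update_of_ne (by omega)]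
      · obtain ⟨b', h1, h2, h3, h4⟩ := ih hg φs hc' hφ' b
        refine ⟨b', ?_, h2, ?_, h4⟩
        · rw [Frame.run_cons, step_of_not_holds hH, h1]
        · simp [h3, hH]
  | @right a c g p _ ih =>
    obtain rfl := hg a (by simp)
    obtain ⟨b', h1, h2, h3, h4⟩ := ih (fun a h => hg a (by simp [h])) φs hc hφ
      (Function.update b n true)
    refine ⟨b', ?_, fun j hj hj' => ?_, ?_, ?_⟩
    · rw [Frame.run_cons, glue, step_of_holds (holds_none n b), upd_single, h1]
    · rw [h2 j hj hj', Function.update_of_ne hj']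
    · rw [h3, Function.update_of_ne (by omega)]
      refine or_congr_right (exists_congr fun φ => and_congr_right fun h => ?_)
      refine holds_congr fun u hu => Function.update_of_ne ?_ _ _
      have := hφ φ h u hu
      omega
    · simp [h4]

theorem run_glue {n : ℕ} {g : List (frame n).Action} (hg : ∀ a ∈ g, a = glue n) (b : ℕ → Bool) :
    ∃ b', Frame.run (state n b) g = state n b' ∧ (∀ j, j ≠ n → b' j = b j) ∧
      (b' n = true ↔ b n = true ∨ g ≠ []) := by
  induction g generalizing b with
  | nil => exact ⟨b, rfl, fun _ _ => rfl, by simp⟩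
  | cons a g ih =>
    obtain rfl := hg a (by simp)
    obtain ⟨b', h1, h2, h3⟩ := ih (fun a h => hg a (by simp [h])) (Function.update b n true)
    refine ⟨b', ?_, fun j hj => ?_, by simp [h3]⟩
    · rw [Frame.run_cons, glue, step_of_holds (holds_none n b), upd_single, h1]
    · rw [h2 j hj, Function.update_of_ne hj]

/-- The accounting step of the hardness proof: tokens at the node and in the store after the block
come from the store before it or from glue steps. Only an inequality holds, because a glue step
applied to a full store is wasted. -/
theorem run_input {n i : ℕ} (hi : i < n) {g p : List (frame n).Action}
    (h : Interleaving [act n (single n true) (move n i)] g p) (hg : ∀ a ∈ g, a = glue n)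
    (b : ℕ → Bool) (hb : b i = false) :
    ∃ b', Frame.run (state n b) p = state n b' ∧ (∀ j, j ≠ i → j ≠ n → b' j = b j) ∧
      (b' i).toNat + (b' n).toNat ≤ (b n).toNat + g.length := by
  obtain ⟨g₁, g₂, p₂, rfl, rfl, h'⟩ := h.exists_of_cons
  obtain rfl := h'.eq_of_nil
  obtain ⟨b₁, hr₁, h1, h2⟩ := run_glue (fun a ha => hg a (by simp [ha]) : ∀ a ∈ g₁, a = glue n) b
  -- The token count just before the moving action; the case distinction below is whether that
  -- action fires.
  have hle : (b₁ n).toNat ≤ (b n).toNat + g₁.length := by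
    cases hn : b n
    · by_cases hg1 : g₁ = []
      · have : b₁ n = false := by rw [← Bool.not_eq_true, h2, hn, hg1]; simp
        simp [this]
      · have := List.length_pos_of_ne_nil hg1
        have := Bool.toNat_le (b₁ n)
        omega
    · have := Bool.toNat_le (b₁ n)
      simp only [Bool.toNat_true]; omega
  have hin : i ≠ n := by omega
  cases hn : b₁ n
  · obtain ⟨b₂, hr₂, h3, h4⟩ := run_glue (fun a ha => hg a (by simp [ha]) : ∀ a ∈ p₂, a = glue n) b₁
    refine ⟨b₂, ?_, fun j hj hj' => ?_, ?_⟩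
    · rw [Frame.run_append, hr₁, Frame.run_cons, step_of_not_holds, hr₂]
      rw [holds_single (by omega), hn]; simp
    · rw [h3 j hj', h1 j hj']
    · rw [h3 i hin, h1 i hin, hb]
      have := Bool.toNat_le (b₂ n)
      by_cases hg2 : p₂ = []
      · have : b₂ n = false := by rw [← Bool.not_eq_true, h4, hn, hg2]; simp
        simp [this]
      · have := List.length_pos_of_ne_nil hg2
        simp only [Bool.toNat_false, List.length_append]; omega
  · obtain ⟨b₂, hr₂, h3, h4⟩ := run_glue (fun a ha => hg a (by simp [ha]) : ∀ a ∈ p₂, a = glue n)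
      (upd (move n i) b₁)
    refine ⟨b₂, ?_, fun j hj hj' => ?_, ?_⟩
    · rw [Frame.run_append, hr₁, Frame.run_cons, step_of_holds, hr₂]
      rw [holds_single (by omega), hn]
    · rw [h3 j hj', upd]; simp [move, hj, hj', h1 j hj']
    · have h5 := Bool.toNat_le (b₂ n)
      have h6 := Bool.toNat_le (b₂ i)
      rw [hn] at hle
      by_cases hg2 : p₂ = []
      · have : b₂ n = false := by
          rw [← Bool.not_eq_true, h4, hg2]; simp [upd, move]
        simp only [this, Bool.toNat_false, List.length_append, Bool.toNat_true] at hle ⊢; omega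
      · have := List.length_pos_of_ne_nil hg2
        simp only [Bool.toNat_true, List.length_append] at hle ⊢; omega

end Guess
-- The stored plan simulates the circuit.
namespace Guess

variable (C : Circuit)

/-- The number of nodes of the circuit. -/
abbrev len : ℕ := C.nodes.length

/-- The actions that evaluate the nodes below `i`. -/
def blocks (i : ℕ) : List (frame (len C)).Action :=
  (List.range i).flatMap fun j => nodeActs (len C) (C.nodes.getD j .input) j

/-- The stored plan, which evaluates the circuit. -/
def plan : List (frame (len C)).Action :=
  start (len C) :: (blocks C (len C) ++ [finish (len C) C.output])

theorem blocks_succ {i : ℕ} {nd : Node} (h : C.nodes[i]? = some nd) :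
    blocks C (i + 1) = blocks C i ++ nodeActs (len C) nd i := by
  simp [blocks, List.range_succ, h]

/-- The number of input nodes below `i` that are true. -/
def inputs (b : ℕ → Bool) (i : ℕ) : ℕ :=
  ((Finset.range i).filter fun j => C.nodes[j]? = some .input ∧ b j = true).card

theorem inputs_zero (b : ℕ → Bool) : inputs C b 0 = 0 := by simp [inputs]

theorem inputs_succ (b : ℕ → Bool) (i : ℕ) : inputs C b (i + 1) =
    inputs C b i + if C.nodes[i]? = some .input then (b i).toNat else 0 := by
  unfold inputs
  rw [Finset.range_add_one, Finset.filter_insert]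
  by_cases h : C.nodes[i]? = some .input <;> cases hb : b i <;> simp [h]

theorem inputs_congr {b b' : ℕ → Bool} {i : ℕ} (h : ∀ j < i, b j = b' j) :
    inputs C b i = inputs C b' i := by
  induction i with
  | zero => simp [inputs_zero]
  | succ i ih => rw [inputs_succ, inputs_succ, ih fun j hj => h j (by omega), h i (by omega)]

theorem weight_eq_inputs (α : ℕ → Bool) : C.weight α = inputs C α (len C) :=
  C.weight_eq_card α

/-- The nodes below `i` are evaluated correctly, the others are false, and the guesses are paid by
`m` glue steps. -/
structure Inv (i m : ℕ) (b : ℕ → Bool) : Prop where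
  eval : ∀ j < i, ∀ nd, C.nodes[j]? = some nd → b j = nd.eval (b j) b
  rest : ∀ j, i ≤ j → j < len C → b j = false
  count : inputs C b i + (b (len C)).toNat ≤ m

variable {C}

/-- The block of node `i` changes only variable `i` and the token store. Equations of earlier nodes
persist since their predecessors are earlier still. The new equation is trivial for an input, whose
value is read off the state, and comes from `run_gate` for a gate; the count comes from `run_input`
or from the glue steps in a gate block. -/
theorem Inv.step {i m : ℕ} {b : ℕ → Bool} (h : Inv C i m b) {nd : Node}
    (hnd : C.nodes[i]? = some nd) {g p : List (frame (len C)).Action}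
    (hp : Interleaving (nodeActs (len C) nd i) g p) (hg : ∀ a ∈ g, a = glue (len C)) :
    ∃ b', Frame.run (state (len C) b) p = state (len C) b' ∧ Inv C (i + 1) (m + g.length) b' ∧
      ∀ j, len C < j → b' j = b j := by
  have hi : i < len C := (List.getElem?_eq_some_iff.1 hnd).1
  have hlt : ∀ j < i, ∀ nd, C.nodes[j]? = some nd → ∀ u ∈ nd.preds, u < i := fun j hj nd hnd u hu =>
    (C.lt_of_mem_preds hnd hu).trans hj
  have hrest := h.rest i le_rfl hi
  have hold : ∀ b' : ℕ → Bool, (∀ j, j ≠ i → j ≠ len C → b' j = b j) →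
      (∀ j < i, ∀ nd, C.nodes[j]? = some nd → b' j = nd.eval (b' j) b') ∧
      (∀ j, i + 1 ≤ j → j < len C → b' j = false) ∧ inputs C b' i = inputs C b i ∧
      ∀ j, len C < j → b' j = b j := by
    intro b' hb'
    have hb'' : ∀ j < i, b' j = b j := fun j hj => hb' j (by omega) (by omega)
    refine ⟨fun j hj nd hnd => ?_, fun j hj hj' => ?_, inputs_congr C hb'',
      fun j hj => hb' j (by omega) (by omega)⟩
    · rw [hb'' j hj, nd.eval_congr _ fun u hu => hb'' u (hlt j hj nd hnd u hu)]
      exact h.eval j hj nd hnd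
    · rw [hb' j (by omega) (by omega), h.rest j (by omega) hj']
  by_cases hin : nd = .input
  · subst hin
    obtain ⟨b', hr, h1, h2⟩ := run_input hi hp hg b hrest
    obtain ⟨h3, h4, h5, h6⟩ := hold b' h1
    refine ⟨b', hr, ⟨fun j hj nd' hnd' => ?_, h4, ?_⟩, h6⟩
    · rcases Nat.lt_succ_iff_lt_or_eq.1 hj with hj | rfl
      · exact h3 j hj nd' hnd'
      · rw [hnd] at hnd'
        obtain rfl := Option.some.inj hnd'
        rfl
    · have := h.count
      rw [inputs_succ, h5, if_pos hnd]
      omega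
  · rw [nodeActs_of_ne hin] at hp
    have hpre : ∀ j ∈ nd.preds, j < i := fun j hj => C.lt_of_mem_preds hnd hj
    obtain ⟨b', hr, h1, h2, h7⟩ := run_gate hi hp hg (guards nd) rfl
      (fun φ hφ u hu => hpre u (guard_support hφ hu)) b
    obtain ⟨h3, h4, h5, h6⟩ := hold b' h1
    refine ⟨b', hr, ⟨fun j hj nd' hnd' => ?_, h4, ?_⟩, h6⟩
    · rcases Nat.lt_succ_iff_lt_or_eq.1 hj with hj | rfl
      · exact h3 j hj nd' hnd'
      · rw [hnd] at hnd'
        obtain rfl := Option.some.inj hnd'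
        rw [Bool.eq_iff_iff, h2, hrest, exists_guard_iff hpre hi hin b (b' j)]
        rw [nd.eval_congr _ fun u hu => h1 u (by have := hpre u hu; omega)
          (by have := hpre u hu; omega)]
        simp
    · have hc := h.count
      rw [inputs_succ, h5, if_neg (fun h => hin (Option.some.inj (hnd.symm.trans h)))]
      have := Bool.toNat_le (b' (len C))
      by_cases hg' : g = []
      · subst hg'
        have : b' (len C) = b (len C) := by rw [Bool.eq_iff_iff, h7]; simp
        rw [this]; simpa using hc
      · have := List.length_pos_of_ne_nil hg'
        omega

theorem Inv.blocks {m : ℕ} {b : ℕ → Bool} (h : Inv C 0 m b) {i : ℕ} (hi : i ≤ len C)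
    {g p : List (frame (len C)).Action} (hp : Interleaving (blocks C i) g p)
    (hg : ∀ a ∈ g, a = glue (len C)) :
    ∃ b', Frame.run (state (len C) b) p = state (len C) b' ∧ Inv C i (m + g.length) b' ∧
      ∀ j, len C < j → b' j = b j := by
  induction i generalizing g p with
  | zero =>
    obtain rfl := Interleaving.eq_of_nil (by simpa [Guess.blocks] using hp)
    obtain ⟨b', hr, h1, h2⟩ := run_glue hg b
    refine ⟨b', hr, ⟨fun j hj => by omega, fun j hj hj' => ?_, ?_⟩, fun j hj => h1 j (by omega)⟩
    · rw [h1 j (by omega), h.rest j hj hj']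
    · have hc := h.count
      rw [inputs_zero] at hc ⊢
      have := Bool.toNat_le (b' (len C))
      by_cases hg' : p = []
      · subst hg'
        have : b' (len C) = b (len C) := by rw [Bool.eq_iff_iff, h2]; simp
        rw [this]; simpa using hc
      · have := List.length_pos_of_ne_nil hg'
        omega
  | succ i ih =>
    have hnd := List.getElem?_eq_getElem (show i < C.nodes.length from hi)
    rw [blocks_succ C hnd] at hp
    obtain ⟨g₁, g₂, p₁, p₂, rfl, rfl, hp₁, hp₂⟩ := hp.exists_of_append
    obtain ⟨b₁, hr₁, h₁, hf₁⟩ := ih (by omega) hp₁ fun a ha => hg a (by simp [ha])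
    obtain ⟨b₂, hr₂, h₂, hf₂⟩ := h₁.step hnd hp₂ fun a ha => hg a (by simp [ha])
    refine ⟨b₂, by rw [Frame.run_append, hr₁, hr₂], ?_, fun j hj => (hf₂ j hj).trans (hf₁ j hj)⟩
    rw [List.length_append, ← Nat.add_assoc]
    exact h₂

/-- If the stored plan can be reused as a whole, then the circuit is satisfiable. -/
theorem satisfiable_of_run {g p : List (frame (len C)).Action}
    (hp : Interleaving (plan C) g p) (hg : ∀ a ∈ g, a = glue (len C))
    (hgoal : Frame.Meets (Frame.run (state (len C) fun _ => false) p)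
      (part (len C) (single (len C + 2) true))) :
    ∃ α, C.Satisfies α ∧ C.weight α ≤ g.length := by
  obtain ⟨g₁, g₂, p₂, rfl, rfl, hp₂⟩ := hp.exists_of_cons
  obtain ⟨g₃, g₄, p₃, p₄, rfl, rfl, hp₃, hp₄⟩ := hp₂.exists_of_append
  obtain ⟨g₅, g₆, p₆, rfl, rfl, hp₆⟩ := hp₄.exists_of_cons
  obtain rfl := hp₆.eq_of_nil
  obtain ⟨b₁, hr₁, h1, h2⟩ := run_glue (fun a ha => hg a (by simp [ha]) :
    ∀ a ∈ g₁, a = glue (len C)) fun _ => false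
  have hinv : Inv C 0 g₁.length (upd (single (len C + 1) true) b₁) := by
    rw [upd_single]
    refine ⟨fun j hj => by omega, fun j _ hj => ?_, ?_⟩
    · rw [Function.update_of_ne (by omega), h1 j (by omega)]
    · rw [inputs_zero, Function.update_of_ne (by omega)]
      have := Bool.toNat_le (b₁ (len C))
      by_cases hg' : g₁ = []
      · have : b₁ (len C) = false := by rw [← Bool.not_eq_true, h2, hg']; simp
        simp [this]
      · have := List.length_pos_of_ne_nil hg'
        omega
  obtain ⟨b₂, hr₂, h₂, hf₂⟩ := hinv.blocks le_rfl hp₃ fun a ha => hg a (by simp [ha])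
  obtain ⟨b₃, hr₃, h3, h4⟩ := run_glue (fun a ha => hg a (by simp [ha]) :
    ∀ a ∈ g₅, a = glue (len C)) b₂
  have hb₃ : ∀ j < len C, b₃ j = b₂ j := fun j hj => h3 j (by omega)
  rw [Frame.run_append, hr₁, Frame.run_cons, start, step_of_holds (holds_none _ _),
    Frame.run_append, hr₂, Frame.run_append, hr₃, Frame.run_cons] at hgoal
  -- If the output were false, the last action would not fire and nothing else could set the flag
  -- `len C + 2` demanded by the goal.
  have hout : b₃ C.output = true := by
    by_contra hout
    rw [finish, step_of_not_holds] at hgoal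
    · obtain ⟨b₄, hr₄, h5, -⟩ := run_glue (fun a ha => hg a (by simp [ha]) :
        ∀ a ∈ p₆, a = glue (len C)) b₃
      rw [hr₄, meets_iff, holds_single (by omega), h5 _ (by omega), h3 _ (by omega),
        hf₂ _ (by omega), upd_single, Function.update_of_ne (by omega), h1 _ (by omega)] at hgoal
      simp at hgoal
    · intro h
      exact hout (h C.output (by have := C.output_lt; simp only [len]; omega) true (by simp))
  -- The state after the evaluation blocks is itself the assignment: it satisfies all node
  -- equations, and these determine the values of the circuit.
  refine ⟨b₂, ?_, ?_⟩
  · unfold Circuit.Satisfies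
    rw [C.values_unique b₂ (fun j nd hnd => h₂.eval j (List.getElem?_eq_some_iff.1 hnd).1 nd hnd)
      C.output_lt, ← hb₃ _ C.output_lt, hout]
  · have := h₂.count
    rw [weight_eq_inputs]
    simp only [List.length_append]
    omega

/-- A satisfying assignment gives the glue steps. -/
theorem exists_run_blocks (α : ℕ → Bool) (b : ℕ → Bool) (hb : ∀ j ≤ len C, b j = false) {i : ℕ}
    (hi : i ≤ len C) : ∃ g p b', Interleaving (blocks C i) g p ∧ (∀ a ∈ g, a = glue (len C)) ∧
      g.length = inputs C α i ∧ Frame.run (state (len C) b) p = state (len C) b' ∧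
      (∀ j < i, b' j = C.values α (len C) j) ∧ (∀ j, i ≤ j → b' j = b j) := by
  induction i with
  | zero =>
    exact ⟨[], [], b, Interleaving.nil, by simp, by simp [inputs_zero], rfl, by simp, by simp⟩
  | succ i ih =>
    obtain ⟨g, p, b₁, hp, hg, hlen, hr, hval, hrest⟩ := ih (by omega)
    have hnd := List.getElem?_eq_getElem (show i < C.nodes.length from hi)
    generalize C.nodes[i] = nd at hnd
    have hn : b₁ (len C) = false := by rw [hrest _ (by omega), hb _ le_rfl]
    rw [blocks_succ C hnd, inputs_succ]
    by_cases hin : nd = .input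
    · subst hin
      have hv := C.values_eq α hnd
      rw [if_pos hnd]
      cases hα : α i
      · refine ⟨g ++ [], p ++ nodeActs (len C) .input i, b₁, hp.append (.right_nil _),
          by simpa using hg, by simpa using hlen, ?_, fun j hj => ?_,
          fun j hj => hrest j (by omega)⟩
        · rw [Frame.run_append, hr, nodeActs, Frame.run_cons, step_of_not_holds]
          · rfl
          · rw [holds_single (by omega), hn]; simp
        · rcases Nat.lt_succ_iff_lt_or_eq.1 hj with hj | rfl
          · exact hval j hj
          · rw [hv, hrest j le_rfl, hb j (by omega), Node.eval, hα]
      -- For a true input a glue step is inserted directly before the moving action, which empties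
      -- the store again.
      · refine ⟨g ++ [glue (len C)], p ++ (glue (len C) :: nodeActs (len C) .input i),
          upd (move (len C) i) (upd (single (len C) true) b₁),
          hp.append (.right (.right_nil _)), ?_, by simp [hlen], ?_, fun j hj => ?_, fun j hj => ?_⟩
        · simpa [or_imp, forall_and] using hg
        · rw [Frame.run_append, hr, nodeActs, Frame.run_cons, glue, step_of_holds (holds_none _ _),
            Frame.run_cons, step_of_holds]
          · rfl
          · rw [holds_single (by omega), upd_single]; simp
        · rcases Nat.lt_succ_iff_lt_or_eq.1 hj with hj | rfl
          · have h1 : j ≠ C.nodes.length := by simp only [len] at hi; omega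
            simp [upd, move, single, h1, hj.ne, hval j hj]
          · have h1 : j ≠ C.nodes.length := by simp only [len] at hi; omega
            rw [hv]
            simp [upd, move, h1, Node.eval, hα]
        · by_cases h1 : j = C.nodes.length
          · subst h1
            simp [upd, move, hb _ le_rfl]
          · simp [upd, move, single, h1, show j ≠ i by omega, hrest j (by omega)]
    · rw [if_neg (fun h => hin (Option.some.inj (hnd.symm.trans h))), nodeActs_of_ne hin]
      have hpre : ∀ j ∈ nd.preds, j < i := fun j hj => C.lt_of_mem_preds hnd hj
      obtain ⟨b', hr', h1, h2, h3⟩ := run_gate hi (Interleaving.right_nil _) (by simp) (guards nd)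
        rfl (fun φ hφ u hu => hpre u (guard_support hφ hu)) b₁
      have hn' : b' (len C) = b₁ (len C) := by rw [Bool.eq_iff_iff, h3]; simp
      refine ⟨g ++ [], _, b', hp.append (.right_nil _), by simpa using hg, by simpa using hlen,
        by rw [Frame.run_append, hr, hr'], fun j hj => ?_, fun j hj => ?_⟩
      · rcases Nat.lt_succ_iff_lt_or_eq.1 hj with hj | rfl
        · rw [h1 j (by omega) (by omega), hval j hj]
        · rw [C.values_eq α hnd, Bool.eq_iff_iff, h2, hrest j le_rfl, hb j (by omega),
            exists_guard_iff hpre hi hin b₁ (α j), nd.eval_congr _ fun u hu => hval u (hpre u hu)]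
          simp
      · by_cases hj' : j = len C
        · rw [hj', hn', hrest _ (by omega)]
        · rw [h1 j (by omega) hj', hrest j (by omega)]

theorem exists_run_of_satisfies {α : ℕ → Bool} (h : C.Satisfies α) :
    ∃ g p, Interleaving (plan C) g p ∧ (∀ a ∈ g, a = glue (len C)) ∧ g.length = C.weight α ∧
      Frame.Meets (Frame.run (state (len C) fun _ => false) p)
        (part (len C) (single (len C + 2) true)) := by
  obtain ⟨g, p, b', hp, hg, hlen, hr, hval, hrest⟩ := exists_run_blocks (C := C) α
    (upd (single (len C + 1) true) fun _ => false)
    (fun j hj => by rw [upd_single, Function.update_of_ne (by omega)]) le_rfl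
  refine ⟨g ++ [], _, .left (hp.append (.right_nil _)), by simpa using hg,
    by rw [List.append_nil, hlen, weight_eq_inputs], ?_⟩
  rw [Frame.run_cons, start, step_of_holds (holds_none _ _), Frame.run_append, hr, Frame.run_cons,
    finish, step_of_holds]
  · exact meets_iff.2 ((holds_single (by omega)).2 (by rw [upd_single]; simp))
  · intro v hv d hd
    simp only [Option.ite_none_right_eq_some, Option.some.injEq] at hd
    obtain ⟨hv' | hv', rfl⟩ := hd
    · rw [hv', hval _ C.output_lt]; exact h
    · rw [hv', hrest _ (by omega), upd_single]; simp

/-! ### Infixes of the stored plan -/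

theorem post_single_of_ne {n v j : ℕ} {φ : ℕ → Option Bool} (hj : j < n + 3) (h : j ≠ v) :
    (Frame.Action.post (act n φ (single v true))).1 ⟨j, hj⟩ = none := by
  simp [act, part, single, h]

theorem post_of_mem_blocks {i : ℕ} (hi : i ≤ len C) {a : (frame (len C)).Action}
    (ha : a ∈ blocks C i) {j : ℕ} (hj : len C < j) (hj' : j < len C + 3) :
    (Frame.Action.post a).1 ⟨j, hj'⟩ = none := by
  simp only [blocks, List.mem_flatMap, List.mem_range] at ha
  obtain ⟨k, hk, ha⟩ := ha
  by_cases hin : C.nodes.getD k .input = .input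
  · rw [hin] at ha
    simp only [nodeActs, List.mem_singleton] at ha
    subst ha
    have h1 : j ≠ C.nodes.length := by simp only [len] at hj; omega
    simp [act, part, move, h1, show j ≠ k by omega]
  · rw [nodeActs_of_ne hin] at ha
    obtain ⟨φ, -, rfl⟩ := List.mem_map.1 ha
    exact post_single_of_ne hj' (by omega)

/-- Without the first action the start flag stays false, so the last action never fires; without the
last action the end flag is never set. In both cases this is an invariant of all remaining actions,
since blocks and glue steps do not touch the flags, and the goal fails. -/
theorem eq_plan_of_run {c g p : List (frame (len C)).Action} (hc : c <:+: plan C)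
    (hp : Interleaving c g p) (hg : ∀ a ∈ g, a = glue (len C))
    (hgoal : Frame.Meets (Frame.run (state (len C) fun _ => false) p)
      (part (len C) (single (len C + 2) true))) : c = plan C := by
  obtain ⟨s, t, hst⟩ := hc
  have hfin : ∀ b : (frame (len C)).State, Frame.Meets b (part (len C) (single (len C + 2) true)) →
      b.1 ⟨len C + 2, Nat.lt_succ_self _⟩ ≠ 0 := by
    intro b hb h0
    have := hb ⟨len C + 2, Nat.lt_succ_self _⟩ 1 (by simp [part, single])
    omega
  have hs : s = [] := by
    by_contra hs
    obtain ⟨x, s, rfl⟩ := List.exists_cons_of_ne_nil hs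
    have hc : ∀ a ∈ c, a ∈ blocks C (len C) ∨ a = finish (len C) C.output := by
      intro a ha
      have : s ++ c ++ t = blocks C (len C) ++ [finish (len C) C.output] := (List.cons.inj hst).2
      have h : a ∈ blocks C (len C) ++ [finish (len C) C.output] := by
        rw [← this]; simp [ha]
      simpa using h
    refine hfin _ hgoal (Frame.run_invariant
      (P := fun b => b.1 ⟨len C + 2, Nat.lt_succ_self _⟩ = 0 ∧ b.1 ⟨len C + 1, by
        simp [frame]⟩ = 0) (fun a ha b hb => ?_) ⟨rfl, rfl⟩).1
    rcases hp.mem_or_mem ha with ha | ha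
    · rcases hc a ha with ha | rfl
      · rw [Frame.step_apply_of_none (post_of_mem_blocks le_rfl ha (by omega) _),
          Frame.step_apply_of_none (post_of_mem_blocks le_rfl ha (by omega) _)]
        exact hb
      · unfold Frame.step
        rw [if_neg]
        · exact hb
        · intro h
          have := h ⟨len C + 1, by simp [frame]⟩ 1 (by simp [finish, act, part, Frame.Action.pre])
          omega
    · rw [hg a ha, glue, Frame.step_apply_of_none (post_single_of_ne _ (by omega)),
        Frame.step_apply_of_none (post_single_of_ne _ (by omega))]
      exact hb
  subst hs
  have ht : t = [] := by
    by_contra ht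
    have hc : ∀ a ∈ c, a = start (len C) ∨ a ∈ blocks C (len C) := by
      intro a ha
      have h1 := congrArg List.dropLast hst
      rw [List.nil_append, List.dropLast_append_of_ne_nil ht, plan, ← List.cons_append,
        List.dropLast_concat] at h1
      have h : a ∈ start (len C) :: blocks C (len C) := by rw [← h1]; simp [ha]
      simpa using h
    refine hfin _ hgoal (Frame.run_invariant
      (P := fun b => b.1 ⟨len C + 2, Nat.lt_succ_self _⟩ = 0) (fun a ha b hb => ?_) rfl)
    rcases hp.mem_or_mem ha with ha | ha
    · rcases hc a ha with rfl | ha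
      · rw [start, Frame.step_apply_of_none (post_single_of_ne _ (by omega))]
        exact hb
      · rw [Frame.step_apply_of_none (post_of_mem_blocks le_rfl ha (by omega) _)]
        exact hb
    · rw [hg a ha, glue, Frame.step_apply_of_none (post_single_of_ne _ (by omega))]
      exact hb
  subst ht
  simpa using hst

end Guess

/-! ### Instances as lists without dependent types. -/

theorem codeList_map {α β : Type} [Coding α] [Coding β] (f : α → β) (l : List α)
    (h : ∀ a ∈ l, Coding.code (f a) = Coding.code a) :
    (Coding.code (l.map f) : Data) = Coding.code l := by
  show codeList _ = codeList _
  induction l with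
  | nil => rfl
  | cons a l ih =>
    simp only [List.map_cons, codeList]
    rw [h a List.mem_cons_self, ih fun b hb => h b (List.mem_cons_of_mem _ hb)]

theorem ofFn_eq_map_range {α : Type} (n : ℕ) (f : ℕ → α) :
    List.ofFn (fun v : Fin n => f v) = (List.range n).map f := by
  refine List.ext_getElem (by simp) fun i h1 h2 => by simp

/-- A polynomial-time function, applied to a family of arguments. -/
theorem PTime.toComp {ι α β : Type} [Coding α] [Coding β] {f : α → β} (hf : PTime f)
    {μ : ι → ℕ} (x : ι → α) (hx : PolyBdd μ fun i => csize (x i)) :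
    Comp μ (fun i => Coding.code (x i)) (fun i => Coding.code (f (x i))) := by
  obtain ⟨p, T, hT, h⟩ := hf
  exact ⟨p, fun i => T (x i), hT.comp x hx, fun i => h (x i)⟩

/-- Partial states and actions without the proofs that the values belong to the domains. -/
abbrev RawAction : Type := List (Option ℕ) × List (Option ℕ)

/-- The list of the values of a partial state, for an action. -/
def Frame.Action.raw {F : Frame} (a : F.Action) : RawAction := (List.ofFn a.1.1, List.ofFn a.2.1)

theorem Frame.Action.code_raw {F : Frame} (a : F.Action) :
    (Coding.code a.raw : Data) = Coding.code a := rfl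

/-- Planning instances with a stored case, without the dependencies between the components. -/
abbrev RawPlanMod : Type := List (List ℕ) × (List ℕ × List (Option ℕ) × List RawAction) ×
  (List ℕ × List (Option ℕ) × List RawAction) × List RawAction × ℕ

/-- The components of an instance as lists. -/
def PlanModInstance.raw (x : PlanModInstance) : RawPlanMod :=
  (List.ofFn x.frame.dom, (List.ofFn x.init.1, List.ofFn x.goal.1, x.actions.map Frame.Action.raw),
    (List.ofFn x.caseInit.1, List.ofFn x.caseGoal.1, x.casePlan.map Frame.Action.raw),
    x.glue.map Frame.Action.raw, x.maxSteps)

/-- Codes ignore the proofs in subtypes and treat tuples as lists. Programs may therefore be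
constructed for the non-dependent type, to which the calculus of `PTime` applies. -/
theorem PlanModInstance.code_raw (x : PlanModInstance) :
    (Coding.code x.raw : Data) = Coding.code x := by
  have h (l : List x.frame.Action) : (Coding.code (l.map Frame.Action.raw) : Data) =
    Coding.code l := codeList_map _ l fun a _ => a.code_raw
  have h1 := h x.actions
  have h2 := h x.casePlan
  have h3 := h x.glue
  show Data.cons _ (Data.cons (Data.cons _ (Data.cons _ _)) (Data.cons (Data.cons _
    (Data.cons _ _)) (Data.cons _ _))) = Data.cons _ (Data.cons (Data.cons _ (Data.cons _ _))
      (Data.cons (Data.cons _ (Data.cons _ _)) (Data.cons _ _)))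
  simp only [PlanModInstance.raw] at h1 h2 h3 ⊢
  rw [h1, h2, h3]
  rfl

namespace Guess

/-- The instance of plan reuse for a circuit. -/
def toPlanMod (x : WSatInstance) : PlanModInstance where
  frame := frame (len x.circuit)
  init := state _ fun _ => false
  goal := part _ (single (len x.circuit + 2) true)
  actions := glue _ :: plan x.circuit
  caseInit := state _ fun _ => false
  caseGoal := part _ fun _ => none
  casePlan := plan x.circuit
  casePlan_subset := fun _ h => List.mem_cons_of_mem _ h
  casePlan_solves := fun v d h => by simp [part] at h
  glue := [glue _]
  glue_subset := by simp
  maxSteps := x.k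

theorem reusable_iff (x : WSatInstance) :
    (toPlanMod x).Reusable (plan x.circuit) ↔ weightedCircuitSat.yes x := by
  constructor
  · rintro ⟨g, p, hlen, hg, hp, hgoal⟩
    obtain ⟨α, h1, h2⟩ := satisfiable_of_run hp (fun a ha => List.mem_singleton.1 (hg a ha)) hgoal
    exact ⟨α, h1, h2.trans hlen⟩
  · rintro ⟨α, h1, h2⟩
    obtain ⟨g, p, hp, hg, hlen, hgoal⟩ := exists_run_of_satisfies h1
    exact ⟨g, p, hlen.trans_le h2, fun a ha => List.mem_singleton.2 (hg a ha), hp, hgoal⟩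

theorem exists_infix_reusable_iff (x : WSatInstance) :
    (∃ c, c <:+: plan x.circuit ∧ (toPlanMod x).Reusable c) ↔ weightedCircuitSat.yes x := by
  rw [← reusable_iff]
  constructor
  · rintro ⟨c, hc, hr⟩
    obtain ⟨g, p, hlen, hg, hp, hgoal⟩ := hr
    have := eq_plan_of_run hc hp (fun a ha => List.mem_singleton.1 (hg a ha)) hgoal
    subst this
    exact ⟨g, p, hlen, hg, hp, hgoal⟩
  · exact fun h => ⟨_, List.infix_rfl, h⟩

/-- The single glue action has an empty precondition and sets one variable to one value. The `3`
bounds the contributions of variables, values and actions, and the sum over `R` is at most the sum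
over all four restrictions. -/
theorem parameter_le (R : Finset Restriction) (x : WSatInstance) :
    parameter R (toPlanMod x) ≤ x.k + 3 := by
  have hV : (toPlanMod x).numGlueVars ≤ 1 := by
    unfold PlanModInstance.numGlueVars
    refine (Set.ncard_le_ncard (t := {⟨len x.circuit, by simp [toPlanMod, frame]⟩}) ?_).trans
      (Set.ncard_singleton _).le
    rintro ⟨v, hv⟩ ⟨a, ha, d, h⟩
    obtain rfl : a = glue (len x.circuit) := List.mem_singleton.1 ha
    simp only [glue, act, part, Frame.Action.pre, Frame.Action.post, single, Option.map_none,
      reduceCtorEq, false_or, Option.map_eq_some_iff, Option.ite_none_right_eq_some] at h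
    obtain ⟨b, ⟨rfl, -⟩, -⟩ := h
    rfl
  have hD : (toPlanMod x).numGlueValues ≤ 1 := by
    unfold PlanModInstance.numGlueValues
    refine (Set.ncard_le_ncard (t := {1}) ?_).trans (Set.ncard_singleton _).le
    rintro d ⟨a, ha, v, h⟩
    obtain rfl : a = glue (len x.circuit) := List.mem_singleton.1 ha
    simp only [glue, act, part, Frame.Action.pre, Frame.Action.post, single, Option.map_none,
      reduceCtorEq, false_or, Option.map_eq_some_iff, Option.ite_none_right_eq_some,
      Option.some.injEq] at h
    obtain ⟨b, ⟨-, rfl⟩, rfl⟩ := h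
    rfl
  have hA : (toPlanMod x).numGlueActions ≤ 1 := by
    unfold PlanModInstance.numGlueActions
    refine (Set.ncard_le_ncard (t := {glue _}) ?_).trans (Set.ncard_singleton _).le
    exact fun a ha => List.mem_singleton.1 ha
  unfold parameter
  refine (Finset.sum_le_sum_of_subset (t := {.L, .V, .D, .A})
    fun r _ => by cases r <;> simp).trans ?_
  rw [Finset.sum_insert (by decide), Finset.sum_insert (by decide), Finset.sum_insert (by decide),
    Finset.sum_singleton]
  have hL : (toPlanMod x).maxSteps = x.k := rfl
  simp only
  omega

/-! ### The reduction in polynomial time -/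

/-- The list of the values of a partial Boolean assignment. -/
def rawPart (r : List ℕ) (φ : ℕ → Option Bool) : List (Option ℕ) :=
  r.map fun v => (φ v).map Bool.toNat

/-- The list version of `act`. -/
def rawAct (r : List ℕ) (φ ψ : ℕ → Option Bool) : RawAction := (rawPart r φ, rawPart r ψ)

theorem raw_part (n : ℕ) (φ : ℕ → Option Bool) :
    List.ofFn (part n φ).1 = rawPart (List.range (n + 3)) φ :=
  ofFn_eq_map_range (n + 3) fun v => (φ v).map Bool.toNat

theorem raw_act (n : ℕ) (φ ψ : ℕ → Option Bool) :
    (act n φ ψ).raw = rawAct (List.range (n + 3)) φ ψ := by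
  simp only [Frame.Action.raw, act, raw_part, rawAct]

/-- The list version of `nodeActs`. -/
def rawNodeActs (r : List ℕ) (n : ℕ) (nd : ℕ × List ℕ) (i : ℕ) : List RawAction :=
  if nd.1 = 0 then [rawAct r (single n true) (move n i)]
  else if nd.1 = 1 then [rawAct r (single (nd.2.headD 0) false) (single i true)]
  else if nd.1 = 2 then
    [rawAct r (fun u => if u ∈ nd.2 then some true else none) (single i true)]
  else nd.2.map fun j => rawAct r (single j true) (single i true)

theorem raw_nodeActs (n : ℕ) (nd : Node) (i : ℕ) :
    (nodeActs n nd i).map Frame.Action.raw = rawNodeActs (List.range (n + 3)) n nd.toPair i := by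
  cases nd with
  | conj l =>
    simp only [nodeActs, guards, List.map_cons, List.map_nil, raw_act]
    rfl
  | _ => simp [nodeActs, rawNodeActs, guards, Node.toPair, raw_act]

/-- The list version of `plan`. -/
def rawPlan (r : List ℕ) (N : List (ℕ × List ℕ)) (out : ℕ) : List RawAction :=
  rawAct r (fun _ => none) (single (N.length + 1) true) ::
    ((N.zipIdx.flatMap fun q => rawNodeActs r N.length q.1 q.2) ++
    [rawAct r (fun u => if u = out ∨ u = N.length + 1 then some true else none)
      (single (N.length + 2) true)])

theorem raw_plan (C : Circuit) : (plan C).map Frame.Action.raw =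
    rawPlan (List.range (len C + 3)) (C.nodes.map Node.toPair) C.output := by
  -- The plan is indexed by node numbers with a default for missing nodes, the list version walks
  -- along the nodes; below the length the default is never used.
  have h : (C.nodes.map Node.toPair).zipIdx =
      (List.range (len C)).map fun j => ((C.nodes.getD j .input).toPair, j) := by
    refine List.ext_getElem (by simp) fun i h1 h2 => ?_
    simp only [List.length_zipIdx, List.length_map] at h1
    simp [h1]
  simp only [plan, rawPlan, h, List.map_cons, List.map_append, List.map_nil, start, finish, raw_act,
    blocks, List.map_flatMap, List.flatMap_map, raw_nodeActs, List.length_map]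

/-- The list version of `toPlanMod`. -/
def rawPlanMod (a : List (ℕ × List ℕ) × ℕ × ℕ) : RawPlanMod :=
  let n := a.1.length
  let r := List.range (n + 3)
  let G := rawAct r (fun _ => none) (single n true)
  (r.map fun _ => [0, 1], (r.map fun _ => 0, rawPart r (single (n + 2) true),
    G :: rawPlan r a.1 a.2.1), (r.map fun _ => 0, rawPart r fun _ => none, rawPlan r a.1 a.2.1),
    [G], a.2.2)

theorem raw_toPlanMod (x : WSatInstance) : (toPlanMod x).raw =
    rawPlanMod (x.circuit.nodes.map Node.toPair, x.circuit.output, x.k) := by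
  simp only [PlanModInstance.raw, toPlanMod, rawPlanMod, List.length_map, raw_plan, List.map_cons,
    List.map_nil, glue, raw_act, raw_part]
  congr 1
  · exact ofFn_eq_map_range _ fun _ => [0, 1]
  · have h : List.ofFn (state (len x.circuit) fun _ => false).1 =
        (List.range (len x.circuit + 3)).map fun _ => 0 := ofFn_eq_map_range _ fun _ => 0
    rw [h]

section

variable {α : Type} [Coding α]

theorem ptime_single {v u : α → ℕ} (d : Bool) (hv : PTime v) (hu : PTime u) :
    PTime fun a => single (v a) d (u a) := .ite (.eq hu hv) (.const _) (.const _)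

theorem ptime_move {n i u : α → ℕ} (hn : PTime n) (hi : PTime i) (hu : PTime u) :
    PTime fun a => move (n a) (i a) (u a) :=
  .ite (.eq hu hn) (.const _) (.ite (.eq hu hi) (.const _) (.const _))

/-- Functions have no code, so `φ` enters as a polynomial-time function of the argument and the
variable. Its value is compared with constants to produce the number. -/
theorem ptime_rawPart {r : α → List ℕ} {φ : α → ℕ → Option Bool} (hr : PTime r)
    (hφ : PTime fun q : α × ℕ => φ q.1 q.2) : PTime fun a => rawPart (r a) (φ a) := by
  refine PTime.map (g := fun a v => (φ a v).map Bool.toNat) hr ((PTime.ite (.eq hφ (.const none))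
    (.const none) (.ite (.eq hφ (.const (some true))) (.const (some 1)) (.const (some 0)))).congr
      fun q => ?_)
  rcases φ q.1 q.2 with _ | _ | _ <;> simp

theorem ptime_rawAct {r : α → List ℕ} {φ ψ : α → ℕ → Option Bool} (hr : PTime r)
    (hφ : PTime fun q : α × ℕ => φ q.1 q.2) (hψ : PTime fun q : α × ℕ => ψ q.1 q.2) :
    PTime fun a => rawAct (r a) (φ a) (ψ a) := .pair (ptime_rawPart hr hφ) (ptime_rawPart hr hψ)

theorem ptime_rawNodeActs {r : α → List ℕ} {n i : α → ℕ} {nd : α → ℕ × List ℕ} (hr : PTime r)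
    (hn : PTime n) (hnd : PTime nd) (hi : PTime i) :
    PTime fun a => rawNodeActs (r a) (n a) (nd a) (i a) := by
  have hi' : PTime fun q : α × ℕ => single (i q.1) true q.2 :=
    ptime_single true (hi.comp (.fst .id)) (.snd .id)
  refine .ite (.eq hnd.fst (.const _)) ?_ (.ite (.eq hnd.fst (.const _)) ?_
    (.ite (.eq hnd.fst (.const _)) ?_ ?_))
  · exact .cons (ptime_rawAct hr (ptime_single _ (hn.comp (.fst .id)) (.snd .id))
      (ptime_move (hn.comp (.fst .id)) (hi.comp (.fst .id)) (.snd .id))) (.const [])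
  · exact .cons (ptime_rawAct hr (ptime_single _ (.headD (hnd.snd.comp (.fst .id)) 0) (.snd .id))
      hi') (.const [])
  · exact .cons (ptime_rawAct hr (.ite (.mem (.snd .id) (hnd.snd.comp (.fst .id))) (.const _)
      (.const _)) hi') (.const [])
  · exact .map hnd.snd (ptime_rawAct (hr.comp (.fst .id))
      (ptime_single _ (.snd (.fst .id)) (.snd .id))
      (ptime_single _ (hi.comp (.fst (.fst .id))) (.snd .id)))

theorem ptime_rawPlan {r : α → List ℕ} {N : α → List (ℕ × List ℕ)} {out : α → ℕ} (hr : PTime r)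
    (hN : PTime N) (ho : PTime out) : PTime fun a => rawPlan (r a) (N a) (out a) := by
  have hn : PTime fun a => (N a).length := hN.length
  have hn' : PTime fun q : α × ℕ => (N q.1).length := hn.comp (.fst .id)
  refine .cons (ptime_rawAct hr (.const none) (ptime_single _ hn'.succ (.snd .id)))
    (.append (.flatMap hN.zipIdx (ptime_rawNodeActs (hr.comp (.fst .id)) (hn.comp (.fst .id))
      (.fst (.snd .id)) (.snd (.snd .id)))) (.cons (ptime_rawAct hr ?_
      (ptime_single _ hn'.succ.succ (.snd .id))) (.const [])))
  refine (PTime.ite (.eq (.snd .id) (ho.comp (.fst .id))) (.const (some true))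
    (.ite (.eq (.snd .id) hn'.succ) (.const (some true)) (.const none))).congr fun q => ?_
  by_cases h1 : q.2 = out q.1 <;> by_cases h2 : q.2 = (N q.1).length + 1 <;> simp [h1, h2]

theorem ptime_rawPlanMod : PTime rawPlanMod := by
  have hN : PTime fun a : List (ℕ × List ℕ) × ℕ × ℕ => a.1 := .fst .id
  have hn : PTime fun q : (List (ℕ × List ℕ) × ℕ × ℕ) × ℕ => q.1.1.length :=
    hN.length.comp (.fst .id)
  -- The range is read off a list padded by three dummy nodes.
  have hr : PTime fun a : List (ℕ × List ℕ) × ℕ × ℕ => List.range (a.1.length + 3) :=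
    PTime.range_length
      (f := fun a : List (ℕ × List ℕ) × ℕ × ℕ => (0, []) :: (0, []) :: (0, []) :: a.1)
      (.cons (.const _) (.cons (.const _) (.cons (.const _) hN)))
  have hG := ptime_rawAct (φ := fun _ _ => none) (ψ := fun a => single a.1.length true) hr
    (.const none) (ptime_single true hn (.snd .id))
  have hp := ptime_rawPlan hr hN (.fst (.snd .id))
  have hs : PTime fun a : List (ℕ × List ℕ) × ℕ × ℕ =>
      (List.range (a.1.length + 3)).map fun _ => 0 :=
    .map hr (.const 0)
  exact .pair (.map hr (.const [0, 1])) (.pair (.pair hs (.pair (ptime_rawPart hr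
    (ptime_single true hn.succ.succ (.snd .id))) (.cons hG hp))) (.pair (.pair hs (.pair
    (ptime_rawPart (φ := fun _ _ => none) hr (.const none)) hp)) (.pair (.cons hG (.const []))
    (.snd (.snd .id)))))

end

theorem comp_toPlanMod : Comp (ι := WSatInstance)
    (fun x => (Coding.code x : Data).size + x.k) (fun x => Coding.code x)
    (fun x => Coding.code (toPlanMod x)) := by
  have hcode : ∀ x : WSatInstance, (Coding.code (x.circuit.nodes.map Node.toPair, x.circuit.output,
      x.k) : Data) = Coding.code x := fun x =>
    congrArg (fun d => Data.cons d _) (codeList_map Node.toPair _ fun _ _ => rfl)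
  have h := ptime_rawPlanMod.toComp (μ := fun x : WSatInstance => (Coding.code x : Data).size + x.k)
    (fun x : WSatInstance => (x.circuit.nodes.map Node.toPair, x.circuit.output, x.k))
    (PolyBdd.refl.mono fun x => by
      unfold csize; rw [hcode]; exact Nat.le_add_right _ _)
  simpa only [hcode, ← raw_toPlanMod, PlanModInstance.code_raw] using h

end Guess

/-! ### The hardness reductions, for all sets of restrictions. -/

theorem weightedCircuitSat_reducible_planMod (R : Finset Restriction) :
    FptReducible weightedCircuitSat (planMod R) :=
  .of_comp Guess.toPlanMod (fun x => (Guess.reusable_iff x).symm)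
    (computable_add Computable.id (Computable.const 3)) (Guess.parameter_le R) Guess.comp_toPlanMod

theorem weightedCircuitSat_reducible_planModStar (R : Finset Restriction) :
    FptReducible weightedCircuitSat (planModStar R) :=
  .of_comp Guess.toPlanMod (fun x => (Guess.exists_infix_reusable_iff x).symm)
    (computable_add Computable.id (Computable.const 3)) (Guess.parameter_le R) Guess.comp_toPlanMod

namespace Unfold

/-! ## Plan reuse reduces to weighted circuit satisfiability -/

/-! ### Sequences of optional and mandatory actions -/

section

variable {A : Type}

/-- `Sel l g p`: the sequence `p` is obtained from `l` by omitting some of the optional entries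
(those marked by `true`), and `g` is the sequence of the optional entries that are kept. -/
inductive Sel : List (Bool × A) → List A → List A → Prop where
  | nil : Sel [] [] []
  | skip {a : A} {l : List (Bool × A)} {g p : List A} : Sel l g p → Sel ((true, a) :: l) g p
  | take {a : A} {l : List (Bool × A)} {g p : List A} :
      Sel l g p → Sel ((true, a) :: l) (a :: g) (a :: p)
  | must {a : A} {l : List (Bool × A)} {g p : List A} : Sel l g p → Sel ((false, a) :: l) g (a :: p)

theorem Sel.append {l l' : List (Bool × A)} {g g' p p' : List A} (h : Sel l g p)
    (h' : Sel l' g' p') : Sel (l ++ l') (g ++ g') (p ++ p') := by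
  induction h with
  | nil => exact h'
  | skip _ ih => exact .skip ih
  | take _ ih => exact .take ih
  | must _ ih => exact .must ih

theorem Sel.interleaving {l : List (Bool × A)} {g p : List A} (h : Sel l g p) :
    Interleaving ((l.filter fun q => !q.1).map Prod.snd) g p ∧ ∀ a ∈ g, (true, a) ∈ l := by
  induction h with
  | nil => exact ⟨.nil, by simp⟩
  | skip _ ih => exact ⟨ih.1, fun a ha => List.mem_cons_of_mem _ (ih.2 a ha)⟩
  | take _ ih =>
    refine ⟨.right ih.1, fun a ha => ?_⟩
    rcases List.mem_cons.1 ha with rfl | ha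
    · exact List.mem_cons_self
    · exact List.mem_cons_of_mem _ (ih.2 a ha)
  | must _ ih => exact ⟨.left ih.1, fun a ha => List.mem_cons_of_mem _ (ih.2 a ha)⟩

/-- The entries of `l` that are kept if `σ` chooses the optional entries. -/
def selected (l : List (Bool × A)) (k : ℕ) (σ : ℕ → Bool) : List A :=
  ((l.zipIdx k).filter fun q => !q.1.1 || σ q.2).map fun q => q.1.2

/-- The optional entries of `l` that are chosen by `σ`. -/
def chosen (l : List (Bool × A)) (k : ℕ) (σ : ℕ → Bool) : List ((Bool × A) × ℕ) :=
  (l.zipIdx k).filter fun q => q.1.1 && σ q.2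

theorem sel_selected (l : List (Bool × A)) (k : ℕ) (σ : ℕ → Bool) :
    Sel l ((chosen l k σ).map fun q => q.1.2) (selected l k σ) := by
  induction l generalizing k with
  | nil => exact .nil
  | cons x l ih =>
    obtain ⟨o, a⟩ := x
    have := ih (k + 1)
    cases o
    · simpa [chosen, selected, List.zipIdx_cons] using Sel.must this
    · cases h : σ k
      · simpa [chosen, selected, List.zipIdx_cons, h] using Sel.skip this
      · simpa [chosen, selected, List.zipIdx_cons, h] using Sel.take this

/-- Together with `sel_selected` this makes selections the same as choice functions on positions.
The starting index `k` is general for the sake of the induction. -/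
theorem Sel.exists_selected {l : List (Bool × A)} {g p : List A} (h : Sel l g p) (k : ℕ) :
    ∃ σ, selected l k σ = p ∧ (chosen l k σ).length = g.length := by
  -- The tail is numbered from `k + 1`, so the choice for the head can be stored at `k` without
  -- affecting it.
  have congr : ∀ (l : List (Bool × A)) (k : ℕ) (σ : ℕ → Bool) (b : Bool),
      selected l (k + 1) (Function.update σ k b) = selected l (k + 1) σ ∧
      chosen l (k + 1) (Function.update σ k b) = chosen l (k + 1) σ := by
    intro l k σ b
    have h : ∀ q ∈ l.zipIdx (k + 1), Function.update σ k b q.2 = σ q.2 := fun q hq =>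
      Function.update_of_ne (by have := List.le_snd_of_mem_zipIdx hq; omega) _ _
    constructor
    · unfold selected
      rw [List.filter_congr fun q hq => by rw [h q hq]]
    · unfold chosen
      rw [List.filter_congr fun q hq => by rw [h q hq]]
  induction h generalizing k with
  | nil => exact ⟨fun _ => false, rfl, rfl⟩
  | skip _ ih =>
    obtain ⟨σ, h1, h2⟩ := ih (k + 1)
    rw [← (congr _ k σ false).1] at h1
    rw [← (congr _ k σ false).2] at h2
    exact ⟨Function.update σ k false, by simpa [selected, List.zipIdx_cons] using h1,
      by simpa [chosen, List.zipIdx_cons] using h2⟩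
  | take _ ih =>
    obtain ⟨σ, h1, h2⟩ := ih (k + 1)
    rw [← (congr _ k σ true).1] at h1
    rw [← (congr _ k σ true).2] at h2
    exact ⟨Function.update σ k true, by simpa [selected, List.zipIdx_cons] using h1,
      by simpa [chosen, List.zipIdx_cons] using h2⟩
  | must _ ih =>
    obtain ⟨σ, h1, h2⟩ := ih (k + 1)
    exact ⟨σ, by simpa [selected, List.zipIdx_cons] using h1,
      by simpa [chosen, List.zipIdx_cons] using h2⟩

theorem selected_concat (l : List (Bool × A)) (x : Bool × A) (σ : ℕ → Bool) :
    selected (l ++ [x]) 0 σ =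
      selected l 0 σ ++ if (!x.1 || σ l.length) = true then [x.2] else [] := by
  unfold selected
  rw [List.zipIdx_append, List.filter_append, List.map_append]
  congr 1
  simp only [List.zipIdx_singleton, Nat.zero_add, List.filter_cons, List.filter_nil]
  split_ifs <;> rfl

/-- In every gap of `c` there is room for a number of glue steps that is given in unary. -/
def gap {B : Type} (u : List B) (G : List A) : List (Bool × A) :=
  u.flatMap fun _ => G.map fun a => (true, a)

/-- The stored plan, with optional glue steps in the gaps. -/
def slots {B : Type} (u : List B) (G c : List A) : List (Bool × A) :=
  (c.flatMap fun a => gap u G ++ [(false, a)]) ++ gap u G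

theorem filter_gap {B : Type} (u : List B) (G : List A) :
    (gap u G).filter (fun q => !q.1) = [] := by
  rw [List.filter_eq_nil_iff]
  intro q hq
  simp only [gap, List.mem_flatMap, List.mem_map] at hq
  obtain ⟨_, _, a, _, rfl⟩ := hq
  simp

theorem filter_slots {B : Type} (u : List B) (G c : List A) :
    ((slots u G c).filter fun q => !q.1).map Prod.snd = c := by
  unfold slots
  rw [List.filter_append, filter_gap, List.append_nil]
  induction c with
  | nil => rfl
  | cons a c ih => simp [filter_gap, ih]

theorem mem_of_mem_slots {B : Type} {u : List B} {G c : List A} {a : A}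
    (h : (true, a) ∈ slots u G c) : a ∈ G := by
  have key : (true, a) ∈ gap u G → a ∈ G := by
    intro h
    simp only [gap, List.mem_flatMap, List.mem_map] at h
    obtain ⟨_, _, b, hb, h⟩ := h
    obtain rfl := (Prod.mk.inj h).2
    exact hb
  unfold slots at h
  rcases List.mem_append.1 h with h | h
  · obtain ⟨b, _, h⟩ := List.mem_flatMap.1 h
    rcases List.mem_append.1 h with h | h
    · exact key h
    · simp at h
  · exact key h

theorem sel_map_nil (G : List A) : Sel (G.map fun a => (true, a)) [] [] := by
  induction G with
  | nil => exact .nil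
  | cons a G ih => exact .skip ih

theorem sel_map_singleton {G : List A} {a : A} (h : a ∈ G) :
    Sel (G.map fun a => (true, a)) [a] [a] := by
  induction G with
  | nil => simp at h
  | cons b G ih =>
    rcases List.mem_cons.1 h with rfl | h
    · exact .take (sel_map_nil G)
    · exact .skip (ih h)

theorem sel_gap {B : Type} {u : List B} {G g : List A} (hg : ∀ a ∈ g, a ∈ G)
    (h : g.length ≤ u.length) : Sel (gap u G) g g := by
  induction u generalizing g with
  | nil =>
    obtain rfl : g = [] := List.eq_nil_of_length_eq_zero (by simpa using h)
    exact .nil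
  | cons b u ih =>
    cases g with
    | nil => exact (sel_map_nil G).append (ih (by simp) (by simp))
    | cons a g =>
      exact (sel_map_singleton (hg a (by simp))).append
        (ih (fun a ha => hg a (by simp [ha])) (by simpa using h))

/-- A gap consists of `u.length` copies of `G`. Taking one action from each of the first copies
realizes any sequence of at most that many glue actions in that gap; the mandatory entries are `c`
in order. -/
theorem sel_slots_iff {B : Type} {u : List B} {G c g p : List A} (h : g.length ≤ u.length) :
    Sel (slots u G c) g p ↔ Interleaving c g p ∧ ∀ a ∈ g, a ∈ G := by
  constructor
  · intro hs
    obtain ⟨h1, h2⟩ := hs.interleaving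
    rw [filter_slots] at h1
    exact ⟨h1, fun a ha => mem_of_mem_slots (h2 a ha)⟩
  · rintro ⟨hp, hg⟩
    induction c generalizing g p with
    | nil =>
      obtain rfl := hp.eq_of_nil
      simpa [slots] using sel_gap hg h
    | cons a c ih =>
      obtain ⟨g₁, g₂, p₂, rfl, rfl, hp₂⟩ := hp.exists_of_cons
      simp only [List.length_append] at h
      have h1 := sel_gap (u := u) (fun a ha => hg a (by simp [ha]) : ∀ a ∈ g₁, a ∈ G) (by omega)
      have h2 := ih (g := g₂) (by omega) hp₂ fun a ha => hg a (by simp [ha])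
      have h3 := h1.append (Sel.must (a := a) h2)
      simpa [slots] using h3

end

/-! ### The circuit -/

/-- The assignments of a value to a variable, for the given list of domains. -/
def fluents (D : List (List ℕ)) : List (ℕ × ℕ) :=
  D.zipIdx.flatMap fun q => q.1.map fun d => (q.2, d)

/-- The partial state assigns the value to the variable. -/
def assigns (p : List (Option ℕ)) (e : ℕ × ℕ) : Bool := decide ((some e.2, e.1) ∈ p.zipIdx)

/-- The partial state assigns some value to the variable. -/
def mentions (p : List (Option ℕ)) (v : ℕ) : Bool :=
  p.zipIdx.any fun q => decide (q.2 = v ∧ ¬ q.1 = none)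

/-- The number of the node `r` of block `t`, with `w` fluents. -/
def pos (w t r : ℕ) : ℕ := t * (w + 3) + r

/-- The nodes of block `t` for the fluents of the partial state `p`. -/
def condNodes (fl : List (ℕ × ℕ)) (p : List (Option ℕ)) (t : ℕ) : List ℕ :=
  (fl.zipIdx.filter fun q => assigns p q.1).map fun q => pos fl.length t q.2

/-- The node for a fluent after step `t`, where `p` is the postcondition of the action. -/
def updNode (w : ℕ) (p : List (Option ℕ)) (t : ℕ) (q : (ℕ × ℕ) × ℕ) : Node :=
  if assigns p q.1 = true then .disj [pos w t q.2, pos w t (w + 1)]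
  else if mentions p q.1.1 = true then .conj [pos w t q.2, pos w t (w + 2)]
  else .conj [pos w t q.2]

/-- The nodes for step `t`: whether the step is chosen, whether the action is applied, the negation
of this, and the fluents after the step. -/
def stepNodes (fl : List (ℕ × ℕ)) (t : ℕ) (x : Bool × RawAction) : List Node :=
  (if x.1 = true then .input else .conj []) ::
    .conj (pos fl.length t fl.length :: condNodes fl x.2.1 t) ::
    .neg (pos fl.length t (fl.length + 1)) ::
    fl.zipIdx.map fun q => updNode fl.length x.2.2 t q

/-- The node for a fluent in the initial state. -/
def initNode (s : List ℕ) (e : ℕ × ℕ) : Node :=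
  if (e.2, e.1) ∈ s.zipIdx then .conj [] else .disj []

/-- The circuit that simulates the plan. -/
def nodes (fl : List (ℕ × ℕ)) (s : List ℕ) (goal : List (Option ℕ))
    (steps : List (Bool × RawAction)) : List Node :=
  fl.map (initNode s) ++ ((steps.zipIdx.flatMap fun q => stepNodes fl q.2 q.1) ++
    [.conj (condNodes fl goal steps.length)])

theorem length_stepNodes (fl : List (ℕ × ℕ)) (t : ℕ) (x : Bool × RawAction) :
    (stepNodes fl t x).length = fl.length + 3 := by simp [stepNodes]

theorem length_flatMap_zipIdx {α β : Type} {g : α × ℕ → List β} {B : ℕ}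
    (hg : ∀ q, (g q).length = B) (l : List α) (k : ℕ) :
    ((l.zipIdx k).flatMap g).length = l.length * B := by
  induction l generalizing k with
  | nil => simp
  | cons a l ih => simp [List.zipIdx_cons, hg, ih, Nat.succ_mul, Nat.add_comm]

/-- The address computation behind `pos`: blocks of constant length are located by multiplication.
-/
theorem getElem?_flatMap_zipIdx {α β : Type} {g : α × ℕ → List β} {B : ℕ}
    (hg : ∀ q, (g q).length = B) {l : List α} {k t : ℕ} {a : α} (ht : l[t]? = some a) {j : ℕ}
    (hj : j < B) : ((l.zipIdx k).flatMap g)[t * B + j]? = (g (a, k + t))[j]? := by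
  induction l generalizing k t with
  | nil => simp at ht
  | cons b l ih =>
    rw [List.zipIdx_cons, List.flatMap_cons]
    cases t with
    | zero =>
      obtain rfl : b = a := by simpa using ht
      rw [List.getElem?_append_left (by rw [hg]; omega)]
      simp
    | succ t =>
      have h := ih (k := k + 1) (t := t) (by simpa using ht)
      rw [List.getElem?_append_right (by rw [hg, Nat.succ_mul]; omega), hg, Nat.succ_mul,
        show t * B + B + j - B = t * B + j by omega, h, show k + (t + 1) = k + 1 + t by omega]

section

variable (fl : List (ℕ × ℕ)) (s : List ℕ) (goal : List (Option ℕ)) (steps : List (Bool × RawAction))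

theorem length_nodes :
    (nodes fl s goal steps).length = pos fl.length steps.length fl.length + 1 := by
  simp only [nodes, List.length_append, List.length_map, List.length_singleton, pos,
    length_flatMap_zipIdx fun q : (Bool × RawAction) × ℕ => length_stepNodes fl q.2 q.1]
  omega

variable {fl s goal steps}

theorem nodes_init {f : ℕ} {e : ℕ × ℕ} (h : fl[f]? = some e) :
    (nodes fl s goal steps)[pos fl.length 0 f]? = some (initNode s e) := by
  have hf := (List.getElem?_eq_some_iff.1 h).1
  rw [nodes, pos, List.getElem?_append_left (by simpa using hf)]
  simp [h]

/-- The nodes of a step begin right after the fluents of block `t`, at offset `fl.length`. The three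
control nodes complete block `t`, and the updated fluents, at `j = 3 + f`, are the first nodes of
block `t + 1`. -/
theorem nodes_step {t j : ℕ} {x : Bool × RawAction} (h : steps[t]? = some x)
    (hj : j < fl.length + 3) :
    (nodes fl s goal steps)[pos fl.length t (fl.length + j)]? = (stepNodes fl t x)[j]? := by
  have ht := (List.getElem?_eq_some_iff.1 h).1
  have h1 : t * (fl.length + 3) + (fl.length + 3) ≤ steps.length * (fl.length + 3) := by
    rw [← Nat.succ_mul]; exact Nat.mul_le_mul_right _ ht
  have hlen := length_flatMap_zipIdx
    (fun q : (Bool × RawAction) × ℕ => length_stepNodes fl q.2 q.1) steps 0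
  rw [nodes, pos, List.getElem?_append_right (by simp; omega),
    List.getElem?_append_left (by rw [hlen]; simp; omega), List.length_map,
    show t * (fl.length + 3) + (fl.length + j) - fl.length = t * (fl.length + 3) + j by omega,
    getElem?_flatMap_zipIdx (fun q : (Bool × RawAction) × ℕ => length_stepNodes fl q.2 q.1) h hj,
    Nat.zero_add]

theorem nodes_goal : (nodes fl s goal steps)[pos fl.length steps.length fl.length]? =
    some (.conj (condNodes fl goal steps.length)) := by
  have hlen := length_flatMap_zipIdx
    (fun q : (Bool × RawAction) × ℕ => length_stepNodes fl q.2 q.1) steps 0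
  rw [nodes, pos, List.getElem?_append_right (by simp),
    List.getElem?_append_right (by rw [hlen]; simp), hlen, List.length_map]
  simp

theorem mem_condNodes_lt {p : List (Option ℕ)} {t j : ℕ} (h : j ∈ condNodes fl p t) :
    j < pos fl.length t fl.length := by
  simp only [condNodes, List.mem_map, List.mem_filter] at h
  obtain ⟨q, ⟨hq, -⟩, rfl⟩ := h
  have := List.snd_lt_of_mem_zipIdx hq
  simp only [pos]
  omega

/-- Every node is of one of the three kinds. -/
theorem exists_of_nodes {i : ℕ} {nd : Node} (h : (nodes fl s goal steps)[i]? = some nd) :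
    (∃ f e, fl[f]? = some e ∧ i = pos fl.length 0 f ∧ nd = initNode s e) ∨
    (∃ t x j, steps[t]? = some x ∧ j < fl.length + 3 ∧ i = pos fl.length t (fl.length + j) ∧
      (stepNodes fl t x)[j]? = some nd) ∨
    (i = pos fl.length steps.length fl.length ∧ nd = .conj (condNodes fl goal steps.length)) := by
  have hi := (List.getElem?_eq_some_iff.1 h).1
  rw [length_nodes] at hi
  by_cases h1 : i < fl.length
  · have he := List.getElem?_eq_getElem h1
    have := nodes_init (s := s) (goal := goal) (steps := steps) he
    have hp : pos fl.length 0 i = i := by simp [pos]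
    rw [hp, h] at this
    exact .inl ⟨i, _, he, hp.symm, Option.some.inj this⟩
  · by_cases h2 : i = pos fl.length steps.length fl.length
    · have := nodes_goal (fl := fl) (s := s) (goal := goal) (steps := steps)
      rw [← h2, h] at this
      exact .inr (.inr ⟨h2, Option.some.inj this⟩)
    · have hd := Nat.div_add_mod' (i - fl.length) (fl.length + 3)
      have hm := Nat.mod_lt (i - fl.length) (show 0 < fl.length + 3 by omega)
      have ht : (i - fl.length) / (fl.length + 3) < steps.length := by
        rw [Nat.div_lt_iff_lt_mul (by omega)]
        simp only [pos] at hi h2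
        omega
      have he := List.getElem?_eq_getElem ht
      have := nodes_step (s := s) (goal := goal) he hm
      have hp : i = pos fl.length ((i - fl.length) / (fl.length + 3))
          (fl.length + (i - fl.length) % (fl.length + 3)) := by
        simp only [pos]; omega
      rw [← hp, h] at this
      exact .inr (.inl ⟨_, _, _, he, hm, hp, this.symm⟩)

theorem stepNodes_three {t f : ℕ} {x : Bool × RawAction} {e : ℕ × ℕ} (h : fl[f]? = some e) :
    (stepNodes fl t x)[3 + f]? = some (updNode fl.length x.2.2 t (e, f)) := by
  rw [Nat.add_comm]
  simp [stepNodes, h]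

/-- Within a block the order is fluents, choice, application, negated application. A control node
refers only to earlier nodes of its block, and an updated fluent only to the preceding block. -/
theorem nodes_acyclic (i : ℕ) (h : i < (nodes fl s goal steps).length) :
    ∀ j ∈ ((nodes fl s goal steps)[i]).preds, j < i := by
  intro u hu
  have hnd := List.getElem?_eq_getElem h
  generalize (nodes fl s goal steps)[i] = nd at hnd hu
  rcases exists_of_nodes hnd with ⟨f, e, -, -, rfl⟩ | ⟨t, x, j, -, hj, rfl, hx⟩ | ⟨rfl, rfl⟩
  · unfold initNode at hu
    split_ifs at hu <;> simp [Node.preds] at hu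
  · match j with
    | 0 =>
      obtain rfl : (if x.1 = true then .input else .conj []) = nd := by simpa [stepNodes] using hx
      split_ifs at hu <;> simp [Node.preds] at hu
    | 1 =>
      obtain rfl : Node.conj (pos fl.length t fl.length :: condNodes fl x.2.1 t) = nd := by
        simpa [stepNodes] using hx
      have : u ≤ pos fl.length t fl.length := by
        rcases List.mem_cons.1 hu with rfl | hu
        · exact le_rfl
        · exact (mem_condNodes_lt hu).le
      simp only [pos] at this ⊢
      omega
    | 2 =>
      obtain rfl : Node.neg (pos fl.length t (fl.length + 1)) = nd := by
        simpa [stepNodes] using hx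
      simp only [Node.preds, List.mem_singleton, pos] at hu ⊢
      omega
    | f + 3 =>
      have hf : f < fl.length := by omega
      rw [Nat.add_comm f 3, stepNodes_three (List.getElem?_eq_getElem hf)] at hx
      obtain rfl := Option.some.inj hx
      simp only [updNode] at hu
      split_ifs at hu <;>
        simp only [Node.preds, List.mem_cons, List.not_mem_nil, or_false, pos] at hu ⊢ <;>
        omega
  · exact mem_condNodes_lt hu

end

/-- The circuit for a sequence of optional and mandatory actions. -/
def circuit (fl : List (ℕ × ℕ)) (s : List ℕ) (goal : List (Option ℕ))
    (steps : List (Bool × RawAction)) : Circuit where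
  nodes := nodes fl s goal steps
  acyclic := nodes_acyclic
  output := pos fl.length steps.length fl.length
  output_lt := by rw [length_nodes]; omega

/-- The weight of an assignment is the number of the optional steps that it chooses. -/
theorem weight_circuit (fl : List (ℕ × ℕ)) (s : List ℕ) (goal : List (Option ℕ))
    (steps : List (Bool × RawAction)) (α : ℕ → Bool) : (circuit fl s goal steps).weight α =
      (chosen steps 0 fun t => α (pos fl.length t fl.length)).length := by
  have hinj : Function.Injective fun t => pos fl.length t fl.length := by
    intro t t' h
    simpa [pos] using h
  have hnd : ((chosen steps 0 fun t => α (pos fl.length t fl.length)).map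
      fun q => pos fl.length q.2 fl.length).Nodup := by
    have h1 : (steps.zipIdx.map Prod.snd).Nodup := by
      rw [List.zipIdx_map_snd]; exact List.nodup_range'
    have h2 : ((chosen steps 0 fun t => α (pos fl.length t fl.length)).map Prod.snd).Nodup :=
      h1.sublist (List.Sublist.map _ List.filter_sublist)
    have h3 := h2.map hinj
    rwa [List.map_map] at h3
  rw [← List.length_map (f := fun q : (Bool × RawAction) × ℕ => pos fl.length q.2 fl.length),
    ← List.toFinset_card_of_nodup hnd, ← Set.ncard_coe_finset]
  unfold Circuit.weight
  congr 1
  ext i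
  simp only [Set.mem_ofPred_eq, List.coe_toFinset, chosen, List.mem_map, List.mem_filter,
    Bool.and_eq_true, List.mem_zipIdx_iff_getElem?]
  constructor
  · rintro ⟨hi, hα⟩
    rcases exists_of_nodes hi with ⟨f, e, -, -, hnd⟩ | ⟨t, x, j, hx, hj, rfl, hnd⟩ | ⟨-, hnd⟩
    · unfold initNode at hnd
      split_ifs at hnd
    · match j with
      | 0 =>
        have h : (if x.1 = true then Node.input else .conj []) = .input := by
          simpa [stepNodes] using hnd
        refine ⟨(x, t), ⟨hx, ?_, hα⟩, rfl⟩
        by_contra h'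
        simp [h'] at h
      | 1 => simp [stepNodes] at hnd
      | 2 => simp [stepNodes] at hnd
      | f + 3 =>
        rw [Nat.add_comm f 3, stepNodes_three (List.getElem?_eq_getElem (by omega))] at hnd
        have := Option.some.inj hnd
        unfold updNode at this
        split_ifs at this
    · simp at hnd
  · rintro ⟨⟨x, t⟩, ⟨hx, h1, h2⟩, rfl⟩
    refine ⟨?_, h2⟩
    have h := nodes_step (s := s) (goal := goal) hx (show 0 < fl.length + 3 by omega)
    have h1' : x.1 = true := h1
    simpa [circuit, stepNodes, h1'] using h

end Unfold
namespace Unfold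

/-! ### Correctness of the circuit -/

variable {F : Frame}

theorem mem_fluents_iff {v d : ℕ} :
    (v, d) ∈ fluents (List.ofFn F.dom) ↔ ∃ h : v < F.numVars, d ∈ F.dom ⟨v, h⟩ := by
  simp only [fluents, List.mem_flatMap, List.mem_map, Prod.mk.injEq, Prod.exists,
    List.mem_zipIdx_iff_getElem?, List.getElem?_ofFn]
  constructor
  · rintro ⟨D, v', h, d', hd, rfl, rfl⟩
    split_ifs at h with hv
    exact ⟨hv, (Option.some.inj h).symm ▸ hd⟩
  · rintro ⟨hv, hd⟩
    exact ⟨_, v, by rw [dif_pos hv], d, hd, rfl, rfl⟩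

theorem assigns_iff (p : Fin F.numVars → Option ℕ) (e : ℕ × ℕ) :
    assigns (List.ofFn p) e = true ↔ ∃ h : e.1 < F.numVars, p ⟨e.1, h⟩ = some e.2 := by
  simp only [assigns, decide_eq_true_eq, List.mem_zipIdx_iff_getElem?, List.getElem?_ofFn]
  split_ifs with h <;> simp [h]

theorem mentions_iff (p : Fin F.numVars → Option ℕ) (v : ℕ) :
    mentions (List.ofFn p) v = true ↔ ∃ h : v < F.numVars, p ⟨v, h⟩ ≠ none := by
  simp only [mentions, List.any_eq_true, decide_eq_true_eq, Prod.exists,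
    List.mem_zipIdx_iff_getElem?, List.getElem?_ofFn]
  constructor
  · rintro ⟨o, v', h, rfl, ho⟩
    split_ifs at h with hv
    exact ⟨hv, fun h' => ho ((Option.some.inj h).symm.trans h')⟩
  · rintro ⟨hv, ho⟩
    exact ⟨_, v, by rw [dif_pos hv], rfl, ho⟩

/-- The truth value of a fluent in a state. -/
def holds (s : F.State) (e : ℕ × ℕ) : Bool :=
  decide ((e.2, e.1) ∈ (List.ofFn s.1).zipIdx)

theorem holds_iff (s : F.State) (e : ℕ × ℕ) :
    holds s e = true ↔ ∃ h : e.1 < F.numVars, s.1 ⟨e.1, h⟩ = e.2 := by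
  simp only [holds, decide_eq_true_eq, List.mem_zipIdx_iff_getElem?, List.getElem?_ofFn]
  split_ifs with h <;> simp [h]

/-- Partial states take values in the domains only, so each of their conditions has its own fluent
node and none is lost. -/
theorem all_condNodes_iff {s : F.State} {p : F.PartialState} {val : ℕ → Bool} {t : ℕ}
    (h : ∀ f e, (fluents (List.ofFn F.dom))[f]? = some e →
      val (pos (fluents (List.ofFn F.dom)).length t f) = holds s e) :
    (condNodes (fluents (List.ofFn F.dom)) (List.ofFn p.1) t).all val = true ↔
      Frame.Meets s p := by
  simp only [condNodes, List.all_eq_true, List.mem_map, List.mem_filter, Prod.exists,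
    List.mem_zipIdx_iff_getElem?, assigns_iff, forall_exists_index, and_imp]
  constructor
  · intro h' v d hd
    obtain ⟨f, hf⟩ := List.getElem?_of_mem (mem_fluents_iff.2 ⟨v.2, p.2 v d hd⟩)
    have := h' _ v d f hf v.2 hd rfl
    rw [h f _ hf, holds_iff] at this
    exact this.2
  · rintro h' _ v d f hf hv hd rfl
    rw [h f _ hf, holds_iff]
    exact ⟨hv, h' _ _ hd⟩

/-- The values of the nodes for the fluents after a step. -/
theorem holds_step {s : F.State} {a : F.Action} {e : ℕ × ℕ} {app : Bool}
    (happ : app = true ↔ Frame.Meets s (Frame.Action.pre a)) :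
    holds (Frame.step s a) e = if assigns a.raw.2 e = true then holds s e || app
      else if mentions a.raw.2 e.1 = true then holds s e && !app else holds s e := by
  rw [Bool.eq_iff_iff, holds_iff]
  unfold Frame.step
  rw [Frame.Action.raw]
  cases app
  · rw [if_neg (by simpa using happ), ← holds_iff]
    split_ifs <;> simp
  · rw [if_pos (by simpa using happ)]
    simp only [Frame.overwrite, Frame.Action.post]
    split_ifs with h1 h2
    · obtain ⟨hv, h1⟩ := (assigns_iff _ _).1 h1
      simp [hv, h1]
    · obtain ⟨hv, h2⟩ := (mentions_iff _ _).1 h2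
      obtain ⟨d, hd⟩ := Option.ne_none_iff_exists'.1 h2
      have hne : d ≠ e.2 := fun h => h1 ((assigns_iff _ _).2 ⟨hv, h ▸ hd⟩)
      simp [hv, hd, hne]
    · rw [holds_iff]
      refine exists_congr fun hv => ?_
      have : a.2.1 ⟨e.1, hv⟩ = none := by
        by_contra h
        exact h2 ((mentions_iff _ _).2 ⟨hv, h⟩)
      rw [this, Option.getD_none]

/-- The steps as lists. -/
def rawSteps (steps : List (Bool × F.Action)) : List (Bool × RawAction) :=
  steps.map fun q => (q.1, q.2.raw)

theorem length_chosen_rawSteps (steps : List (Bool × F.Action)) (σ : ℕ → Bool) :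
    (chosen (rawSteps steps) 0 σ).length = (chosen steps 0 σ).length := by
  unfold chosen rawSteps
  rw [List.zipIdx_map, List.filter_map, List.length_map]
  rfl

section

variable (s : F.State) (goal : F.PartialState) (steps : List (Bool × F.Action)) (α : ℕ → Bool)

/-- The circuit for a sequence of optional and mandatory actions of a frame. -/
def planCircuit : Circuit :=
  circuit (fluents (List.ofFn F.dom)) (List.ofFn s.1) (List.ofFn goal.1) (rawSteps steps)

/-- The choices of an assignment to the input nodes. -/
def choice (F : Frame) (α : ℕ → Bool) (t : ℕ) : Bool :=
  α (pos (fluents (List.ofFn F.dom)).length t (fluents (List.ofFn F.dom)).length)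

/-- Induction on `t`: the fluents of block `t` describe the state after the first `t` steps, with
unchosen optional steps omitted. A step acts when it is chosen and its precondition holds; then
fluents in its postcondition become true and other fluents of the variables it mentions become
false. -/
theorem values_fluent {t : ℕ} (ht : t ≤ steps.length) {f : ℕ} {e : ℕ × ℕ}
    (hf : (fluents (List.ofFn F.dom))[f]? = some e) :
    (planCircuit s goal steps).values α (planCircuit s goal steps).nodes.length
      (pos (fluents (List.ofFn F.dom)).length t f) =
        holds (Frame.run s (selected (steps.take t) 0 (choice F α))) e := by
  set C := planCircuit s goal steps with hC
  set val := C.values α C.nodes.length with hval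
  set fl := fluents (List.ofFn F.dom) with hfl
  induction t generalizing f e with
  | zero =>
    have hn : C.nodes[pos fl.length 0 f]? = some (initNode (List.ofFn s.1) e) := nodes_init hf
    rw [hval, C.values_eq α hn]
    have : Frame.run s (selected (steps.take 0) 0 (choice F α)) = s := rfl
    rw [this, initNode, holds]
    split_ifs with h <;> simp [Node.eval, h]
  | succ t ih =>
    have ih' := fun f e (hf : fl[f]? = some e) => ih (by omega) hf
    obtain ⟨x, hx⟩ : ∃ x, steps[t]? = some x := ⟨_, List.getElem?_eq_getElem ht⟩
    have hx' : (rawSteps steps)[t]? = some (x.1, x.2.raw) := by simp [rawSteps, hx]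
    set st := Frame.run s (selected (steps.take t) 0 (choice F α)) with hst
    have hnode : ∀ j nd, j < fl.length + 3 → (stepNodes fl t (x.1, x.2.raw))[j]? = some nd →
        val (pos fl.length t (fl.length + j)) =
          nd.eval (α (pos fl.length t (fl.length + j))) val := fun j nd hj h =>
      C.values_eq α ((nodes_step hx' hj).trans h)
    -- For a mandatory step this node is the empty conjunction, hence true; for an optional one it
    -- is an input node.
    have h0 : val (pos fl.length t fl.length) = (!x.1 || choice F α t) := by
      rw [show pos fl.length t fl.length = pos fl.length t (fl.length + 0) from rfl,
        hnode 0 _ (by omega) (by rw [stepNodes, List.getElem?_cons_zero])]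
      cases h : x.1
      · simp [Node.eval]
      · simp [Node.eval, choice, hfl]
    have h1 : val (pos fl.length t (fl.length + 1)) = true ↔
        (!x.1 || choice F α t) = true ∧ Frame.Meets st (Frame.Action.pre x.2) := by
      rw [hnode 1 _ (by omega) (by rw [stepNodes, List.getElem?_cons_succ,
        List.getElem?_cons_zero])]
      rw [Node.eval, List.all_cons, Bool.and_eq_true, h0]
      exact and_congr_right fun _ => all_condNodes_iff ih'
    have h2 : val (pos fl.length t (fl.length + 2)) = !val (pos fl.length t (fl.length + 1)) := by
      rw [hnode 2 _ (by omega) (by rw [stepNodes, List.getElem?_cons_succ,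
        List.getElem?_cons_succ, List.getElem?_cons_zero])]
      rfl
    have hf' := (List.getElem?_eq_some_iff.1 hf).1
    have h3 := hnode (3 + f) _ (by omega) (stepNodes_three hf)
    rw [show pos fl.length t (fl.length + (3 + f)) = pos fl.length (t + 1) f by
      simp only [pos]; ring] at h3
    rw [h3]
    have htake : steps.take (t + 1) = steps.take t ++ [x] := by
      rw [List.take_add_one, hx]; rfl
    rw [htake, selected_concat, Frame.run_append, ← hst, List.length_take_of_le (by omega)]
    have hupd : (updNode fl.length x.2.raw.2 t (e, f)).eval (α (pos fl.length (t + 1) f)) val =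
        if assigns x.2.raw.2 e = true then holds st e || val (pos fl.length t (fl.length + 1))
        else if mentions x.2.raw.2 e.1 = true then
          holds st e && !val (pos fl.length t (fl.length + 1)) else holds st e := by
      unfold updNode
      have := ih' f e hf
      split_ifs <;> simp [Node.eval, this, h2]
    rw [hupd]
    -- An unchosen step is absent from the plan, and its application node is false, so all fluents
    -- are copied.
    cases hc : (!x.1 || choice F α t)
    · have h1' : val (pos fl.length t (fl.length + 1)) = false := by
        rw [← Bool.not_eq_true, h1, hc]; simp
      rw [h1']
      show _ = holds st e
      split_ifs <;> simp
    · rw [if_pos rfl]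
      refine (holds_step ?_).symm
      rw [h1, hc]; simp

theorem planCircuit_satisfies_iff : (planCircuit s goal steps).Satisfies α ↔
    Frame.Meets (Frame.run s (selected steps 0 (choice F α))) goal := by
  unfold Circuit.Satisfies
  have hn : (planCircuit s goal steps).nodes[(planCircuit s goal steps).output]? = some (.conj
      (condNodes (fluents (List.ofFn F.dom)) (List.ofFn goal.1) (rawSteps steps).length)) :=
    nodes_goal
  have hlen : (rawSteps steps).length = steps.length := by simp [rawSteps]
  rw [Circuit.values_eq _ α hn, Node.eval, hlen]
  refine all_condNodes_iff fun f e hf => ?_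
  rw [values_fluent s goal steps α le_rfl hf, List.take_length]

theorem exists_satisfies_iff (M : ℕ) :
    (∃ α, (planCircuit s goal steps).Satisfies α ∧ (planCircuit s goal steps).weight α ≤ M) ↔
      ∃ g p, Sel steps g p ∧ g.length ≤ M ∧ Frame.Meets (Frame.run s p) goal := by
  have hw : ∀ α, (planCircuit s goal steps).weight α =
      (chosen steps 0 (choice F α)).length := fun α => by
    rw [← length_chosen_rawSteps]; exact weight_circuit _ _ _ _ α
  constructor
  · rintro ⟨α, h1, h2⟩
    rw [planCircuit_satisfies_iff] at h1
    rw [hw] at h2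
    exact ⟨_, _, sel_selected steps 0 (choice F α), by rwa [List.length_map], h1⟩
  · rintro ⟨g, p, hs, hg, hp⟩
    obtain ⟨σ, h1, h2⟩ := hs.exists_selected 0
    set w := (fluents (List.ofFn F.dom)).length with hw'
    -- The choice node of step `t` has number `t * (w + 3) + w`, so the step is recovered by
    -- subtraction and division.
    have hσ : choice F (fun i => σ ((i - w) / (w + 3))) = σ := by
      funext t
      simp [choice, pos, ← hw']
    refine ⟨fun i => σ ((i - w) / (w + 3)), ?_, ?_⟩
    · rw [planCircuit_satisfies_iff, hσ, h1]; exact hp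
    · rw [hw, hσ, h2]; exact hg

end

/-! ### The step bound in unary, and the reduction to circuits. -/

/-- Doubling a unary number and adding a bit. -/
def double (u : List Bool) (b : Bool) : List Bool := u ++ u ++ if b = true then [true] else []

/-- The number `n` in unary. -/
def unary (n : ℕ) : List Bool := n.bits.reverse.foldl double []

theorem length_unary (n : ℕ) : (unary n).length = n := by
  unfold unary
  rw [List.foldl_reverse]
  induction n using Nat.strong_induction_on with
  | _ n ih =>
    rcases Nat.even_or_odd' n with ⟨m, rfl | rfl⟩
    · rcases Nat.eq_zero_or_pos m with rfl | hm
      · simp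
      · rw [Nat.bit0_bits _ (by omega), List.foldr_cons, double]
        simp only [List.length_append, ih m (by omega)]
        simp; omega
    · rw [Nat.bit1_bits, List.foldr_cons, double]
      simp only [List.length_append, ih m (by omega)]
      simp; omega

/-- The instance of weighted circuit satisfiability for an instance of plan reuse. -/
def toWSat (x : PlanModInstance) : WSatInstance where
  circuit := planCircuit x.init x.goal
    (slots (unary x.maxSteps) x.glue x.casePlan)
  k := if x.maxSteps = 0 then 1 else x.maxSteps
  k_pos := by split_ifs <;> omega

theorem toWSat_yes (x : PlanModInstance) :
    x.Reusable x.casePlan ↔ weightedCircuitSat.yes (toWSat x) := by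
  set l := slots (unary x.maxSteps) x.glue x.casePlan with hl
  have h : weightedCircuitSat.yes (toWSat x) ↔
      ∃ g p, Sel l g p ∧ g.length ≤ (toWSat x).k ∧
        Frame.Meets (Frame.run x.init p) x.goal := exists_satisfies_iff _ _ _ _
  rw [h]
  have hsel : ∀ g p : List x.frame.Action, g.length ≤ x.maxSteps →
      (Sel l g p ↔ Interleaving x.casePlan g p ∧ ∀ a ∈ g, a ∈ x.glue) := fun g p hg =>
    sel_slots_iff (by rwa [length_unary])
  constructor
  · rintro ⟨g, p, hlen, hg, hp, hgoal⟩
    refine ⟨g, p, (hsel g p hlen).2 ⟨hp, hg⟩, hlen.trans ?_, hgoal⟩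
    simp only [toWSat]
    split_ifs <;> omega
  · rintro ⟨g, p, hs, hlen, hgoal⟩
    -- Circuit satisfiability demands `k ≥ 1`, so `M = 0` is mapped to `k = 1`. This is harmless:
    -- for `M = 0` the gaps are empty and there is no optional step to choose.
    have hlen' : g.length ≤ x.maxSteps := by
      simp only [toWSat] at hlen
      split_ifs at hlen with h0
      · have : ∀ a ∈ g, (true, a) ∈ l := hs.interleaving.2
        cases g with
        | nil => simp
        | cons a g =>
          have := this a (by simp)
          rw [hl, h0] at this
          simp [slots, gap, unary] at this
      · exact hlen
    obtain ⟨hp, hg⟩ := (hsel g p hlen').1 hs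
    exact ⟨g, p, hlen', hg, hp, hgoal⟩

end Unfold
namespace Unfold

/-! ### The circuit in polynomial time -/

theorem double_length_le (l u : List Bool) : u.length ≤ (l.foldl double u).length := by
  induction l generalizing u with
  | nil => exact le_rfl
  | cons b l ih =>
    refine le_trans ?_ (ih (double u b))
    simp only [double, List.length_append]
    omega

/-- Converting binary to unary may take exponential time in the input size, but is polynomial once
the value is added to the measure. The intermediate lists only grow, so the length `f a` of the
final one bounds them all. -/
theorem timeBdd_unary {α : Type} [Coding α] {f : α → ℕ} (hf : PTime f) :
    TimeBdd (fun a => csize a + f a) fun a => unary (f a) := by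
  have hμ : PolyBdd (fun a => csize a + f a) fun a => csize a :=
    PolyBdd.refl.mono fun a => Nat.le_add_right _ _
  have hb : PTime fun a => (f a).bits := PTime.code_congr hf fun _ => rfl
  refine TimeBdd.foldl (g := fun _ u b => double u b) (B := fun a => 1 + (csize a + f a) * (1 + 3))
    hμ (hb.reverse.toComp id hμ) ((PTime.const []).toComp id hμ)
    (.append (.append (.fst (.snd .id)) (.fst (.snd .id)))
      (.ite (.decide_of_bool (.snd (.snd .id))) (.const _) (.const _)))
    ((PolyBdd.const _).add (PolyBdd.refl.mul (.const _))) fun a l' hl' => ?_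
  refine (csize_list_le (K := 3) fun b _ => by
    cases b <;> simp [csize, Coding.code, Data.size]).trans ?_
  have h : (l'.foldl double []).length ≤ f a := by
    obtain ⟨m, hm⟩ := hl'
    have h1 := length_unary (f a)
    rw [unary, ← hm, List.foldl_append] at h1
    exact (double_length_le m _).trans h1.le
  exact Nat.add_le_add_left (Nat.mul_le_mul_right _ (h.trans (Nat.le_add_left _ _))) _

/-- `condNodes` for an arbitrary numbering of the nodes. -/
def condNodesAt (P : ℕ → ℕ → ℕ) (fl : List (ℕ × ℕ)) (p : List (Option ℕ)) (t : ℕ) : List ℕ :=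
  (fl.zipIdx.filter fun q => assigns p q.1).map fun q => P t q.2

/-- `updNode` for an arbitrary numbering of the nodes. -/
def updNodeAt (P : ℕ → ℕ → ℕ) (w : ℕ) (p : List (Option ℕ)) (t : ℕ) (q : (ℕ × ℕ) × ℕ) : Node :=
  if assigns p q.1 = true then .disj [P t q.2, P t (w + 1)]
  else if mentions p q.1.1 = true then .conj [P t q.2, P t (w + 2)]
  else .conj [P t q.2]

/-- `stepNodes` for an arbitrary numbering of the nodes. -/
def stepNodesAt (P : ℕ → ℕ → ℕ) (fl : List (ℕ × ℕ)) (t : ℕ) (x : Bool × RawAction) : List Node :=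
  (if x.1 = true then .input else .conj []) ::
    .conj (P t fl.length :: condNodesAt P fl x.2.1 t) ::
    .neg (P t (fl.length + 1)) ::
    fl.zipIdx.map fun q => updNodeAt P fl.length x.2.2 t q

/-- `nodes` for an arbitrary numbering of the nodes. -/
def nodesAt (P : ℕ → ℕ → ℕ) (fl : List (ℕ × ℕ)) (s : List ℕ) (goal : List (Option ℕ))
    (steps : List (Bool × RawAction)) : List Node :=
  fl.map (initNode s) ++ ((steps.zipIdx.flatMap fun q => stepNodesAt P fl q.2 q.1) ++
    [.conj (condNodesAt P fl goal steps.length)])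

/-- Only positions in blocks `0` to `steps.length` with offset below `fl.length + 3` are used, so
`pos` may be replaced by the list search `pairIndex`. -/
theorem nodesAt_eq {P : ℕ → ℕ → ℕ} {fl : List (ℕ × ℕ)} {s : List ℕ} {goal : List (Option ℕ)}
    {steps : List (Bool × RawAction)}
    (hP : ∀ t ≤ steps.length, ∀ r < fl.length + 3, P t r = pos fl.length t r) :
    nodesAt P fl s goal steps = nodes fl s goal steps := by
  have hc : ∀ t ≤ steps.length, ∀ p, condNodesAt P fl p t = condNodes fl p t := fun t ht p =>
    List.map_congr_left fun q hq => hP t ht _ (by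
      have := List.snd_lt_of_mem_zipIdx (List.mem_of_mem_filter hq)
      omega)
  unfold nodesAt nodes
  rw [hc _ le_rfl, List.flatMap_congr fun q hq => ?_]
  have ht : q.2 ≤ steps.length := by
    have := List.snd_lt_of_mem_zipIdx hq
    omega
  unfold stepNodesAt stepNodes
  rw [hc _ ht, hP _ ht _ (by omega), hP _ ht _ (by omega), List.map_congr_left fun e he => ?_]
  have := List.snd_lt_of_mem_zipIdx he
  unfold updNodeAt updNode
  rw [hP _ ht _ (by omega), hP _ ht _ (by omega), hP _ ht _ (by omega)]

section

variable {α : Type} [Coding α]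

theorem ptime_conj {l : α → List ℕ} (hl : PTime l) : PTime fun a => Node.conj (l a) :=
  PTime.code_congr (f := fun a => (2, l a)) (.pair (.const 2) hl) fun _ => rfl

theorem ptime_disj {l : α → List ℕ} (hl : PTime l) : PTime fun a => Node.disj (l a) :=
  PTime.code_congr (f := fun a => (3, l a)) (.pair (.const 3) hl) fun _ => rfl

theorem ptime_neg {i : α → ℕ} (hi : PTime i) : PTime fun a => Node.neg (i a) :=
  PTime.code_congr (f := fun a => (1, [i a])) (.pair (.const 1) (.cons hi (.const []))) fun _ => rfl

theorem ptime_fluents {D : α → List (List ℕ)} (hD : PTime D) : PTime fun a => fluents (D a) :=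
  .flatMap (g := fun _ (q : List ℕ × ℕ) => q.1.map fun d => (q.2, d)) hD.zipIdx
    (.map (g := fun (p : α × List ℕ × ℕ) d => (p.2.2, d)) (.fst (.snd .id))
      (.pair (.snd (.snd (.fst .id))) (.snd .id)))

theorem ptime_assigns {p : α → List (Option ℕ)} {e : α → ℕ × ℕ} (hp : PTime p) (he : PTime e) :
    PTime fun a => assigns (p a) (e a) := .mem (.pair (.some he.snd) he.fst) hp.zipIdx

theorem ptime_mentions {p : α → List (Option ℕ)} {v : α → ℕ} (hp : PTime p) (hv : PTime v) :
    PTime fun a => mentions (p a) (v a) :=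
  .any hp.zipIdx (.and (.eq (.snd (.snd .id)) (hv.comp (.fst .id)))
    (.not (.eq (.fst (.snd .id)) (.const none))))

theorem ptime_initNode {s : α → List ℕ} {e : α → ℕ × ℕ} (hs : PTime s) (he : PTime e) :
    PTime fun a => initNode (s a) (e a) :=
  .ite (.mem (.pair he.snd he.fst) hs.zipIdx) (.const _) (.const _)

theorem ptime_condNodesAt {P : α → ℕ → ℕ → ℕ} {fl : α → List (ℕ × ℕ)} {p : α → List (Option ℕ)}
    {t : α → ℕ} (hP : PTime fun q : α × ℕ × ℕ => P q.1 q.2.1 q.2.2) (hfl : PTime fl) (hp : PTime p)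
    (ht : PTime t) : PTime fun a => condNodesAt (P a) (fl a) (p a) (t a) :=
  .map (g := fun a (q : (ℕ × ℕ) × ℕ) => P a (t a) q.2)
    (.filter (p := fun a (q : (ℕ × ℕ) × ℕ) => assigns (p a) q.1) hfl.zipIdx
      (ptime_assigns (hp.comp (.fst .id)) (.fst (.snd .id))))
    (hP.comp (.pair (.fst .id) (.pair (ht.comp (.fst .id)) (.snd (.snd .id)))))

theorem ptime_updNodeAt {P : α → ℕ → ℕ → ℕ} {w : α → ℕ} {p : α → List (Option ℕ)} {t : α → ℕ}
    {q : α → (ℕ × ℕ) × ℕ} (hP : PTime fun q : α × ℕ × ℕ => P q.1 q.2.1 q.2.2) (hw : PTime w)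
    (hp : PTime p) (ht : PTime t) (hq : PTime q) :
    PTime fun a => updNodeAt (P a) (w a) (p a) (t a) (q a) := by
  have h : ∀ {r : α → ℕ}, PTime r → PTime fun a => P a (t a) (r a) := fun hr =>
    hP.comp (.pair .id (.pair ht hr))
  exact .ite (.decide_of_bool (ptime_assigns hp hq.fst))
    (ptime_disj (.cons (h hq.snd) (.cons (h hw.succ) (.const []))))
    (.ite (.decide_of_bool (ptime_mentions hp hq.fst.fst))
      (ptime_conj (.cons (h hq.snd) (.cons (h hw.succ.succ) (.const []))))
      (ptime_conj (.cons (h hq.snd) (.const []))))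

theorem ptime_stepNodesAt {P : α → ℕ → ℕ → ℕ} {fl : α → List (ℕ × ℕ)} {t : α → ℕ}
    {x : α → Bool × RawAction} (hP : PTime fun q : α × ℕ × ℕ => P q.1 q.2.1 q.2.2)
    (hfl : PTime fl) (ht : PTime t) (hx : PTime x) :
    PTime fun a => stepNodesAt (P a) (fl a) (t a) (x a) := by
  have h : ∀ {r : α → ℕ}, PTime r → PTime fun a => P a (t a) (r a) := fun hr =>
    hP.comp (.pair .id (.pair ht hr))
  have h1 : PTime fun a => if (x a).1 = true then Node.input else Node.conj [] :=
    .ite (.decide_of_bool hx.fst) (.const _) (.const _)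
  have h2 : PTime fun a => Node.conj (P a (t a) (fl a).length ::
      condNodesAt (P a) (fl a) (x a).2.1 (t a)) :=
    ptime_conj (.cons (h hfl.length) (ptime_condNodesAt hP hfl hx.snd.fst ht))
  have h3 : PTime fun a => Node.neg (P a (t a) ((fl a).length + 1)) :=
    ptime_neg (h hfl.length.succ)
  have hP' : PTime fun q : (α × (ℕ × ℕ) × ℕ) × ℕ × ℕ => P q.1.1 q.2.1 q.2.2 :=
    hP.comp (f := fun q : (α × (ℕ × ℕ) × ℕ) × ℕ × ℕ => (q.1.1, q.2))
      (.pair (.fst (.fst .id)) (.snd .id))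
  have h4 : PTime fun q : α × (ℕ × ℕ) × ℕ =>
      updNodeAt (P q.1) (fl q.1).length (x q.1).2.2 (t q.1) q.2 := by
    have hw : PTime fun q : α × (ℕ × ℕ) × ℕ => (fl q.1).length := hfl.length.comp (.fst .id)
    have hp : PTime fun q : α × (ℕ × ℕ) × ℕ => (x q.1).2.2 := hx.snd.snd.comp (.fst .id)
    have ht' : PTime fun q : α × (ℕ × ℕ) × ℕ => t q.1 := ht.comp (.fst .id)
    have hq : PTime fun q : α × (ℕ × ℕ) × ℕ => q.2 := .snd .id
    have h := ptime_updNodeAt (P := fun q : α × (ℕ × ℕ) × ℕ => P q.1)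
      (w := fun q => (fl q.1).length) (p := fun q => (x q.1).2.2) (t := fun q => t q.1)
      (q := fun q => q.2) hP' hw hp ht' hq
    exact h
  exact .cons h1 (.cons h2 (.cons h3 (.map hfl.zipIdx h4)))

theorem ptime_nodesAt {P : α → ℕ → ℕ → ℕ} {fl : α → List (ℕ × ℕ)} {s : α → List ℕ}
    {goal : α → List (Option ℕ)} {steps : α → List (Bool × RawAction)}
    (hP : PTime fun q : α × ℕ × ℕ => P q.1 q.2.1 q.2.2) (hfl : PTime fl) (hs : PTime s)
    (hgoal : PTime goal) (hsteps : PTime steps) :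
    PTime fun a => nodesAt (P a) (fl a) (s a) (goal a) (steps a) := by
  have hP' : PTime fun q : (α × (Bool × RawAction) × ℕ) × ℕ × ℕ => P q.1.1 q.2.1 q.2.2 :=
    hP.comp (f := fun q : (α × (Bool × RawAction) × ℕ) × ℕ × ℕ => (q.1.1, q.2))
      (.pair (.fst (.fst .id)) (.snd .id))
  have h : PTime fun q : α × (Bool × RawAction) × ℕ => stepNodesAt (P q.1) (fl q.1) q.2.2 q.2.1 :=
    ptime_stepNodesAt (P := fun q => P q.1) hP' (hfl.comp (.fst .id)) (.snd (.snd .id))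
      (.fst (.snd .id))
  exact .append (.map hfl (ptime_initNode (hs.comp (.fst .id)) (.snd .id)))
    (.append (.flatMap hsteps.zipIdx h)
      (.cons (ptime_conj (ptime_condNodesAt hP hfl hgoal hsteps.length)) (.const [])))

theorem ptime_nodes_pos {fl : α → List (ℕ × ℕ)} {s : α → List ℕ}
    {goal : α → List (Option ℕ)} {steps : α → List (Bool × RawAction)}
    (hfl : PTime fl) (hs : PTime s) (hgoal : PTime goal) (hsteps : PTime steps) :
    (PTime fun a => nodes (fl a) (s a) (goal a) (steps a)) ∧
      PTime fun a => pos (fl a).length (steps a).length (fl a).length := by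
  -- One block more than there are steps, because the goal refers to the fluents after the last
  -- step.
  have hT : PTime fun a => List.range ((steps a).length + 1) :=
    PTime.range_length (f := fun a => (false, ([], [])) :: steps a) (.cons (.const _) hsteps)
  have hB : PTime fun a => List.range ((fl a).length + 3) :=
    PTime.range_length (f := fun a => (0, 0) :: (0, 0) :: (0, 0) :: fl a)
      (.cons (.const _) (.cons (.const _) (.cons (.const _) hfl)))
  have hP : PTime fun q : α × ℕ × ℕ =>
      pairIndex ((steps q.1).length + 1) ((fl q.1).length + 3) q.2.1 q.2.2 :=
    .pairIndex (hT.comp (.fst .id)) (hB.comp (.fst .id)) (.fst (.snd .id)) (.snd (.snd .id))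
  constructor
  · refine (ptime_nodesAt (P := fun a => pairIndex ((steps a).length + 1) ((fl a).length + 3)) hP
      hfl hs hgoal hsteps).congr fun a => nodesAt_eq fun t ht r hr => ?_
    exact pairIndex_eq (by omega) hr
  · refine (hP.comp (.pair .id (.pair hsteps.length hfl.length))).congr fun a => ?_
    exact pairIndex_eq (Nat.lt_succ_self _) (Nat.lt_add_of_pos_right (by omega))

theorem ptime_gap {A B : Type} [Coding A] [Coding B] {u : α → List B} {G : α → List A}
    (hu : PTime u) (hG : PTime G) : PTime fun a => gap (u a) (G a) :=
  .flatMap hu (.map (hG.comp (.fst .id)) (.pair (.const true) (.snd .id)))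

theorem ptime_slots {A B : Type} [Coding A] [Coding B] {u : α → List B} {G c : α → List A}
    (hu : PTime u) (hG : PTime G) (hc : PTime c) : PTime fun a => slots (u a) (G a) (c a) :=
  .append (.flatMap hc (.append ((ptime_gap hu hG).comp (.fst .id))
    (.cons (.pair (.const false) (.snd .id)) (.const [])))) (ptime_gap hu hG)

end

/-- The list version of `toWSat`. -/
def rawWSat (a : RawPlanMod × List Bool) : List Node × ℕ × ℕ :=
  let steps := slots a.2 a.1.2.2.2.1 a.1.2.2.1.2.2
  (nodes (fluents a.1.1) a.1.2.1.1 a.1.2.1.2.1 steps,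
    pos (fluents a.1.1).length steps.length (fluents a.1.1).length,
    if a.1.2.2.2.2 = 0 then 1 else a.1.2.2.2.2)

theorem ptime_rawWSat : PTime rawWSat := by
  have hx : PTime fun a : RawPlanMod × List Bool => a.1 := .fst .id
  have h := ptime_nodes_pos (ptime_fluents hx.fst) hx.snd.fst.fst hx.snd.fst.snd.fst
    (ptime_slots (.snd .id) hx.snd.snd.snd.fst hx.snd.snd.fst.snd.snd)
  exact .pair h.1 (.pair h.2 (.ite (.eq hx.snd.snd.snd.snd (.const 0)) (.const 1)
    hx.snd.snd.snd.snd))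

theorem rawSteps_slots {F : Frame} {B : Type} (u : List B) (G c : List F.Action) :
    rawSteps (slots u G c) = slots u (G.map Frame.Action.raw) (c.map Frame.Action.raw) := by
  simp [rawSteps, slots, gap, List.map_flatMap, List.flatMap_map, Function.comp_def]

theorem code_toWSat (x : PlanModInstance) :
    (Coding.code (rawWSat (x.raw, unary x.maxSteps)) : Data) = Coding.code (toWSat x) := by
  show Coding.code _ =
    Coding.code ((toWSat x).circuit.nodes, (toWSat x).circuit.output, (toWSat x).k)
  congr 1
  simp only [rawWSat, PlanModInstance.raw, ← rawSteps_slots]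
  rfl

/-- The unary step bound is computed first, in time polynomial in size plus `M`; from the instance
and this list the circuit is built in ordinary polynomial time. -/
theorem comp_toWSat : Comp (ι := PlanModInstance)
    (fun x => (Coding.code x : Data).size + x.maxSteps) (fun x => Coding.code x)
    (fun x => Coding.code (toWSat x)) := by
  have hμ : PolyBdd (fun a : RawPlanMod => csize a + a.2.2.2.2) fun a => csize a :=
    PolyBdd.refl.mono fun a => Nat.le_add_right _ _
  have h1 : TimeBdd (fun a : RawPlanMod => csize a + a.2.2.2.2)
      fun a : RawPlanMod => (a, unary a.2.2.2.2) :=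
    Comp.pair hμ .refl (timeBdd_unary (.snd (.snd (.snd (.snd .id)))))
  obtain ⟨p, T, hT, h⟩ := TimeBdd.comp ptime_rawWSat h1 hμ
  have hraw : ∀ x : PlanModInstance, csize x.raw = (Coding.code x : Data).size := fun x => by
    rw [csize, x.code_raw]
  refine ⟨p, fun x => T x.raw, hT.comp _ (PolyBdd.refl.mono fun x => by rw [hraw]; rfl),
    fun x => ?_⟩
  have : OutputsWithin p (Coding.code x.raw) (Coding.code (rawWSat (x.raw, unary x.maxSteps)))
    (T x.raw) := h x.raw
  rwa [x.code_raw, code_toWSat] at this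

end Unfold

/-! ### Membership and hardness. -/

/-- With `L` in `R` the number `M` is at most the parameter; this bounds both the new parameter,
with `+ 1` for the case `M = 0`, and the time for writing `M` in unary. -/
theorem inWP_planMod {R : Finset Restriction} (hR : Restriction.L ∈ R) : InWP (planMod R) := by
  have hle : ∀ x : PlanModInstance, x.maxSteps ≤ parameter R x := fun x =>
    Finset.single_le_sum (f := fun r => match r with
      | Restriction.L => x.maxSteps
      | Restriction.V => x.numGlueVars
      | Restriction.D => x.numGlueValues
      | Restriction.A => x.numGlueActions) (fun _ _ => Nat.zero_le _) hR
  refine .of_comp Unfold.toWSat Unfold.toWSat_yes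
    (computable_add Computable.id (Computable.const 1)) (fun x => ?_) ?_
  · have := hle x
    show (if x.maxSteps = 0 then 1 else x.maxSteps) ≤ parameter R x + 1
    split_ifs <;> omega
  · obtain ⟨p, T, hT, h⟩ := Unfold.comp_toWSat
    refine ⟨p, T, hT.comp id (PolyBdd.refl.mono fun x => ?_), h⟩
    exact Nat.add_le_add_left (hle x) _

theorem wpHard_planMod (R : Finset Restriction) : WPHard (planMod R) := fun _ hP =>
  hP.trans (weightedCircuitSat_reducible_planMod R)

theorem wpHard_planModStar (R : Finset Restriction) : WPHard (planModStar R) := fun _ hP =>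
  hP.trans (weightedCircuitSat_reducible_planModStar R)

end PlanReuse

theorem mainTheorem8 :
    PlanReuse.WPComplete
      (PlanReuse.planMod {PlanReuse.Restriction.L, PlanReuse.Restriction.V,
        PlanReuse.Restriction.D, PlanReuse.Restriction.A}) ∧
    ∀ R : Finset PlanReuse.Restriction,
      (PlanReuse.WPHard (PlanReuse.planMod R) ∧
        (PlanReuse.InFPT (PlanReuse.planMod R) →
          ∀ P : PlanReuse.ParamProblem, PlanReuse.InWP P → PlanReuse.InFPT P)) ∧
      (PlanReuse.WPHard (PlanReuse.planModStar R) ∧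
        (PlanReuse.InFPT (PlanReuse.planModStar R) →
          ∀ P : PlanReuse.ParamProblem, PlanReuse.InWP P → PlanReuse.InFPT P)) :=
  ⟨⟨PlanReuse.inWP_planMod (by simp), PlanReuse.wpHard_planMod _⟩, fun R =>
    ⟨⟨PlanReuse.wpHard_planMod R,
      fun h P hP => .of_fptReducible (PlanReuse.wpHard_planMod R P hP) h⟩,
    PlanReuse.wpHard_planModStar R,
    fun h P hP => .of_fptReducible (PlanReuse.wpHard_planModStar R P hP) h⟩⟩
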